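/- Work over intuitionistic higher-order arithmetic (intuitionistic type theory with types built from unspecified base sets, $\mathbb{N}$ and the type of propositions by products and power sets, with comprehension, extensionality and the Peano axioms) together with the axiom of countable choice: if $S\subseteq\mathbb{N}\times B$ and for each $n\in\mathbb{N}$ there is $b\in B$ with $(n,b)\in S$, then there is a function $f:\mathbb{N}\to B$ with $(n,f(n))\in S$ for all $n$. Real numbers are (located, two-sided) Dedekind cuts of rationals, functions are total single-valued relations, $x\le y$ means $\neg(y<x)$, and $x\neq y$ denotes the positive inequality: $x<y$ or $y<x$ for reals, $d(x,y)>0$ in a metric space, and $\exists n\,(\alpha(n)\neq\beta(n))$ for sequences of natural numbers. A function $f:X\to\mathbb{R}$ is strongly extensional if $f(x)\neq f(y)$ implies $x\neq y$ for all $x,y\in X$. Weak Markov's principle (WMP) is the statement that every pseudo-positive real number is positive: for all $x\in\mathbb{R}$, if $$\forall y\in\mathbb{R}:\ \neg\neg(0<y)\ \vee\ \neg\neg(y<x),$$ then $0<x$. Proposition 2.2.7. Over this theory, WMP is equivalent to each of the following statements (that is, each of the two is derivable from the other; the statements 1 and 6, about all complete metric spaces, are taken as schemes, with one instance for each type of points).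 1. Every real-valued function on a complete metric space (one in which every Cauchy sequence converges) is strongly extensional. 2. Every real-valued function on Baire space $\mathbb{N}^{\mathbb{N}}$ is strongly extensional. 3. Every real-valued function on Cantor space $2^{\mathbb{N}}$ is strongly extensional. 4. Every real-valued function on $\mathbb{N}_\infty$, the space of all increasing (i.e. non-decreasing) binary sequences, is strongly extensional. 5. Every real-valued function on $[0,1]$ is strongly extensional. 6. If $a,b$ are points of a complete metric space and $X=\overline{\{a,b\}}$ is the closure of $\{a,b\}$ in that space, then every function $f:X\to\mathbb{R}$ is strongly extensional. -/

import Mathlib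

/-!
Constructive mathematics (intuitionistic logic with countable choice) as a formal system.

In classical logic weak Markov's principle and all the statements compared with it are true, so an
equivalence between them has content only as an equivalence over a constructive theory.  The theory
used here is intuitionistic higher-order arithmetic (intuitionistic type theory with natural
numbers, products and power types: the internal language of an elementary topos with a natural
numbers object), together with the axiom of countable choice.  Terms and formulas are intrinsically
typed with de Bruijn variables, and derivability is natural deduction.  All of analysis is built
inside the system: functions are graphs, rationals are coded by natural numbers, reals are Dedekind
cuts.
-/

namespace BISH

/-! ### Types, terms and formulas -/

/-- The types.  `atom i` is an unspecified set about which nothing is assumed, so that statements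
about all types are statements about arbitrary sets. -/
inductive Ty : Type
  | atom (i : ℕ) : Ty
  | nat : Ty
  | prop : Ty
  | prod (σ τ : Ty) : Ty
  | pow (σ : Ty) : Ty

/-- Contexts: the types of the free variables, the innermost one first. -/
abbrev Ctx : Type := List Ty

/-- De Bruijn variables of a given type in a given context. -/
inductive Var : Ctx → Ty → Type
  | zero {Γ : Ctx} {σ : Ty} : Var (σ :: Γ) σ
  | succ {Γ : Ctx} {σ τ : Ty} (x : Var Γ σ) : Var (τ :: Γ) σ

/-- Terms of a given type in a given context.  Formulas are the terms of type `prop`. -/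
inductive Tm : Ctx → Ty → Type
  | var {Γ : Ctx} {σ : Ty} (x : Var Γ σ) : Tm Γ σ
  | bot {Γ : Ctx} : Tm Γ .prop
  | and {Γ : Ctx} (φ ψ : Tm Γ .prop) : Tm Γ .prop
  | or {Γ : Ctx} (φ ψ : Tm Γ .prop) : Tm Γ .prop
  | imp {Γ : Ctx} (φ ψ : Tm Γ .prop) : Tm Γ .prop
  | all {Γ : Ctx} (σ : Ty) (φ : Tm (σ :: Γ) .prop) : Tm Γ .prop
  | ex {Γ : Ctx} (σ : Ty) (φ : Tm (σ :: Γ) .prop) : Tm Γ .prop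
  | eq {Γ : Ctx} {σ : Ty} (s t : Tm Γ σ) : Tm Γ .prop
  | mem {Γ : Ctx} {σ : Ty} (t : Tm Γ σ) (A : Tm Γ (.pow σ)) : Tm Γ .prop
  | compr {Γ : Ctx} {σ : Ty} (φ : Tm (σ :: Γ) .prop) : Tm Γ (.pow σ)
  | pair {Γ : Ctx} {σ τ : Ty} (s : Tm Γ σ) (t : Tm Γ τ) : Tm Γ (.prod σ τ)
  | fst {Γ : Ctx} {σ τ : Ty} (p : Tm Γ (.prod σ τ)) : Tm Γ σ
  | snd {Γ : Ctx} {σ τ : Ty} (p : Tm Γ (.prod σ τ)) : Tm Γ τ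
  | zero {Γ : Ctx} : Tm Γ .nat
  | succ {Γ : Ctx} (n : Tm Γ .nat) : Tm Γ .nat
  | add {Γ : Ctx} (m n : Tm Γ .nat) : Tm Γ .nat
  | mul {Γ : Ctx} (m n : Tm Γ .nat) : Tm Γ .nat

/-- Formulas. -/
abbrev Fm (Γ : Ctx) : Type := Tm Γ .prop

/-- Closed formulas. -/
abbrev Sentence : Type := Fm []

/-! ### Renaming and substitution -/

/-- A renaming extended below one binder. -/
def liftRen {Γ Δ : Ctx} (ρ : ∀ σ : Ty, Var Γ σ → Var Δ σ) (τ : Ty) :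
    ∀ σ : Ty, Var (τ :: Γ) σ → Var (τ :: Δ) σ
  | _, .zero => .zero
  | _, .succ x => .succ (ρ _ x)

/-- Renaming of the free variables. -/
def Tm.rename : {Γ Δ : Ctx} → {σ : Ty} →
    (∀ τ : Ty, Var Γ τ → Var Δ τ) → Tm Γ σ → Tm Δ σ
  | _, _, _, ρ, .var x => .var (ρ _ x)
  | _, _, _, _, .bot => .bot
  | _, _, _, ρ, .and φ ψ => .and (φ.rename ρ) (ψ.rename ρ)
  | _, _, _, ρ, .or φ ψ => .or (φ.rename ρ) (ψ.rename ρ)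
  | _, _, _, ρ, .imp φ ψ => .imp (φ.rename ρ) (ψ.rename ρ)
  | _, _, _, ρ, .all σ φ => .all σ (φ.rename (liftRen ρ σ))
  | _, _, _, ρ, .ex σ φ => .ex σ (φ.rename (liftRen ρ σ))
  | _, _, _, ρ, .eq s t => .eq (s.rename ρ) (t.rename ρ)
  | _, _, _, ρ, .mem t A => .mem (t.rename ρ) (A.rename ρ)
  | _, _, _, ρ, .compr φ => .compr (φ.rename (liftRen ρ _))
  | _, _, _, ρ, .pair s t => .pair (s.rename ρ) (t.rename ρ)
  | _, _, _, ρ, .fst p => .fst (p.rename ρ)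
  | _, _, _, ρ, .snd p => .snd (p.rename ρ)
  | _, _, _, _, .zero => .zero
  | _, _, _, ρ, .succ n => .succ (n.rename ρ)
  | _, _, _, ρ, .add m n => .add (m.rename ρ) (n.rename ρ)
  | _, _, _, ρ, .mul m n => .mul (m.rename ρ) (n.rename ρ)

/-- Weakening: the same term in a context with one more (innermost) variable. -/
def Tm.w {Γ : Ctx} {σ τ : Ty} (t : Tm Γ σ) : Tm (τ :: Γ) σ :=
  t.rename fun _ x => .succ x

/-- A substitution extended below one binder. -/
def liftSub {Γ Δ : Ctx} (s : ∀ σ : Ty, Var Γ σ → Tm Δ σ) (τ : Ty) :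
    ∀ σ : Ty, Var (τ :: Γ) σ → Tm (τ :: Δ) σ
  | _, .zero => .var .zero
  | _, .succ x => (s _ x).w

/-- Simultaneous substitution of terms for the free variables. -/
def Tm.subst : {Γ Δ : Ctx} → {σ : Ty} →
    (∀ τ : Ty, Var Γ τ → Tm Δ τ) → Tm Γ σ → Tm Δ σ
  | _, _, _, s, .var x => s _ x
  | _, _, _, _, .bot => .bot
  | _, _, _, s, .and φ ψ => .and (φ.subst s) (ψ.subst s)
  | _, _, _, s, .or φ ψ => .or (φ.subst s) (ψ.subst s)
  | _, _, _, s, .imp φ ψ => .imp (φ.subst s) (ψ.subst s)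
  | _, _, _, s, .all σ φ => .all σ (φ.subst (liftSub s σ))
  | _, _, _, s, .ex σ φ => .ex σ (φ.subst (liftSub s σ))
  | _, _, _, s, .eq t u => .eq (t.subst s) (u.subst s)
  | _, _, _, s, .mem t A => .mem (t.subst s) (A.subst s)
  | _, _, _, s, .compr φ => .compr (φ.subst (liftSub s _))
  | _, _, _, s, .pair t u => .pair (t.subst s) (u.subst s)
  | _, _, _, s, .fst p => .fst (p.subst s)
  | _, _, _, s, .snd p => .snd (p.subst s)
  | _, _, _, _, .zero => .zero
  | _, _, _, s, .succ n => .succ (n.subst s)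
  | _, _, _, s, .add m n => .add (m.subst s) (n.subst s)
  | _, _, _, s, .mul m n => .mul (m.subst s) (n.subst s)

/-- The substitution that replaces the innermost variable by `t`. -/
def instSub {Γ : Ctx} {τ : Ty} (t : Tm Γ τ) : ∀ σ : Ty, Var (τ :: Γ) σ → Tm Γ σ
  | _, .zero => t
  | _, .succ x => .var x

/-- `φ.inst t` replaces the innermost variable of `φ` by `t`. -/
def Tm.inst {Γ : Ctx} {σ τ : Ty} (φ : Tm (τ :: Γ) σ) (t : Tm Γ τ) : Tm Γ σ :=
  φ.subst (instSub t)

/-! ### Abbreviations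

Bodies of quantifiers and comprehensions are written as functions of the bound variable; terms that
come from outside a binder are weakened by `.w`, once for each binder that is crossed. -/

infix:50 "≐" => Tm.eq
infix:50 "∊" => Tm.mem
infixr:35 "⋏" => Tm.and
infixr:30 "⋎" => Tm.or
infixr:25 "⇛" => Tm.imp

/-- Negation. -/
abbrev neg {Γ : Ctx} (φ : Fm Γ) : Fm Γ := φ ⇛ .bot

/-- Equivalence. -/
abbrev biimp {Γ : Ctx} (φ ψ : Fm Γ) : Fm Γ := (φ ⇛ ψ) ⋏ (ψ ⇛ φ)

/-- For all `x` of type `σ`. -/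
abbrev All {Γ : Ctx} (σ : Ty) (φ : Tm (σ :: Γ) σ → Fm (σ :: Γ)) : Fm Γ :=
  .all σ (φ (.var .zero))

/-- There is `x` of type `σ`. -/
abbrev Ex {Γ : Ctx} (σ : Ty) (φ : Tm (σ :: Γ) σ → Fm (σ :: Γ)) : Fm Γ :=
  .ex σ (φ (.var .zero))

/-- The set of all `x` of type `σ` with the given property. -/
abbrev SetOf {Γ : Ctx} (σ : Ty) (φ : Tm (σ :: Γ) σ → Fm (σ :: Γ)) : Tm Γ (.pow σ) :=
  .compr (φ (.var .zero))

/-- For all `x` in `A`. -/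
abbrev AllIn {Γ : Ctx} {σ : Ty} (A : Tm Γ (.pow σ)) (φ : Tm (σ :: Γ) σ → Fm (σ :: Γ)) : Fm Γ :=
  All σ fun x => (x ∊ A.w) ⇛ φ x

/-- There is `x` in `A`. -/
abbrev ExIn {Γ : Ctx} {σ : Ty} (A : Tm Γ (.pow σ)) (φ : Tm (σ :: Γ) σ → Fm (σ :: Γ)) : Fm Γ :=
  Ex σ fun x => (x ∊ A.w) ⋏ φ x

/-- The set of all elements of the type `σ`. -/
def univ {Γ : Ctx} (σ : Ty) : Tm Γ (.pow σ) := SetOf σ fun x => x ≐ x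

/-- Cartesian product of sets. -/
def times {Γ : Ctx} {σ τ : Ty} (A : Tm Γ (.pow σ)) (B : Tm Γ (.pow τ)) :
    Tm Γ (.pow (.prod σ τ)) :=
  SetOf (.prod σ τ) fun p => (p.fst ∊ A.w) ⋏ (p.snd ∊ B.w)

/-- Inclusion of sets. -/
def subset {Γ : Ctx} {σ : Ty} (A B : Tm Γ (.pow σ)) : Fm Γ :=
  AllIn A fun x => x ∊ B.w

/-- `F` is (the graph of) a function from `A` to `B`. -/
def IsFun {Γ : Ctx} {σ τ : Ty} (A : Tm Γ (.pow σ)) (B : Tm Γ (.pow τ))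
    (F : Tm Γ (.pow (.prod σ τ))) : Fm Γ :=
  subset F (times A B) ⋏
  (AllIn A fun x => Ex τ fun y => .pair x.w y ∊ F.w.w) ⋏
  (All σ fun x => All τ fun y => All τ fun z =>
    (.pair x.w.w y.w ∊ F.w.w.w) ⇛ (.pair x.w.w z ∊ F.w.w.w) ⇛ (y.w ≐ z))

/-! ### Derivability -/

/-- `Derives H φ`: the formula `φ` is derivable from the hypotheses `H` in intuitionistic
higher-order arithmetic with countable choice. -/
inductive Derives : {Γ : Ctx} → Set (Fm Γ) → Fm Γ → Prop
  -- intuitionistic natural deduction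
  | hyp {Γ : Ctx} {H : Set (Fm Γ)} {φ : Fm Γ} : φ ∈ H → Derives H φ
  | botE {Γ : Ctx} {H : Set (Fm Γ)} {φ : Fm Γ} : Derives H .bot → Derives H φ
  | andI {Γ : Ctx} {H : Set (Fm Γ)} {φ ψ : Fm Γ} :
      Derives H φ → Derives H ψ → Derives H (φ ⋏ ψ)
  | andE₁ {Γ : Ctx} {H : Set (Fm Γ)} {φ ψ : Fm Γ} : Derives H (φ ⋏ ψ) → Derives H φ
  | andE₂ {Γ : Ctx} {H : Set (Fm Γ)} {φ ψ : Fm Γ} : Derives H (φ ⋏ ψ) → Derives H ψ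
  | orI₁ {Γ : Ctx} {H : Set (Fm Γ)} {φ ψ : Fm Γ} : Derives H φ → Derives H (φ ⋎ ψ)
  | orI₂ {Γ : Ctx} {H : Set (Fm Γ)} {φ ψ : Fm Γ} : Derives H ψ → Derives H (φ ⋎ ψ)
  | orE {Γ : Ctx} {H : Set (Fm Γ)} {φ ψ χ : Fm Γ} : Derives H (φ ⋎ ψ) →
      Derives (insert φ H) χ → Derives (insert ψ H) χ → Derives H χ
  | impI {Γ : Ctx} {H : Set (Fm Γ)} {φ ψ : Fm Γ} :
      Derives (insert φ H) ψ → Derives H (φ ⇛ ψ)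
  | impE {Γ : Ctx} {H : Set (Fm Γ)} {φ ψ : Fm Γ} :
      Derives H (φ ⇛ ψ) → Derives H φ → Derives H ψ
  | allI {Γ : Ctx} {H : Set (Fm Γ)} {σ : Ty} {φ : Fm (σ :: Γ)} :
      Derives (Tm.w '' H) φ → Derives H (.all σ φ)
  | allE {Γ : Ctx} {H : Set (Fm Γ)} {σ : Ty} {φ : Fm (σ :: Γ)} (t : Tm Γ σ) :
      Derives H (.all σ φ) → Derives H (φ.inst t)
  | exI {Γ : Ctx} {H : Set (Fm Γ)} {σ : Ty} {φ : Fm (σ :: Γ)} (t : Tm Γ σ) :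
      Derives H (φ.inst t) → Derives H (.ex σ φ)
  | exE {Γ : Ctx} {H : Set (Fm Γ)} {σ : Ty} {φ : Fm (σ :: Γ)} {χ : Fm Γ} :
      Derives H (.ex σ φ) → Derives (insert φ (Tm.w '' H)) χ.w → Derives H χ
  -- equality
  | eqRefl {Γ : Ctx} {H : Set (Fm Γ)} {σ : Ty} (t : Tm Γ σ) : Derives H (t ≐ t)
  | eqSubst {Γ : Ctx} {H : Set (Fm Γ)} {σ : Ty} {s t : Tm Γ σ} (φ : Fm (σ :: Γ)) :
      Derives H (s ≐ t) → Derives H (φ.inst s) → Derives H (φ.inst t)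
  -- comprehension and extensionality
  | comprI {Γ : Ctx} {H : Set (Fm Γ)} {σ : Ty} {φ : Fm (σ :: Γ)} {t : Tm Γ σ} :
      Derives H (φ.inst t) → Derives H (t ∊ .compr φ)
  | comprE {Γ : Ctx} {H : Set (Fm Γ)} {σ : Ty} {φ : Fm (σ :: Γ)} {t : Tm Γ σ} :
      Derives H (t ∊ .compr φ) → Derives H (φ.inst t)
  | setExt {Γ : Ctx} {H : Set (Fm Γ)} {σ : Ty} {A B : Tm Γ (.pow σ)} :
      Derives H (All σ fun x => biimp (x ∊ A.w) (x ∊ B.w)) → Derives H (A ≐ B)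
  | propExt {Γ : Ctx} {H : Set (Fm Γ)} {φ ψ : Fm Γ} : Derives H (biimp φ ψ) → Derives H (φ ≐ ψ)
  -- pairs
  | fstPair {Γ : Ctx} {H : Set (Fm Γ)} {σ τ : Ty} (s : Tm Γ σ) (t : Tm Γ τ) :
      Derives H (.fst (.pair s t) ≐ s)
  | sndPair {Γ : Ctx} {H : Set (Fm Γ)} {σ τ : Ty} (s : Tm Γ σ) (t : Tm Γ τ) :
      Derives H (.snd (.pair s t) ≐ t)
  | pairEta {Γ : Ctx} {H : Set (Fm Γ)} {σ τ : Ty} (p : Tm Γ (.prod σ τ)) :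
      Derives H (.pair p.fst p.snd ≐ p)
  -- arithmetic
  | succNeZero {Γ : Ctx} {H : Set (Fm Γ)} {n : Tm Γ .nat} :
      Derives H (n.succ ≐ .zero) → Derives H .bot
  | succInj {Γ : Ctx} {H : Set (Fm Γ)} {m n : Tm Γ .nat} :
      Derives H (m.succ ≐ n.succ) → Derives H (m ≐ n)
  | addZero {Γ : Ctx} {H : Set (Fm Γ)} (m : Tm Γ .nat) : Derives H (m.add .zero ≐ m)
  | addSucc {Γ : Ctx} {H : Set (Fm Γ)} (m n : Tm Γ .nat) :
      Derives H (m.add n.succ ≐ (m.add n).succ)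
  | mulZero {Γ : Ctx} {H : Set (Fm Γ)} (m : Tm Γ .nat) : Derives H (m.mul .zero ≐ .zero)
  | mulSucc {Γ : Ctx} {H : Set (Fm Γ)} (m n : Tm Γ .nat) :
      Derives H (m.mul n.succ ≐ (m.mul n).add m)
  | induction {Γ : Ctx} {H : Set (Fm Γ)} {A : Tm Γ (.pow .nat)} :
      Derives H (.zero ∊ A) → Derives H (AllIn A fun n => n.succ ∊ A.w) →
      Derives H (All .nat fun n => n ∊ A.w)
  -- countable choice
  | countableChoice {Γ : Ctx} {H : Set (Fm Γ)} {σ : Ty} {S : Tm Γ (.pow (.prod .nat σ))} :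
      Derives H (All .nat fun n => Ex σ fun b => .pair n.w b ∊ S.w.w) →
      Derives H (Ex (.pow (.prod .nat σ)) fun F => IsFun (univ .nat) (univ σ) F ⋏ subset F S.w)

/-- Two sets of sentences are equivalent over the constructive theory: each sentence of either set
is derivable from the other set. -/
def Equivalent (S T : Set Sentence) : Prop :=
  (∀ φ ∈ T, Derives S φ) ∧ (∀ φ ∈ S, Derives T φ)

/-! ### Natural and rational numbers -/

/-- `m < n` for natural numbers. -/
def natLt {Γ : Ctx} (m n : Tm Γ .nat) : Fm Γ := Ex .nat fun k => m.w.add k.succ ≐ n.w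

/-- `m ≤ n` for natural numbers. -/
def natLe {Γ : Ctx} (m n : Tm Γ .nat) : Fm Γ := Ex .nat fun k => m.w.add k ≐ n.w

/-- The type of codes of rational numbers: `((a, b), c)` codes `(a - b) / (c + 1)`. -/
abbrev ratTy : Ty := .prod (.prod .nat .nat) .nat

/-- `p < q` for rational numbers: `(a - b) / c < (a' - b') / c'` is `a c' + b' c < a' c + b c'`. -/
def ratLt {Γ : Ctx} (p q : Tm Γ ratTy) : Fm Γ :=
  natLt ((p.fst.fst.mul q.snd.succ).add (q.fst.snd.mul p.snd.succ))
    ((q.fst.fst.mul p.snd.succ).add (p.fst.snd.mul q.snd.succ))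

/-- `p + q` for rational numbers; the new denominator is `(c + 1) (c' + 1) = (c c' + c + c') + 1`. -/
def ratAdd {Γ : Ctx} (p q : Tm Γ ratTy) : Tm Γ ratTy :=
  .pair
    (.pair ((p.fst.fst.mul q.snd.succ).add (q.fst.fst.mul p.snd.succ))
      ((p.fst.snd.mul q.snd.succ).add (q.fst.snd.mul p.snd.succ)))
    (((p.snd.mul q.snd).add p.snd).add q.snd)

/-- The rational number `0`. -/
def ratZero {Γ : Ctx} : Tm Γ ratTy := .pair (.pair .zero .zero) .zero

/-- The rational number `1`. -/
def ratOne {Γ : Ctx} : Tm Γ ratTy := .pair (.pair (.succ .zero) .zero) .zero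

/-! ### Real numbers -/

/-- The type of pairs `(L, U)` of sets of rationals. -/
abbrev realTy : Ty := .prod (.pow ratTy) (.pow ratTy)

/-- `x = (L, U)` is a Dedekind cut: `L` and `U` are inhabited, `L` is a rounded lower set and `U` a
rounded upper set, they are disjoint, and `q < r` implies `q ∈ L` or `r ∈ U`. -/
def IsReal {Γ : Ctx} (x : Tm Γ realTy) : Fm Γ :=
  (Ex ratTy fun q => q ∊ x.w.fst) ⋏
  (Ex ratTy fun q => q ∊ x.w.snd) ⋏
  (All ratTy fun q =>
    biimp (q ∊ x.w.fst) (Ex ratTy fun r => ratLt q.w r ⋏ (r ∊ x.w.w.fst))) ⋏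
  (All ratTy fun q =>
    biimp (q ∊ x.w.snd) (Ex ratTy fun r => ratLt r q.w ⋏ (r ∊ x.w.w.snd))) ⋏
  (All ratTy fun q => neg ((q ∊ x.w.fst) ⋏ (q ∊ x.w.snd))) ⋏
  (All ratTy fun q => All ratTy fun r =>
    ratLt q.w r ⇛ ((q.w ∊ x.w.w.fst) ⋎ (r ∊ x.w.w.snd)))

/-- The set of real numbers. -/
def reals {Γ : Ctx} : Tm Γ (.pow realTy) := SetOf realTy fun x => IsReal x

/-- `x < y` for real numbers: some rational lies strictly between them. -/
def realLt {Γ : Ctx} (x y : Tm Γ realTy) : Fm Γ :=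
  Ex ratTy fun q => (q ∊ x.w.snd) ⋏ (q ∊ y.w.fst)

/-- `x ≤ y` for real numbers, defined as `¬ (y < x)`. -/
def realLe {Γ : Ctx} (x y : Tm Γ realTy) : Fm Γ := neg (realLt y x)

/-- The positive inequality `x ≠ y` of real numbers: `x < y` or `y < x`. -/
def realNe {Γ : Ctx} (x y : Tm Γ realTy) : Fm Γ := realLt x y ⋎ realLt y x

/-- The rational number `q` as a real number. -/
def ofRat {Γ : Ctx} (q : Tm Γ ratTy) : Tm Γ realTy :=
  .pair (SetOf ratTy fun p => ratLt p q.w) (SetOf ratTy fun p => ratLt q.w p)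

/-- The sum of two real numbers. -/
def realAdd {Γ : Ctx} (x y : Tm Γ realTy) : Tm Γ realTy :=
  .pair
    (SetOf ratTy fun q => ExIn x.w.fst fun r => ExIn y.w.w.fst fun s =>
      ratLt q.w.w (ratAdd r.w s))
    (SetOf ratTy fun q => ExIn x.w.snd fun r => ExIn y.w.w.snd fun s =>
      ratLt (ratAdd r.w s) q.w.w)

/-- The closed unit interval. -/
def unitInterval {Γ : Ctx} : Tm Γ (.pow realTy) :=
  SetOf realTy fun x => IsReal x ⋏ realLe (ofRat ratZero) x ⋏ realLe x (ofRat ratOne)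

/-! ### Weak Markov's principle -/

/-- `x` is pseudo-positive: every real `y` satisfies `¬¬ (0 < y)` or `¬¬ (y < x)`. -/
def PseudoPositive {Γ : Ctx} (x : Tm Γ realTy) : Fm Γ :=
  AllIn reals fun y => neg (neg (realLt (ofRat ratZero) y)) ⋎ neg (neg (realLt y x.w))

/-- Weak Markov's principle: every pseudo-positive real number is positive. -/
def WMP : Sentence :=
  AllIn reals fun x => PseudoPositive x ⇛ realLt (ofRat ratZero) x

/-! ### Strong extensionality -/

/-- Every real-valued function `F` on the set `X` is strongly extensional, where the set of pairs
`N` is the inequality of `X`: if `F x ≠ F y` then `x ≠ y`. -/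
def AllStronglyExtensional {Γ : Ctx} {σ : Ty} (X : Tm Γ (.pow σ))
    (N : Tm Γ (.pow (.prod σ σ))) : Fm Γ :=
  All (.pow (.prod σ realTy)) fun F => IsFun X.w reals F ⇛
    (All σ fun x => All σ fun y => All realTy fun u => All realTy fun v =>
      (.pair x.w.w.w u.w ∊ F.w.w.w.w) ⇛ (.pair y.w.w v ∊ F.w.w.w.w) ⇛ realNe u.w v ⇛
        (.pair x.w.w.w y.w.w ∊ N.w.w.w.w.w))

/-- The inequality of real numbers as a set of pairs. -/
def realNeSet {Γ : Ctx} : Tm Γ (.pow (.prod realTy realTy)) :=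
  SetOf (.prod realTy realTy) fun p => realNe p.fst p.snd

/-! ### Metric spaces -/

/-- `D` is (the graph of) a metric on the set `X`. -/
def IsMetric {Γ : Ctx} {σ : Ty} (X : Tm Γ (.pow σ))
    (D : Tm Γ (.pow (.prod (.prod σ σ) realTy))) : Fm Γ :=
  IsFun (times X X) reals D ⋏
  (All σ fun x => All σ fun y => All realTy fun r =>
    (.pair (.pair x.w.w y.w) r ∊ D.w.w.w) ⇛
      (realLe (ofRat ratZero) r ⋏
        biimp (r ≐ ofRat ratZero) (x.w.w ≐ y.w) ⋏
        (.pair (.pair y.w x.w.w) r ∊ D.w.w.w))) ⋏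
  (All σ fun x => All σ fun y => All σ fun z =>
    All realTy fun r => All realTy fun s => All realTy fun t =>
      (.pair (.pair x.w.w.w.w.w y.w.w.w.w) r.w.w ∊ D.w.w.w.w.w.w) ⇛
      (.pair (.pair y.w.w.w.w z.w.w.w) s.w ∊ D.w.w.w.w.w.w) ⇛
      (.pair (.pair x.w.w.w.w.w z.w.w.w) t ∊ D.w.w.w.w.w.w) ⇛
        realLe t (realAdd r.w.w s.w))

/-- `d(x, y) < ε` for the metric `D` and a rational number `ε`. -/
def distLt {Γ : Ctx} {σ : Ty} (D : Tm Γ (.pow (.prod (.prod σ σ) realTy))) (x y : Tm Γ σ)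
    (ε : Tm Γ ratTy) : Fm Γ :=
  Ex realTy fun r => (.pair (.pair x.w y.w) r ∊ D.w) ⋏ realLt r (ofRat ε.w)

/-- The inequality of a metric space as a set of pairs: `x ≠ y` means `d(x, y) > 0`. -/
def metricNeSet {Γ : Ctx} {σ : Ty} (D : Tm Γ (.pow (.prod (.prod σ σ) realTy))) :
    Tm Γ (.pow (.prod σ σ)) :=
  SetOf (.prod σ σ) fun p => Ex realTy fun r => (.pair p.w r ∊ D.w.w) ⋏ realLt (ofRat ratZero) r

/-- The sequence `S` (a function on the natural numbers) is Cauchy: for every rational `ε > 0` there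
is `k` such that `d(S m, S n) < ε` for all `m, n ≥ k`. -/
def IsCauchy {Γ : Ctx} {σ : Ty} (D : Tm Γ (.pow (.prod (.prod σ σ) realTy)))
    (S : Tm Γ (.pow (.prod .nat σ))) : Fm Γ :=
  All ratTy fun ε => ratLt ratZero ε ⇛ Ex .nat fun k =>
    All .nat fun m => All .nat fun n => natLe k.w.w m.w ⇛ natLe k.w.w n ⇛
      All σ fun x => All σ fun y =>
        (.pair m.w.w.w x.w ∊ S.w.w.w.w.w.w) ⇛ (.pair n.w.w y ∊ S.w.w.w.w.w.w) ⇛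
          distLt D.w.w.w.w.w.w x.w y ε.w.w.w.w.w

/-- The sequence `S` converges to `l`: for every rational `ε > 0` there is `k` such that
`d(S n, l) < ε` for all `n ≥ k`. -/
def ConvergesTo {Γ : Ctx} {σ : Ty} (D : Tm Γ (.pow (.prod (.prod σ σ) realTy)))
    (S : Tm Γ (.pow (.prod .nat σ))) (l : Tm Γ σ) : Fm Γ :=
  All ratTy fun ε => ratLt ratZero ε ⇛ Ex .nat fun k =>
    All .nat fun n => natLe k.w n ⇛
      All σ fun x => (.pair n.w x ∊ S.w.w.w.w) ⇛ distLt D.w.w.w.w x l.w.w.w.w ε.w.w.w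

/-- `X` with the metric `D` is a complete metric space: every Cauchy sequence in `X` converges to a
point of `X`. -/
def IsCompleteMetric {Γ : Ctx} {σ : Ty} (X : Tm Γ (.pow σ))
    (D : Tm Γ (.pow (.prod (.prod σ σ) realTy))) : Fm Γ :=
  IsMetric X D ⋏
  (All (.pow (.prod .nat σ)) fun S => IsFun (univ .nat) X.w S ⇛ IsCauchy D.w S ⇛
    ExIn X.w fun l => ConvergesTo D.w.w S.w l)

/-- The closure of `{a, b}` in the metric space `X`. -/
def closurePair {Γ : Ctx} {σ : Ty} (X : Tm Γ (.pow σ))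
    (D : Tm Γ (.pow (.prod (.prod σ σ) realTy))) (a b : Tm Γ σ) : Tm Γ (.pow σ) :=
  SetOf σ fun x => (x ∊ X.w) ⋏
    (All ratTy fun ε => ratLt ratZero ε ⇛
      Ex σ fun y => ((y ≐ a.w.w.w) ⋎ (y ≐ b.w.w.w)) ⋏ distLt D.w.w.w x.w.w y ε.w)

/-! ### Spaces of sequences -/

/-- Baire space: the set of all sequences of natural numbers. -/
def baire {Γ : Ctx} : Tm Γ (.pow (.pow (.prod .nat .nat))) :=
  SetOf (.pow (.prod .nat .nat)) fun α => IsFun (univ .nat) (univ .nat) α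

/-- The set `{0, 1}`. -/
def two {Γ : Ctx} : Tm Γ (.pow .nat) := SetOf .nat fun n => (n ≐ .zero) ⋎ (n ≐ .succ .zero)

/-- Cantor space: the set of all binary sequences. -/
def cantor {Γ : Ctx} : Tm Γ (.pow (.pow (.prod .nat .nat))) :=
  SetOf (.pow (.prod .nat .nat)) fun α => IsFun (univ .nat) two α

/-- The set of all increasing binary sequences: `α n ≤ α (n + 1)` for all `n`. -/
def natInfty {Γ : Ctx} : Tm Γ (.pow (.pow (.prod .nat .nat))) :=
  SetOf (.pow (.prod .nat .nat)) fun α => IsFun (univ .nat) two α ⋏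
    (All .nat fun n => All .nat fun i => All .nat fun j =>
      (.pair n.w.w i.w ∊ α.w.w.w) ⇛ (.pair n.w.w.succ j ∊ α.w.w.w) ⇛ natLe i.w j)

/-- The inequality of sequences as a set of pairs: `α ≠ β` means `α n ≠ β n` for some `n`.  This is
positivity of the distance for the usual metric on sequences. -/
def seqNeSet {Γ : Ctx} : Tm Γ (.pow (.prod (.pow (.prod .nat .nat)) (.pow (.prod .nat .nat)))) :=
  SetOf (.prod (.pow (.prod .nat .nat)) (.pow (.prod .nat .nat))) fun p =>
    Ex .nat fun n => Ex .nat fun i => Ex .nat fun j =>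
      (.pair n.w.w i.w ∊ p.w.w.w.fst) ⋏ (.pair n.w.w j ∊ p.w.w.w.snd) ⋏ neg (i.w ≐ j)

/-! ### The statements compared with weak Markov's principle -/

/-- Every real-valued function on a complete metric space (with points of type `σ`) is strongly
extensional. -/
def SEComplete (σ : Ty) : Sentence :=
  All (.pow σ) fun X => All (.pow (.prod (.prod σ σ) realTy)) fun D =>
    IsCompleteMetric X.w D ⇛ AllStronglyExtensional X.w (metricNeSet D)

/-- Every real-valued function on Baire space is strongly extensional. -/
def SEBaire : Sentence := AllStronglyExtensional baire seqNeSet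

/-- Every real-valued function on Cantor space is strongly extensional. -/
def SECantor : Sentence := AllStronglyExtensional cantor seqNeSet

/-- Every real-valued function on the space of increasing binary sequences is strongly
extensional. -/
def SENatInfty : Sentence := AllStronglyExtensional natInfty seqNeSet

/-- Every real-valued function on `[0, 1]` is strongly extensional. -/
def SEUnitInterval : Sentence := AllStronglyExtensional unitInterval realNeSet

/-- Every real-valued function on the closure of a set `{a, b}` of two points `a, b` of a complete
metric space (with points of type `σ`) is strongly extensional. -/
def SEClosurePair (σ : Ty) : Sentence :=
  All (.pow σ) fun X => All (.pow (.prod (.prod σ σ) realTy)) fun D =>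
    IsCompleteMetric X.w D ⇛
      (AllIn X.w fun a => AllIn X.w.w fun b =>
        AllStronglyExtensional (closurePair X.w.w.w D.w.w a.w b) (metricNeSet D.w.w))

end BISH

/-! Derivability is established semantically. Terms with countably many parameters, up to provable
equality, are the elements of a term model, and a world is a consistent prime theory about them that
has witnesses for existential statements. By a Henkin construction (`exists_world`) whatever is
preserved in all worlds is derivable (`entails_iff`, `derives_of_forces`). The worlds carry the
topology generated by the sets of worlds in which a given truth value holds: disjunctions and
existential statements are evaluated in the world itself, implications and universal statements
throughout a neighbourhood (`forces_himp`, `forces_fal`). A constructive argument thus becomes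
classical reasoning at a point, provided that everything used below an implication or a universal
quantifier is known to hold nearby. Induction, comprehension and countable choice are available for
definable families (`forces_induction`, `mem_compr`, `forces_choice`).

The mathematics rests on a combinatorial form of weak Markov's principle, `WMPAt`. A proposition φ
is split if, whenever P and Q are incompatible and φ implies P ∨ Q, one of ¬¬P and ¬¬Q holds. The
principle becomes: a detachable set A of natural numbers with at most one element is inhabited as
soon as its inhabitedness is split. Positivity of a real is the inhabitedness of such a set
(`exists_isUniqAt_iff`, by countable choice), pseudo-positivity makes positivity split
(`split_of_pseudoPositive`), and conversely A yields the real that is 1/(n+1) for n in A and 0 if A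
is empty (`elemReal`).

From the principle to strong extensionality (`forces_inhabited_of_wmpAt`): let F x ≠ F y, and let A
be inhabited exactly when x ≠ y. Given incompatible P and Q with x ≠ y implying P ∨ Q, glue a point
z that is x under P and y under Q. By cotransitivity F z ≠ F x or F z ≠ F y. In the first case P
fails; if Q failed too, A would be empty, so x = y and F x = F y, which is absurd; hence ¬¬Q. The
second case gives ¬¬P. So the inhabitedness of A is split, and A is inhabited. Each space only has
to supply z: by gluing sequences (`glue`), by gluing cuts (`glueReal`), or as the limit of a
sequence obtained by choice (`exists_dist_pos`).

For the converse, a set A with split inhabitedness gives a function that takes different values at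
two points whose inequality would produce an element of A. On sequences the function tells whether
the term at the element of A is 0 (`IsSeqSpace.wmpAt`); on [0, 1] it sends y to min 1 ((n+1) y) for
n in A (`scale`). In both cases splitting makes the function total without an element of A being
known. For metric spaces one takes {0, 1} with d(0, 1) equal to the real of A: splitting is what
makes this space complete (`isCompleteAt_twoDist`), and the inclusion into the reals is the
function. -/

namespace BISH

/-! ### Renaming and substitution calculus -/

/-- Renamings of variables. -/
abbrev Ren (Γ Δ : Ctx) : Type := ∀ τ : Ty, Var Γ τ → Var Δ τ

/-- Simultaneous substitutions. -/
abbrev Sub (Γ Δ : Ctx) : Type := ∀ τ : Ty, Var Γ τ → Tm Δ τ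

theorem liftRen_id (Γ : Ctx) (τ : Ty) :
    liftRen (fun _ x => x : Ren Γ Γ) τ = fun _ x => x := by
  funext σ x; cases x <;> rfl

theorem liftRen_comp {Γ Δ Θ : Ctx} (ρ : Ren Γ Δ) (ρ' : Ren Δ Θ) (τ : Ty) :
    (fun σ x => liftRen ρ' τ σ (liftRen ρ τ σ x)) = liftRen (fun σ x => ρ' σ (ρ σ x)) τ := by
  funext σ x; cases x <;> rfl

theorem Tm.rename_id {Γ : Ctx} {σ : Ty} (t : Tm Γ σ) : t.rename (fun _ x => x) = t := by
  induction t <;> simp only [Tm.rename, liftRen_id, *]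

theorem Tm.rename_rename {Γ Δ Θ : Ctx} {σ : Ty} (ρ : Ren Γ Δ) (ρ' : Ren Δ Θ) (t : Tm Γ σ) :
    (t.rename ρ).rename ρ' = t.rename fun σ x => ρ' σ (ρ σ x) := by
  induction t generalizing Δ Θ <;> simp only [Tm.rename, liftRen_comp, *]

theorem liftSub_liftRen {Γ Δ Θ : Ctx} (ρ : Ren Γ Δ) (s : Sub Δ Θ) (τ : Ty) :
    (fun σ x => liftSub s τ σ (liftRen ρ τ σ x)) = liftSub (fun σ x => s σ (ρ σ x)) τ := by
  funext σ x; cases x <;> rfl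

theorem Tm.subst_rename {Γ Δ Θ : Ctx} {σ : Ty} (ρ : Ren Γ Δ) (s : Sub Δ Θ) (t : Tm Γ σ) :
    (t.rename ρ).subst s = t.subst fun σ x => s σ (ρ σ x) := by
  induction t generalizing Δ Θ <;> simp only [Tm.rename, Tm.subst, liftSub_liftRen, *]

theorem Tm.w_rename {Γ Δ : Ctx} {σ τ : Ty} (ρ : Ren Γ Δ) (t : Tm Γ σ) :
    (t.w (τ := τ)).rename (liftRen ρ τ) = (t.rename ρ).w := by
  simp only [Tm.w, Tm.rename_rename]; rfl

theorem liftRen_liftSub {Γ Δ Θ : Ctx} (s : Sub Γ Δ) (ρ : Ren Δ Θ) (τ : Ty) :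
    (fun σ x => (liftSub s τ σ x).rename (liftRen ρ τ)) =
      liftSub (fun σ x => (s σ x).rename ρ) τ := by
  funext σ x; cases x
  · rfl
  · exact Tm.w_rename _ _

theorem Tm.rename_subst {Γ Δ Θ : Ctx} {σ : Ty} (s : Sub Γ Δ) (ρ : Ren Δ Θ) (t : Tm Γ σ) :
    (t.subst s).rename ρ = t.subst fun σ x => (s σ x).rename ρ := by
  induction t generalizing Δ Θ <;> simp only [Tm.rename, Tm.subst, liftRen_liftSub, *]

theorem Tm.w_subst {Γ Δ : Ctx} {σ τ : Ty} (s : Sub Γ Δ) (t : Tm Γ σ) :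
    (t.w (τ := τ)).subst (liftSub s τ) = (t.subst s).w := by
  simp only [Tm.w, Tm.subst_rename, Tm.rename_subst]; rfl

theorem liftSub_liftSub {Γ Δ Θ : Ctx} (s : Sub Γ Δ) (s' : Sub Δ Θ) (τ : Ty) :
    (fun σ x => (liftSub s τ σ x).subst (liftSub s' τ)) =
      liftSub (fun σ x => (s σ x).subst s') τ := by
  funext σ x; cases x
  · rfl
  · exact Tm.w_subst _ _

theorem Tm.subst_subst {Γ Δ Θ : Ctx} {σ : Ty} (s : Sub Γ Δ) (s' : Sub Δ Θ) (t : Tm Γ σ) :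
    (t.subst s).subst s' = t.subst fun σ x => (s σ x).subst s' := by
  induction t generalizing Δ Θ <;> simp only [Tm.subst, liftSub_liftSub, *]

theorem liftSub_var (Γ : Ctx) (τ : Ty) :
    liftSub (fun _ x => .var x : Sub Γ Γ) τ = fun _ x => .var x := by
  funext σ x; cases x <;> rfl

theorem Tm.subst_var {Γ : Ctx} {σ : Ty} (t : Tm Γ σ) : t.subst (fun _ x => .var x) = t := by
  induction t <;> simp only [Tm.subst, liftSub_var, *]

theorem Tm.rename_eq_subst {Γ Δ : Ctx} {σ : Ty} (ρ : Ren Γ Δ) (t : Tm Γ σ) :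
    t.rename ρ = t.subst fun τ x => .var (ρ τ x) := by
  rw [← Tm.subst_var (t.rename ρ), Tm.subst_rename]

theorem Tm.w_inst {Γ : Ctx} {σ τ : Ty} (t : Tm Γ σ) (u : Tm Γ τ) : t.w.inst u = t := by
  simp only [Tm.w, Tm.inst, Tm.subst_rename]; exact t.subst_var

theorem Tm.inst_rename {Γ Δ : Ctx} {σ τ : Ty} (ρ : Ren Γ Δ) (t : Tm (τ :: Γ) σ) (u : Tm Γ τ) :
    (t.inst u).rename ρ = (t.rename (liftRen ρ τ)).inst (u.rename ρ) := by
  simp only [Tm.inst, Tm.subst_rename, Tm.rename_subst]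
  congr 1; funext σ x; cases x <;> rfl

/-- The substitution extended by a term for the innermost variable. -/
def consSub {Γ Δ : Ctx} {τ : Ty} (u : Tm Δ τ) (s : Sub Γ Δ) : Sub (τ :: Γ) Δ
  | _, .zero => u
  | _, .succ x => s _ x

theorem Tm.subst_liftSub_inst {Γ Δ : Ctx} {σ τ : Ty} (s : Sub Γ Δ) (t : Tm (τ :: Γ) σ)
    (u : Tm Δ τ) : (t.subst (liftSub s τ)).inst u = t.subst (consSub u s) := by
  simp only [Tm.inst, Tm.subst_subst]
  congr 1; funext σ x; cases x
  · rfl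
  · exact Tm.w_inst _ _

/-! ### Structural rules -/

/-- A single induction on derivations covers both the renaming of variables and the weakening of
hypotheses, since `H'` only has to contain the renamed hypotheses. -/
theorem Derives.rename {Γ Δ : Ctx} {H : Set (Fm Γ)} {φ : Fm Γ} (h : Derives H φ)
    (ρ : Ren Γ Δ) {H' : Set (Fm Δ)} (hH : ∀ ψ ∈ H, ψ.rename ρ ∈ H') :
    Derives H' (φ.rename ρ) := by
  have hins : ∀ {Γ Δ : Ctx} {H : Set (Fm Γ)} {H' : Set (Fm Δ)} {ρ : Ren Γ Δ} (χ : Fm Γ),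
      (∀ ψ ∈ H, ψ.rename ρ ∈ H') → ∀ ψ ∈ insert χ H, ψ.rename ρ ∈ insert (χ.rename ρ) H' := by
    rintro _ _ _ _ _ χ hH ψ (rfl | hψ)
    · exact Or.inl rfl
    · exact Or.inr (hH ψ hψ)
  have hw : ∀ {Γ Δ : Ctx} {H : Set (Fm Γ)} {H' : Set (Fm Δ)} {ρ : Ren Γ Δ} (τ : Ty),
      (∀ ψ ∈ H, ψ.rename ρ ∈ H') →
      ∀ ψ ∈ (Tm.w '' H : Set (Fm (τ :: Γ))), ψ.rename (liftRen ρ τ) ∈ Tm.w '' H' := by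
    rintro _ _ _ _ _ τ hH _ ⟨ψ, hψ, rfl⟩
    exact ⟨_, hH ψ hψ, (Tm.w_rename _ _).symm⟩
  induction h generalizing Δ with
  | hyp h => exact .hyp (hH _ h)
  | botE _ ih => exact .botE (ih ρ hH)
  | andI _ _ ih₁ ih₂ => exact .andI (ih₁ ρ hH) (ih₂ ρ hH)
  | andE₁ _ ih => exact .andE₁ (ih ρ hH)
  | andE₂ _ ih => exact .andE₂ (ih ρ hH)
  | orI₁ _ ih => exact .orI₁ (ih ρ hH)
  | orI₂ _ ih => exact .orI₂ (ih ρ hH)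
  | orE _ _ _ ih ih₁ ih₂ =>
    exact .orE (ih ρ hH) (ih₁ ρ (hins _ hH)) (ih₂ ρ (hins _ hH))
  | impI _ ih => exact .impI (ih ρ (hins _ hH))
  | impE _ _ ih₁ ih₂ => exact .impE (ih₁ ρ hH) (ih₂ ρ hH)
  | allI _ ih => exact .allI (ih (liftRen ρ _) (hw _ hH))
  | allE t _ ih => rw [Tm.inst_rename]; exact .allE _ (ih ρ hH)
  | exI t _ ih => exact .exI (t.rename ρ) (by rw [← Tm.inst_rename]; exact ih ρ hH)
  | exE _ _ ih₁ ih₂ =>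
    exact .exE (ih₁ ρ hH) (by
      rw [← Tm.w_rename]; exact ih₂ (liftRen ρ _) (hins _ (hw _ hH)))
  | eqRefl t => exact .eqRefl _
  | eqSubst φ _ _ ih₁ ih₂ =>
    rw [Tm.inst_rename]
    exact .eqSubst _ (ih₁ ρ hH) (by rw [← Tm.inst_rename]; exact ih₂ ρ hH)
  | comprI _ ih => exact .comprI (by rw [← Tm.inst_rename]; exact ih ρ hH)
  | comprE _ ih => rw [Tm.inst_rename]; exact .comprE (ih ρ hH)
  | setExt _ ih =>
    refine .setExt ?_
    have := ih ρ hH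
    simp only [Tm.rename, Tm.w_rename] at this
    exact this
  | propExt _ ih => exact .propExt (ih ρ hH)
  | fstPair s t => exact .fstPair _ _
  | sndPair s t => exact .sndPair _ _
  | pairEta p => exact .pairEta _
  | succNeZero _ ih => exact .succNeZero (ih ρ hH)
  | succInj _ ih => exact .succInj (ih ρ hH)
  | addZero m => exact .addZero _
  | addSucc m n => exact .addSucc _ _
  | mulZero m => exact .mulZero _
  | mulSucc m n => exact .mulSucc _ _
  -- In this rule and in the rule of choice the formulas contain weakened terms and defined notions;
  -- these have to be unfolded before the renaming is seen to give an instance of the same rule.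
  | induction _ _ ih₁ ih₂ =>
    have h₂ := ih₂ ρ hH
    simp only [Tm.rename, Tm.w_rename] at h₂ ⊢
    exact .induction (ih₁ ρ hH) h₂
  | countableChoice _ ih =>
    have h := ih ρ hH
    simp only [Tm.rename, Tm.w_rename, IsFun, subset, times, univ] at h ⊢
    exact .countableChoice h

theorem Derives.mono {Γ : Ctx} {H H' : Set (Fm Γ)} {φ : Fm Γ} (h : Derives H φ) (hH : H ⊆ H') :
    Derives H' φ := by
  have := h.rename (fun _ x => x) (H' := H') fun ψ hψ => by rw [Tm.rename_id]; exact hH hψ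
  rwa [Tm.rename_id] at this

theorem Derives.cut {Γ : Ctx} {H : Set (Fm Γ)} {φ ψ : Fm Γ} (h : Derives H φ)
    (h' : Derives (insert φ H) ψ) : Derives H ψ :=
  .impE (.impI h') h

end BISH

namespace BISH

/-! ### Countability of the syntax -/

/-- A code of a type. -/
def Ty.code : Ty → ℕ
  | .atom i => Nat.pair 0 i
  | .nat => Nat.pair 1 0
  | .prop => Nat.pair 2 0
  | .prod σ τ => Nat.pair 3 (Nat.pair σ.code τ.code)
  | .pow σ => Nat.pair 4 σ.code

theorem Ty.code_injective : Function.Injective Ty.code := by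
  intro σ
  induction σ with
  | atom i => intro τ h; cases τ <;> simp_all [Ty.code]
  | nat => intro τ h; cases τ <;> simp_all [Ty.code]
  | prop => intro τ h; cases τ <;> simp_all [Ty.code]
  | prod σ₁ σ₂ ih₁ ih₂ =>
    intro τ h
    cases τ <;> simp [Ty.code] at h
    rw [ih₁ h.1, ih₂ h.2]
  | pow σ ih =>
    intro τ h
    cases τ <;> simp [Ty.code] at h
    rw [ih h]

instance : Countable Ty := Ty.code_injective.countable

/-- The de Bruijn index of a variable. -/
def Var.code : {Γ : Ctx} → {σ : Ty} → Var Γ σ → ℕ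
  | _, _, .zero => 0
  | _, _, .succ x => x.code + 1

theorem Var.code_injective {Γ : Ctx} {σ : Ty} (x : Var Γ σ) :
    ∀ {τ : Ty} (y : Var Γ τ), x.code = y.code → σ = τ ∧ HEq x y := by
  induction x with
  | zero => intro τ y h; cases y <;> simp_all [Var.code]
  | succ x ih =>
    intro τ y h
    cases y with
    | zero => simp [Var.code] at h
    | succ y =>
      obtain ⟨rfl, h⟩ := ih y (by simpa [Var.code] using h)
      exact ⟨rfl, by rw [eq_of_heq h]⟩

/-- A code of a term. -/
def Tm.code : {Γ : Ctx} → {σ : Ty} → Tm Γ σ → ℕ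
  | _, _, .var x => Nat.pair 0 x.code
  | _, _, .bot => Nat.pair 1 0
  | _, _, .and φ ψ => Nat.pair 2 (Nat.pair φ.code ψ.code)
  | _, _, .or φ ψ => Nat.pair 3 (Nat.pair φ.code ψ.code)
  | _, _, .imp φ ψ => Nat.pair 4 (Nat.pair φ.code ψ.code)
  | _, _, .all σ φ => Nat.pair 5 (Nat.pair σ.code φ.code)
  | _, _, .ex σ φ => Nat.pair 6 (Nat.pair σ.code φ.code)
  | _, _, .eq s t => Nat.pair 7 (Nat.pair s.code t.code)
  | _, _, .mem t A => Nat.pair 8 (Nat.pair t.code A.code)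
  | _, _, .compr (σ := σ) φ => Nat.pair 9 (Nat.pair σ.code φ.code)
  | _, _, .pair s t => Nat.pair 10 (Nat.pair s.code t.code)
  | _, _, .fst p => Nat.pair 11 p.code
  | _, _, .snd p => Nat.pair 12 p.code
  | _, _, .zero => Nat.pair 13 0
  | _, _, .succ n => Nat.pair 14 n.code
  | _, _, .add m n => Nat.pair 15 (Nat.pair m.code n.code)
  | _, _, .mul m n => Nat.pair 16 (Nat.pair m.code n.code)

/-- The type of a term must be recovered from its code together with the term: in an equation, a
membership or a projection the type of the subterms is not visible in the type of the whole. Only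
binders store a type, because it fixes the context of the body. -/
theorem Tm.code_injective {Γ : Ctx} {σ : Ty} (t : Tm Γ σ) :
    ∀ {τ : Ty} (u : Tm Γ τ), t.code = u.code → σ = τ ∧ HEq t u := by
  induction t with
  | var x =>
    intro τ u h
    cases u <;> simp [Tm.code] at h
    obtain ⟨rfl, h⟩ := Var.code_injective _ _ h
    exact ⟨rfl, by rw [eq_of_heq h]⟩
  | all σ φ ih | ex σ φ ih | compr φ ih =>
    intro τ u h
    cases u <;> simp [Tm.code] at h
    obtain rfl := Ty.code_injective h.1
    obtain ⟨_, h⟩ := ih _ h.2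
    exact ⟨rfl, by rw [eq_of_heq h]⟩
  | bot | zero => intro τ u h; cases u <;> simp_all [Tm.code]
  | fst p ih | snd p ih | succ p ih =>
    intro τ u h
    cases u <;> simp [Tm.code] at h
    obtain ⟨h₁, h⟩ := ih _ h
    cases h₁
    exact ⟨rfl, by rw [eq_of_heq h]⟩
  | and s t ih₁ ih₂ | or s t ih₁ ih₂ | imp s t ih₁ ih₂ | eq s t ih₁ ih₂ | mem s t ih₁ ih₂
  | pair s t ih₁ ih₂ | add s t ih₁ ih₂ | mul s t ih₁ ih₂ =>
    intro τ u h
    cases u <;> simp [Tm.code] at h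
    obtain ⟨h₁, h₁'⟩ := ih₁ _ h.1
    cases h₁
    obtain ⟨h₂, h₂'⟩ := ih₂ _ h.2
    cases h₂
    exact ⟨rfl, by rw [eq_of_heq h₁', eq_of_heq h₂']⟩

instance {Γ : Ctx} {σ : Ty} : Countable (Tm Γ σ) :=
  Function.Injective.countable (f := Tm.code) fun t u h => eq_of_heq (t.code_injective u h).2

end BISH

namespace BISH

/-! ### Equality in the calculus -/

theorem Derives.eqSymm {Γ : Ctx} {H : Set (Fm Γ)} {σ : Ty} {s t : Tm Γ σ}
    (h : Derives H (s ≐ t)) : Derives H (t ≐ s) := by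
  have := Derives.eqSubst (.eq (.var .zero) s.w) h
  simp only [Tm.inst, Tm.subst, instSub] at this
  rw [show s.w.subst (instSub s) = s from s.w_inst s,
    show s.w.subst (instSub t) = s from s.w_inst t] at this
  exact this (.eqRefl s)

theorem Derives.eqTrans {Γ : Ctx} {H : Set (Fm Γ)} {σ : Ty} {s t u : Tm Γ σ}
    (h : Derives H (s ≐ t)) (h' : Derives H (t ≐ u)) : Derives H (s ≐ u) := by
  have := Derives.eqSubst (.eq s.w (.var .zero)) h'
  simp only [Tm.inst, Tm.subst, instSub] at this
  rw [show s.w.subst (instSub t) = s from s.w_inst t,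
    show s.w.subst (instSub u) = s from s.w_inst u] at this
  exact this h

theorem Derives.eqInst {Γ : Ctx} {H : Set (Fm Γ)} {σ τ : Ty} {s t : Tm Γ σ}
    (f : Tm (σ :: Γ) τ) (h : Derives H (s ≐ t)) : Derives H (f.inst s ≐ f.inst t) := by
  have := Derives.eqSubst (.eq (f.inst s).w f) h
  simp only [Tm.inst, Tm.subst] at this
  rw [show ((f.subst (instSub s)).w).subst (instSub s) = f.subst (instSub s) from Tm.w_inst _ _,
    show ((f.subst (instSub s)).w).subst (instSub t) = f.subst (instSub s) from Tm.w_inst _ _]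
    at this
  exact this (.eqRefl _)

theorem Derives.eqMp {Γ : Ctx} {H : Set (Fm Γ)} {φ ψ : Fm Γ}
    (h : Derives H (φ ≐ ψ)) (h' : Derives H φ) : Derives H ψ :=
  .eqSubst (.var .zero) h h'

theorem Derives.biimpOfEq {Γ : Ctx} {H : Set (Fm Γ)} {φ ψ : Fm Γ}
    (h : Derives H (φ ≐ ψ)) : Derives H (biimp φ ψ) :=
  .andI (.impI (.eqMp (h.mono (Set.subset_insert _ _)) (.hyp (Set.mem_insert _ _))))
    (.impI (.eqMp (h.eqSymm.mono (Set.subset_insert _ _)) (.hyp (Set.mem_insert _ _))))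

/-- Congruence for a binary operation, given as a term in each of its two arguments. -/
theorem Derives.eqCongr₂ {Γ : Ctx} {H : Set (Fm Γ)} {σ τ υ : Ty} {s s' : Tm Γ σ} {t t' : Tm Γ τ}
    (f : Tm (σ :: Γ) υ) (g : Tm (τ :: Γ) υ) (hfg : f.inst s' = g.inst t)
    (h : Derives H (s ≐ s')) (h' : Derives H (t ≐ t')) :
    Derives H (f.inst s ≐ g.inst t') :=
  (Derives.eqInst f h).eqTrans (hfg ▸ Derives.eqInst g h')

/-- Opening a weakened binder at the new variable gives back the body; this is how quantifier rules
are applied to a generic element. -/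
theorem Tm.rename_liftRen_succ_inst {Γ : Ctx} {σ τ : Ty} (t : Tm (σ :: Γ) τ) :
    (t.rename (liftRen (fun _ x => Var.succ (τ := σ) x) σ)).inst (.var .zero) = t := by
  simp only [Tm.inst, Tm.subst_rename]
  convert t.subst_var using 2
  funext τ x; cases x <;> rfl

theorem Derives.eqAll {Γ : Ctx} {H : Set (Fm Γ)} {σ : Ty} {φ ψ : Fm (σ :: Γ)}
    (h : Derives (Tm.w '' H) (φ ≐ ψ)) : Derives H (.all σ φ ≐ .all σ ψ) := by
  have key : ∀ {φ ψ : Fm (σ :: Γ)}, Derives (Tm.w '' H) (φ ≐ ψ) →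
      Derives H (.all σ φ ⇛ .all σ ψ) := by
    intro φ ψ h
    refine .impI (.allI (.eqMp (h.mono (Set.image_mono (Set.subset_insert _ _))) ?_))
    have : Derives (Tm.w '' (insert (Tm.all σ φ) H)) ((Tm.all σ φ).w (τ := σ)) :=
      .hyp ⟨_, Set.mem_insert _ _, rfl⟩
    have := Derives.allE (.var .zero) this
    rwa [Tm.rename_liftRen_succ_inst] at this
  exact .propExt (.andI (key h) (key h.eqSymm))

theorem Derives.eqEx {Γ : Ctx} {H : Set (Fm Γ)} {σ : Ty} {φ ψ : Fm (σ :: Γ)}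
    (h : Derives (Tm.w '' H) (φ ≐ ψ)) : Derives H (.ex σ φ ≐ .ex σ ψ) := by
  have key : ∀ {φ ψ : Fm (σ :: Γ)}, Derives (Tm.w '' H) (φ ≐ ψ) →
      Derives H (.ex σ φ ⇛ .ex σ ψ) := by
    intro φ ψ h
    refine .impI (.exE (.hyp (Set.mem_insert _ _)) (.exI (.var .zero) ?_))
    rw [Tm.rename_liftRen_succ_inst]
    exact .eqMp (h.mono ((Set.image_mono (Set.subset_insert _ _)).trans (Set.subset_insert _ _)))
      (.hyp (Set.mem_insert _ _))
  exact .propExt (.andI (key h) (key h.eqSymm))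

theorem Derives.memCompr {Γ : Ctx} {H : Set (Fm Γ)} {σ : Ty} (φ : Fm (σ :: Γ)) (t : Tm Γ σ) :
    Derives H ((t ∊ .compr φ) ≐ φ.inst t) :=
  .propExt (.andI (.impI (.comprE (.hyp (Set.mem_insert _ _))))
    (.impI (.comprI (.hyp (Set.mem_insert _ _)))))

theorem Derives.eqCompr {Γ : Ctx} {H : Set (Fm Γ)} {σ : Ty} {φ ψ : Fm (σ :: Γ)}
    (h : Derives (Tm.w '' H) (φ ≐ ψ)) : Derives H (.compr φ ≐ .compr ψ) := by
  refine .setExt (.allI (Derives.biimpOfEq ?_))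
  have h₁ := Derives.memCompr (H := Tm.w '' H)
    (φ.rename (liftRen (fun _ x => Var.succ (τ := σ) x) σ)) (.var .zero)
  have h₂ := Derives.memCompr (H := Tm.w '' H)
    (ψ.rename (liftRen (fun _ x => Var.succ (τ := σ) x) σ)) (.var .zero)
  rw [Tm.rename_liftRen_succ_inst] at h₁ h₂
  exact (h₁.eqTrans h).eqTrans h₂.eqSymm

/-- Provable equality is a congruence, also under binders, where propositional and set
extensionality are used. This makes the evaluation of terms at classes of terms well defined. -/
theorem Derives.substCongr {Γ Δ : Ctx} {σ : Ty} (t : Tm Γ σ) {s s' : Sub Γ Δ}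
    {H : Set (Fm Δ)} (h : ∀ τ x, Derives H (s τ x ≐ s' τ x)) :
    Derives H (t.subst s ≐ t.subst s') := by
  have lift : ∀ {Γ Δ : Ctx} (τ : Ty) {s s' : Sub Γ Δ} {H : Set (Fm Δ)},
      (∀ τ x, Derives H (s τ x ≐ s' τ x)) →
      ∀ υ x, Derives (Tm.w '' H) (liftSub s τ υ x ≐ liftSub s' τ υ x) := by
    intro Γ Δ τ s s' H h υ x
    cases x with
    | zero => exact .eqRefl _
    | succ x => exact (h _ x).rename _ fun ψ hψ => ⟨ψ, hψ, rfl⟩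
  -- All binary constructors are treated at once: it is enough that the constructor commutes with
  -- substitution.
  have bin : ∀ {Δ : Ctx} {σ τ υ : Ty} {H : Set (Fm Δ)} {a a' : Tm Δ σ} {b b' : Tm Δ τ}
      (c : ∀ {Δ : Ctx}, Tm Δ σ → Tm Δ τ → Tm Δ υ)
      (_ : ∀ {Γ Δ : Ctx} (s : Sub Γ Δ) (a : Tm Γ σ) (b : Tm Γ τ),
        (c a b).subst s = c (a.subst s) (b.subst s)),
      Derives H (a ≐ a') → Derives H (b ≐ b') → Derives H (c a b ≐ c a' b') := by
    intro Δ σ τ υ H a a' b b' c hc h₁ h₂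
    have e₁ : ∀ a, (c (.var .zero) b.w).inst a = c a b := fun a => by
      rw [Tm.inst, hc]; exact congrArg _ (b.w_inst a)
    have e₂ : ∀ b, (c a'.w (.var .zero)).inst b = c a' b := fun b => by
      rw [Tm.inst, hc]; exact congrArg (fun x => c x b) (a'.w_inst b)
    have := Derives.eqCongr₂ (c (.var .zero) b.w) (c a'.w (.var .zero)) (by rw [e₁, e₂]) h₁ h₂
    rwa [e₁, e₂] at this
  induction t generalizing Δ with
  | var x => exact h _ x
  | bot | zero => exact .eqRefl _
  | all σ φ ih => exact .eqAll (ih (lift _ h))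
  | ex σ φ ih => exact .eqEx (ih (lift _ h))
  | compr φ ih => exact .eqCompr (ih (lift _ h))
  | fst p ih => exact Derives.eqInst (.fst (.var .zero)) (ih h)
  | snd p ih => exact Derives.eqInst (.snd (.var .zero)) (ih h)
  | succ p ih => exact Derives.eqInst (.succ (.var .zero)) (ih h)
  | and a b ih₁ ih₂ => exact bin .and (fun _ _ _ => rfl) (ih₁ h) (ih₂ h)
  | or a b ih₁ ih₂ => exact bin .or (fun _ _ _ => rfl) (ih₁ h) (ih₂ h)
  | imp a b ih₁ ih₂ => exact bin .imp (fun _ _ _ => rfl) (ih₁ h) (ih₂ h)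
  | eq a b ih₁ ih₂ => exact bin .eq (fun _ _ _ => rfl) (ih₁ h) (ih₂ h)
  | mem a b ih₁ ih₂ => exact bin .mem (fun _ _ _ => rfl) (ih₁ h) (ih₂ h)
  | pair a b ih₁ ih₂ => exact bin .pair (fun _ _ _ => rfl) (ih₁ h) (ih₂ h)
  | add a b ih₁ ih₂ => exact bin .add (fun _ _ _ => rfl) (ih₁ h) (ih₂ h)
  | mul a b ih₁ ih₂ => exact bin .mul (fun _ _ _ => rfl) (ih₁ h) (ih₂ h)

end BISH

namespace BISH

/-! ### Infinitely many parameters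

Over a base context `B` a sequence of parameters is adjoined, infinitely many of each type that is
inhabited over `B`. -/

/-- The type `σ` has a term over `B`. -/
class Inh (B : Ctx) (σ : Ty) : Prop where
  nonempty : Nonempty (Tm B σ)

instance {B : Ctx} : Inh B .nat := ⟨⟨.zero⟩⟩
instance {B : Ctx} : Inh B .prop := ⟨⟨.bot⟩⟩
instance {B : Ctx} {σ : Ty} : Inh B (.pow σ) := ⟨⟨.compr .bot⟩⟩
instance {B : Ctx} {σ τ : Ty} [h : Inh B σ] [h' : Inh B τ] : Inh B (.prod σ τ) :=
  ⟨h.nonempty.elim fun s => h'.nonempty.elim fun t => ⟨.pair s t⟩⟩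

/-- Each type with a term over the base recurs infinitely often, so beyond every stage there is a
fresh parameter of that type. Types without a term receive none, because such a parameter could not
be removed again (`Prv.of_w`). -/
theorem exists_parameterTypes (B : Ctx) :
    ∃ f : ℕ → {σ : Ty // Inh B σ}, ∀ σ n, ∃ m, n ≤ m ∧ f m = σ := by
  have : Nonempty {σ : Ty // Inh B σ} := ⟨⟨.nat, inferInstance⟩⟩
  obtain ⟨g, hg⟩ := exists_surjective_nat {σ : Ty // Inh B σ}
  -- Reading only the first component of a pair repeats each value of `g` at arbitrarily late
  -- places.
  refine ⟨fun m => g m.unpair.1, fun σ n => ?_⟩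
  obtain ⟨k, rfl⟩ := hg σ
  exact ⟨Nat.pair k n, Nat.right_le_pair _ _, by simp⟩

/-- The type of the `n`-th parameter. -/
noncomputable def parTy (B : Ctx) (n : ℕ) : Ty := ((exists_parameterTypes B).choose n).1

instance (B : Ctx) (n : ℕ) : Inh B (parTy B n) := ((exists_parameterTypes B).choose n).2

theorem exists_parTy_eq (B : Ctx) (σ : Ty) [h : Inh B σ] (n : ℕ) : ∃ m, n ≤ m ∧ parTy B m = σ := by
  obtain ⟨m, hm, h⟩ := (exists_parameterTypes B).choose_spec ⟨σ, h⟩ n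
  exact ⟨m, hm, congrArg Subtype.val h⟩

/-- The context with the first `n` parameters. -/
noncomputable def ctx (B : Ctx) : ℕ → Ctx
  | 0 => B
  | n + 1 => parTy B n :: ctx B n

variable {B : Ctx}

/-- The inclusion of contexts. -/
noncomputable def upRen {n m : ℕ} (h : n ≤ m) : Ren (ctx B n) (ctx B m) :=
  Nat.leRec (motive := fun m _ => Ren (ctx B n) (ctx B m)) (fun _ x => x)
    (fun _ _ ρ τ x => .succ (ρ τ x)) h

theorem upRen_refl (n : ℕ) : (upRen (le_refl n) : Ren (ctx B n) (ctx B n)) = fun _ x => x :=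
  Nat.leRec_self _ _

theorem upRen_succ {n m : ℕ} (h : n ≤ m) :
    (upRen (Nat.le_succ_of_le h) : Ren (ctx B n) (ctx B (m + 1))) =
      fun τ x => Var.succ (upRen h τ x) :=
  Nat.leRec_succ _ _ h

theorem upRen_trans {n m k : ℕ} (h : n ≤ m) (h' : m ≤ k) (τ : Ty) (x : Var (ctx B n) τ) :
    upRen h' τ (upRen h τ x) = upRen (h.trans h') τ x := by
  induction h' with
  | refl => rw [upRen_refl]
  | step h' ih =>
    rw [upRen_succ h', upRen_succ (h.trans h')]
    exact congrArg Var.succ ih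

/-- A term regarded as a term with more parameters. -/
noncomputable def up {n m : ℕ} (h : n ≤ m) {σ : Ty} (t : Tm (ctx B n) σ) : Tm (ctx B m) σ :=
  t.rename (upRen h)

theorem up_refl {n : ℕ} (h : n ≤ n) {σ : Ty} (t : Tm (ctx B n) σ) : up h t = t := by
  rw [up, upRen_refl, Tm.rename_id]

theorem up_up {n m k : ℕ} (h : n ≤ m) (h' : m ≤ k) {σ : Ty} (t : Tm (ctx B n) σ) :
    up h' (up h t) = up (h.trans h') t := by
  simp only [up, Tm.rename_rename, upRen_trans]

theorem up_succ {n m : ℕ} (h : n ≤ m) {σ : Ty} (t : Tm (ctx B n) σ) :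
    up (Nat.le_succ_of_le h) t = ((up h t).w : Tm (ctx B (m + 1)) σ) := by
  rw [up, upRen_succ h, up, Tm.w, Tm.rename_rename]
  rfl

theorem up_subst {Γ : Ctx} {n m : ℕ} (h : n ≤ m) {σ : Ty} (t : Tm Γ σ) (s : Sub Γ (ctx B n)) :
    up h (t.subst s) = t.subst fun τ x => up h (s τ x) :=
  Tm.rename_subst _ _ _

/-- Derivability without hypotheses. -/
abbrev Prv {Γ : Ctx} (φ : Fm Γ) : Prop := Derives ∅ φ

theorem Prv.up {n m : ℕ} {φ : Fm (ctx B n)} (h : Prv φ) (hnm : n ≤ m) : Prv (up hnm φ) :=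
  h.rename _ fun _ h => h.elim

/-- An unused variable is generalized and then instantiated, which requires a term of its type. -/
theorem Prv.of_w {Γ : Ctx} {σ : Ty} {φ : Fm Γ} (t : Tm Γ σ) (h : Prv (φ.w (τ := σ))) : Prv φ := by
  have := Derives.allE t (Derives.allI (H := ∅) (by rwa [Set.image_empty]))
  rwa [Tm.w_inst] at this

/-- Parameters are conservative: they are removed one at a time, and each has a type with a term
over the base. -/
theorem Prv.of_up {n m : ℕ} {φ : Fm (ctx B n)} (hnm : n ≤ m) (h : Prv (BISH.up hnm φ)) :
    Prv φ := by
  induction hnm with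
  | refl => rwa [up_refl] at h
  | @step m hnm ih =>
    rw [up_succ hnm] at h
    obtain ⟨t⟩ := (inferInstance : Inh B (parTy B m)).nonempty
    exact ih (Prv.of_w (BISH.up (Nat.zero_le m) t) h)

/-! ### Elements: terms with parameters up to provable equality -/

/-- Terms with parameters that are provably equal. -/
noncomputable def elSetoid (B : Ctx) (σ : Ty) : Setoid (Σ n, Tm (ctx B n) σ) where
  r a b := ∃ (k : ℕ) (ha : a.1 ≤ k) (hb : b.1 ≤ k), Prv (up ha a.2 ≐ up hb b.2)
  iseqv :=
    { refl := fun a => ⟨a.1, le_rfl, le_rfl, .eqRefl _⟩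
      symm := fun ⟨k, ha, hb, h⟩ => ⟨k, hb, ha, h.eqSymm⟩
      trans := by
        rintro a b c ⟨k, ha, hb, h⟩ ⟨l, hb', hc, h'⟩
        refine ⟨max k l, ha.trans (le_max_left _ _), hc.trans (le_max_right _ _), ?_⟩
        have h₁ : Prv (up _ (up ha a.2) ≐ up _ (up hb b.2)) := Prv.up h (le_max_left k l)
        have h₂ : Prv (up _ (up hb' b.2) ≐ up _ (up hc c.2)) := Prv.up h' (le_max_right k l)
        simp only [up_up] at h₁ h₂
        exact h₁.eqTrans h₂ }

/-- The elements of type `σ`. -/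
def El (B : Ctx) (σ : Ty) : Type := Quotient (elSetoid B σ)

/-- Truth values. -/
abbrev Om (B : Ctx) : Type := El B .prop

/-- The element denoted by a term. -/
noncomputable def El.mk {n : ℕ} {σ : Ty} (t : Tm (ctx B n) σ) : El B σ := Quotient.mk (elSetoid B σ) ⟨n, t⟩

theorem El.mk_up {n m : ℕ} {σ : Ty} (h : n ≤ m) (t : Tm (ctx B n) σ) : El.mk (up h t) = El.mk t :=
  Quotient.sound ⟨m, le_rfl, h, by simp only [up_refl]; exact .eqRefl _⟩

/-- By conservativity, an equality proved with additional parameters is already provable at the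
original stage. -/
theorem El.mk_eq_mk {n : ℕ} {σ : Ty} {s t : Tm (ctx B n) σ} :
    El.mk s = El.mk t ↔ Prv (s ≐ t) := by
  constructor
  · intro h
    obtain ⟨k, h₁, h₂, h⟩ := Quotient.exact h
    exact Prv.of_up (φ := s ≐ t) h₁ h
  · intro h
    exact Quotient.sound ⟨n, le_rfl, le_rfl, by simpa only [up_refl] using h⟩

instance {σ : Ty} : Countable (El B σ) := Quotient.countable

/-- Environments: values of the variables of a context. -/
def Env (B Γ : Ctx) : Type := ∀ τ : Ty, Var Γ τ → El B τ

/-- The empty environment. -/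
def Env.nil : Env B [] := fun _ x => nomatch x

/-- An environment extended by the value of the innermost variable. -/
def Env.cons {Γ : Ctx} {σ : Ty} (a : El B σ) (ρ : Env B Γ) : Env B (σ :: Γ)
  | _, .zero => a
  | _, .succ x => ρ _ x

/-- The substitution `s` represents the environment `ρ`. -/
def Env.Rep {Γ : Ctx} (ρ : Env B Γ) {n : ℕ} (s : Sub Γ (ctx B n)) : Prop :=
  ∀ τ x, El.mk (s τ x) = ρ τ x

theorem Env.Rep.up {Γ : Ctx} {ρ : Env B Γ} {n m : ℕ} {s : Sub Γ (ctx B n)} (h : ρ.Rep s)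
    (hnm : n ≤ m) : ρ.Rep fun τ x => BISH.up hnm (s τ x) :=
  fun τ x => (El.mk_up _ _).trans (h τ x)

theorem Env.Rep.cons {Γ : Ctx} {ρ : Env B Γ} {n : ℕ} {s : Sub Γ (ctx B n)} (h : ρ.Rep s)
    {σ : Ty} (t : Tm (ctx B n) σ) : (Env.cons (El.mk t) ρ).Rep (consSub t s) := by
  intro τ x
  cases x with
  | zero => rfl
  | succ x => exact h _ x

/-- A context is finite, so representatives of all its values exist at a common stage. -/
theorem Env.exists_rep {Γ : Ctx} (ρ : Env B Γ) : ∃ (n : ℕ) (s : Sub Γ (ctx B n)), ρ.Rep s := by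
  induction Γ with
  | nil => exact ⟨0, (fun _ x => nomatch x), fun _ x => nomatch x⟩
  | cons σ Γ ih =>
    obtain ⟨n, s, hs⟩ := ih fun τ x => ρ τ (.succ x)
    obtain ⟨⟨m, t⟩, ht⟩ := Quotient.exists_rep (ρ σ .zero)
    refine ⟨max n m, consSub (BISH.up (le_max_right _ _) t)
      (fun τ x => BISH.up (le_max_left _ _) (s τ x)), ?_⟩
    intro τ x
    cases x with
    | zero => exact (El.mk_up _ _).trans ht
    | succ x => exact (El.mk_up _ _).trans (hs _ x)

/-- The value of a term in an environment. -/
noncomputable def ev {Γ : Ctx} {σ : Ty} (t : Tm Γ σ) (ρ : Env B Γ) : El B σ :=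
  El.mk (t.subst ρ.exists_rep.choose_spec.choose)

/-- Two representations of an environment become provably equal substitutions at a common later
stage, so the value does not depend on the one chosen in `ev`. -/
theorem ev_eq_mk {Γ : Ctx} {σ : Ty} (t : Tm Γ σ) {ρ : Env B Γ} {n : ℕ} {s : Sub Γ (ctx B n)}
    (h : ρ.Rep s) : ev t ρ = El.mk (t.subst s) := by
  have key : ∀ {m k : ℕ} {r : Sub Γ (ctx B m)} {s : Sub Γ (ctx B k)}, ρ.Rep r → ρ.Rep s →
      El.mk (t.subst r) = El.mk (t.subst s) := by
    intro m k r s hr hs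
    rw [← El.mk_up (le_max_left m k), ← El.mk_up (le_max_right m k) (t.subst s), El.mk_eq_mk,
      up_subst, up_subst]
    refine Derives.substCongr t fun τ x => El.mk_eq_mk.1 ?_
    rw [El.mk_up, El.mk_up, hr, hs]
  exact key ρ.exists_rep.choose_spec.choose_spec h

theorem ev_var {Γ : Ctx} {σ : Ty} (x : Var Γ σ) (ρ : Env B Γ) : ev (.var x) ρ = ρ σ x := by
  obtain ⟨n, s, hs⟩ := ρ.exists_rep
  exact (ev_eq_mk _ hs).trans (hs σ x)

theorem ev_subst {Γ Δ : Ctx} {σ : Ty} (t : Tm Γ σ) (s : Sub Γ Δ) (ρ : Env B Δ) :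
    ev (t.subst s) ρ = ev t fun τ x => ev (s τ x) ρ := by
  obtain ⟨n, r, hr⟩ := ρ.exists_rep
  rw [ev_eq_mk _ hr, Tm.subst_subst]
  exact (ev_eq_mk t fun τ x => (ev_eq_mk (s τ x) hr).symm).symm

theorem ev_rename {Γ Δ : Ctx} {σ : Ty} (t : Tm Γ σ) (r : Ren Γ Δ) (ρ : Env B Δ) :
    ev (t.rename r) ρ = ev t fun τ x => ρ τ (r τ x) := by
  simp only [Tm.rename_eq_subst, ev_subst, ev_var]

@[simp]
theorem ev_w {Γ : Ctx} {σ τ : Ty} (t : Tm Γ σ) (a : El B τ) (ρ : Env B Γ) :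
    ev t.w (ρ.cons a) = ev t ρ := by
  rw [Tm.w, ev_rename]; rfl

@[simp]
theorem ev_var_zero {Γ : Ctx} {σ : Ty} (a : El B σ) (ρ : Env B Γ) :
    ev (.var .zero) (ρ.cons a) = a := ev_var _ _

@[simp]
theorem ev_var_succ {Γ : Ctx} {σ τ : Ty} (x : Var Γ σ) (a : El B τ) (ρ : Env B Γ) :
    ev (.var (.succ x)) (ρ.cons a) = ev (.var x) ρ := by
  rw [ev_var, ev_var]; rfl

end BISH

namespace BISH

variable {B : Ctx}

/-! ### Operations on elements -/

namespace El

theorem exists_mk₂ {σ τ : Ty} (a : El B σ) (b : El B τ) :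
    ∃ (n : ℕ) (s : Tm (ctx B n) σ) (t : Tm (ctx B n) τ), a = mk s ∧ b = mk t := by
  obtain ⟨n, s, hs⟩ := ((Env.nil.cons b).cons a).exists_rep
  exact ⟨n, s _ .zero, s _ (.succ .zero), (hs _ .zero).symm, (hs _ (.succ .zero)).symm⟩

theorem exists_mk₃ {σ τ υ : Ty} (a : El B σ) (b : El B τ) (c : El B υ) :
    ∃ (n : ℕ) (s : Tm (ctx B n) σ) (t : Tm (ctx B n) τ) (u : Tm (ctx B n) υ),
      a = mk s ∧ b = mk t ∧ c = mk u := by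
  obtain ⟨n, s, hs⟩ := (((Env.nil.cons c).cons b).cons a).exists_rep
  exact ⟨n, s _ .zero, s _ (.succ .zero), s _ (.succ (.succ .zero)), (hs _ .zero).symm,
    (hs _ (.succ .zero)).symm, (hs _ (.succ (.succ .zero))).symm⟩

/-- A unary operation on elements given by a term. -/
noncomputable def op₁ {σ τ : Ty} (t : Tm [σ] τ) (a : El B σ) : El B τ := ev t (Env.nil.cons a)

/-- A binary operation on elements given by a term. -/
noncomputable def op₂ {σ τ υ : Ty} (t : Tm [σ, τ] υ) (a : El B σ) (b : El B τ) : El B υ :=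
  ev t ((Env.nil.cons b).cons a)

/-- The substitution from the empty context. -/
def nilSub {Δ : Ctx} : Sub [] Δ := fun _ x => nomatch x

theorem nil_rep {n : ℕ} : (Env.nil : Env B []).Rep (n := n) nilSub :=
  fun _ x => nomatch x

theorem op₁_mk {σ τ : Ty} (t : Tm [σ] τ) {n : ℕ} (s : Tm (ctx B n) σ) :
    op₁ t (mk s) = mk (t.subst (consSub s nilSub)) :=
  ev_eq_mk t (nil_rep.cons s)

theorem op₂_mk {σ τ υ : Ty} (t : Tm [σ, τ] υ) {n : ℕ} (s : Tm (ctx B n) σ) (u : Tm (ctx B n) τ) :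
    op₂ t (mk s) (mk u) = mk (t.subst (consSub s (consSub u nilSub))) :=
  ev_eq_mk t ((nil_rep.cons u).cons s)

/-- Equality as a truth value. -/
noncomputable def eq {σ : Ty} : El B σ → El B σ → Om B := op₂ (.eq (.var .zero) (.var (.succ .zero)))

/-- Membership as a truth value. -/
noncomputable def mem {σ : Ty} : El B σ → El B (.pow σ) → Om B :=
  op₂ (.mem (.var .zero) (.var (.succ .zero)))

/-- Pairing. -/
noncomputable def pair {σ τ : Ty} : El B σ → El B τ → El B (.prod σ τ) :=
  op₂ (.pair (.var .zero) (.var (.succ .zero)))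

/-- First projection. -/
noncomputable def fst {σ τ : Ty} : El B (.prod σ τ) → El B σ := op₁ (.fst (.var .zero))

/-- Second projection. -/
noncomputable def snd {σ τ : Ty} : El B (.prod σ τ) → El B τ := op₁ (.snd (.var .zero))

/-- Successor. -/
noncomputable def succ : El B .nat → El B .nat := op₁ (.succ (.var .zero))

/-- Universal quantification over a set of truth. -/
noncomputable def allMem {σ : Ty} : El B (.pow σ) → Om B :=
  op₁ (.all σ (.mem (.var .zero) (.var (.succ .zero))))

/-- Existential quantification over a set of truth. -/
noncomputable def exMem {σ : Ty} : El B (.pow σ) → Om B :=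
  op₁ (.ex σ (.mem (.var .zero) (.var (.succ .zero))))

noncomputable instance : Min (Om B) := ⟨op₂ (.and (.var .zero) (.var (.succ .zero)))⟩
noncomputable instance : Max (Om B) := ⟨op₂ (.or (.var .zero) (.var (.succ .zero)))⟩
noncomputable instance : HImp (Om B) := ⟨op₂ (.imp (.var .zero) (.var (.succ .zero)))⟩
noncomputable instance : Bot (Om B) := ⟨ev .bot Env.nil⟩
noncomputable instance : Compl (Om B) := ⟨fun a => a ⇨ ⊥⟩
noncomputable instance : Zero (El B .nat) := ⟨ev .zero Env.nil⟩
noncomputable instance : Add (El B .nat) := ⟨op₂ (.add (.var .zero) (.var (.succ .zero)))⟩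
noncomputable instance : Mul (El B .nat) := ⟨op₂ (.mul (.var .zero) (.var (.succ .zero)))⟩
noncomputable instance : One (El B .nat) := ⟨succ 0⟩

section mk
variable {n : ℕ} {σ τ : Ty}

theorem eq_mk (s t : Tm (ctx B n) σ) : eq (mk s) (mk t) = mk (s ≐ t) := op₂_mk _ _ _
theorem mem_mk (s : Tm (ctx B n) σ) (t : Tm (ctx B n) (.pow σ)) :
    mem (mk s) (mk t) = mk (s ∊ t) := op₂_mk _ _ _
theorem pair_mk (s : Tm (ctx B n) σ) (t : Tm (ctx B n) τ) :
    pair (mk s) (mk t) = mk (.pair s t) := op₂_mk _ _ _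
theorem fst_mk (s : Tm (ctx B n) (.prod σ τ)) : fst (mk s) = mk (.fst s) := op₁_mk _ _
theorem snd_mk (s : Tm (ctx B n) (.prod σ τ)) : snd (mk s) = mk (.snd s) := op₁_mk _ _
theorem succ_mk (s : Tm (ctx B n) .nat) : succ (mk s) = mk (.succ s) := op₁_mk _ _
theorem allMem_mk (s : Tm (ctx B n) (.pow σ)) :
    allMem (mk s) = mk (All σ fun x => x ∊ s.w) := op₁_mk _ _
theorem exMem_mk (s : Tm (ctx B n) (.pow σ)) :
    exMem (mk s) = mk (Ex σ fun x => x ∊ s.w) := op₁_mk _ _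
theorem inf_mk (s t : Fm (ctx B n)) : mk s ⊓ mk t = mk (s ⋏ t) := op₂_mk _ _ _
theorem sup_mk (s t : Fm (ctx B n)) : mk s ⊔ mk t = mk (s ⋎ t) := op₂_mk _ _ _
theorem himp_mk (s t : Fm (ctx B n)) : mk s ⇨ mk t = mk (s ⇛ t) := op₂_mk _ _ _
theorem bot_eq_mk : (⊥ : Om B) = mk (n := n) .bot := ev_eq_mk _ nil_rep
theorem zero_eq_mk : (0 : El B .nat) = mk (n := n) .zero := ev_eq_mk _ nil_rep
theorem add_mk (s t : Tm (ctx B n) .nat) : mk s + mk t = mk (.add s t) := op₂_mk _ _ _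
theorem mul_mk (s t : Tm (ctx B n) .nat) : mk s * mk t = mk (.mul s t) := op₂_mk _ _ _

end mk

theorem compl_def (a : Om B) : aᶜ = a ⇨ ⊥ := rfl

@[simp]
theorem fst_pair {σ τ : Ty} (a : El B σ) (b : El B τ) : fst (pair a b) = a := by
  obtain ⟨n, s, t, rfl, rfl⟩ := exists_mk₂ a b
  rw [pair_mk, fst_mk, mk_eq_mk]
  exact .fstPair _ _

@[simp]
theorem snd_pair {σ τ : Ty} (a : El B σ) (b : El B τ) : snd (pair a b) = b := by
  obtain ⟨n, s, t, rfl, rfl⟩ := exists_mk₂ a b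
  rw [pair_mk, snd_mk, mk_eq_mk]
  exact .sndPair _ _

@[simp]
theorem pair_fst_snd {σ τ : Ty} (p : El B (.prod σ τ)) : pair (fst p) (snd p) = p := by
  obtain ⟨⟨n, p⟩, rfl⟩ := Quotient.exists_rep p
  change pair (fst (mk p)) (snd (mk p)) = mk p
  rw [fst_mk, snd_mk, pair_mk, mk_eq_mk]
  exact .pairEta _

end El

open El

/-! ### Values of compound terms -/

section ev
variable {Γ : Ctx} {σ τ : Ty} (ρ : Env B Γ)

@[simp] theorem ev_eq (s t : Tm Γ σ) : ev (s ≐ t) ρ = El.eq (ev s ρ) (ev t ρ) := by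
  obtain ⟨n, r, hr⟩ := ρ.exists_rep
  simp only [ev_eq_mk _ hr, eq_mk]; rfl
@[simp] theorem ev_mem (s : Tm Γ σ) (t : Tm Γ (.pow σ)) :
    ev (s ∊ t) ρ = El.mem (ev s ρ) (ev t ρ) := by
  obtain ⟨n, r, hr⟩ := ρ.exists_rep
  simp only [ev_eq_mk _ hr, mem_mk]; rfl
@[simp] theorem ev_pair (s : Tm Γ σ) (t : Tm Γ τ) :
    ev (.pair s t) ρ = El.pair (ev s ρ) (ev t ρ) := by
  obtain ⟨n, r, hr⟩ := ρ.exists_rep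
  simp only [ev_eq_mk _ hr, pair_mk]; rfl
@[simp] theorem ev_fst (s : Tm Γ (.prod σ τ)) : ev (.fst s) ρ = El.fst (ev s ρ) := by
  obtain ⟨n, r, hr⟩ := ρ.exists_rep
  simp only [ev_eq_mk _ hr, fst_mk]; rfl
@[simp] theorem ev_snd (s : Tm Γ (.prod σ τ)) : ev (.snd s) ρ = El.snd (ev s ρ) := by
  obtain ⟨n, r, hr⟩ := ρ.exists_rep
  simp only [ev_eq_mk _ hr, snd_mk]; rfl
@[simp] theorem ev_and (s t : Fm Γ) : ev (s ⋏ t) ρ = ev s ρ ⊓ ev t ρ := by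
  obtain ⟨n, r, hr⟩ := ρ.exists_rep
  simp only [ev_eq_mk _ hr, inf_mk]; rfl
@[simp] theorem ev_or (s t : Fm Γ) : ev (s ⋎ t) ρ = ev s ρ ⊔ ev t ρ := by
  obtain ⟨n, r, hr⟩ := ρ.exists_rep
  simp only [ev_eq_mk _ hr, sup_mk]; rfl
@[simp] theorem ev_imp (s t : Fm Γ) : ev (s ⇛ t) ρ = ev s ρ ⇨ ev t ρ := by
  obtain ⟨n, r, hr⟩ := ρ.exists_rep
  simp only [ev_eq_mk _ hr, himp_mk]; rfl
@[simp] theorem ev_bot : ev .bot ρ = ⊥ := by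
  obtain ⟨n, r, hr⟩ := ρ.exists_rep
  simp only [ev_eq_mk _ hr, bot_eq_mk (n := n)]; rfl
@[simp] theorem ev_zero : ev .zero ρ = 0 := by
  obtain ⟨n, r, hr⟩ := ρ.exists_rep
  simp only [ev_eq_mk _ hr, zero_eq_mk (n := n)]; rfl
theorem ev_succ' (s : Tm Γ .nat) : ev (.succ s) ρ = El.succ (ev s ρ) := by
  obtain ⟨n, r, hr⟩ := ρ.exists_rep
  simp only [ev_eq_mk _ hr, succ_mk]; rfl
@[simp] theorem ev_add (s t : Tm Γ .nat) : ev (.add s t) ρ = ev s ρ + ev t ρ := by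
  obtain ⟨n, r, hr⟩ := ρ.exists_rep
  simp only [ev_eq_mk _ hr, add_mk]; rfl
@[simp] theorem ev_mul (s t : Tm Γ .nat) : ev (.mul s t) ρ = ev s ρ * ev t ρ := by
  obtain ⟨n, r, hr⟩ := ρ.exists_rep
  simp only [ev_eq_mk _ hr, mul_mk]; rfl

theorem ev_neg (s : Fm Γ) : ev (s ⇛ .bot) ρ = (ev s ρ)ᶜ := by
  rw [ev_imp, ev_bot]; rfl

theorem mem_ev_compr (φ : Fm (σ :: Γ)) (a : El B σ) :
    El.mem a (ev (.compr φ) ρ) = ev φ (ρ.cons a) := by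
  obtain ⟨⟨m, t⟩, rfl⟩ := Quotient.exists_rep a
  obtain ⟨n, r, hr⟩ := ρ.exists_rep
  change El.mem (El.mk t) _ = ev φ (ρ.cons (El.mk t))
  rw [← El.mk_up (le_max_left m n) t]
  have hr' := hr.up (le_max_right m n)
  rw [ev_eq_mk _ hr', ev_eq_mk _ (hr'.cons _), mem_mk, mk_eq_mk, ← Tm.subst_liftSub_inst]
  exact Derives.memCompr _ _

/-- Quantification is reduced to an operation on elements of a power type; no operation on families
of truth values is needed. -/
theorem ev_all_eq_allMem (φ : Fm (σ :: Γ)) : ev (.all σ φ) ρ = allMem (ev (.compr φ) ρ) := by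
  obtain ⟨n, r, hr⟩ := ρ.exists_rep
  simp only [ev_eq_mk _ hr, allMem_mk, mk_eq_mk]
  refine Derives.eqAll (Derives.eqSymm ?_)
  have := Derives.memCompr (H := Tm.w '' ∅)
    ((φ.subst (liftSub r σ)).rename (liftRen (fun _ x => Var.succ (τ := σ) x) σ)) (.var .zero)
  rwa [Tm.rename_liftRen_succ_inst] at this

theorem ev_ex_eq_exMem (φ : Fm (σ :: Γ)) : ev (.ex σ φ) ρ = exMem (ev (.compr φ) ρ) := by
  obtain ⟨n, r, hr⟩ := ρ.exists_rep
  simp only [ev_eq_mk _ hr, exMem_mk, mk_eq_mk]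
  refine Derives.eqEx (Derives.eqSymm ?_)
  have := Derives.memCompr (H := Tm.w '' ∅)
    ((φ.subst (liftSub r σ)).rename (liftRen (fun _ x => Var.succ (τ := σ) x) σ)) (.var .zero)
  rwa [Tm.rename_liftRen_succ_inst] at this

end ev

/-! ### Entailment between truth values -/

/-- The truth value `a` entails `b`. -/
def Entails (a b : Om B) : Prop := ∃ (n : ℕ) (φ ψ : Fm (ctx B n)),
  a = El.mk φ ∧ b = El.mk ψ ∧ Derives {φ} ψ

theorem Derives.iff_prv_imp {Γ : Ctx} {φ ψ : Fm Γ} : Derives {φ} ψ ↔ Prv (φ ⇛ ψ) := by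
  constructor
  · intro h
    exact .impI (by simpa using h)
  · intro h
    exact .impE (h.mono (Set.empty_subset _)) (.hyp rfl)

theorem entails_mk {n : ℕ} {φ ψ : Fm (ctx B n)} :
    Entails (El.mk φ) (El.mk ψ) ↔ Derives {φ} ψ := by
  constructor
  · rintro ⟨m, φ', ψ', h₁, h₂, h⟩
    rw [← El.mk_up (le_max_left n m), ← El.mk_up (le_max_right n m) φ', El.mk_eq_mk] at h₁
    rw [← El.mk_up (le_max_left n m), ← El.mk_up (le_max_right n m) ψ', El.mk_eq_mk] at h₂
    have h := Prv.up (Derives.iff_prv_imp.1 h) (le_max_right n m)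
    refine Derives.iff_prv_imp.2 (Prv.of_up (le_max_left n m) (Derives.impI ?_))
    have e : ∀ {χ : Fm (ctx B (max n m))}, Prv χ →
        Derives (insert (up (le_max_left n m) φ) ∅) χ := fun h => h.mono (Set.empty_subset _)
    exact (e h₂.eqSymm).eqMp (.impE (e h) ((e h₁).eqMp (.hyp (Set.mem_insert _ _))))
  · exact fun h => ⟨n, φ, ψ, rfl, rfl, h⟩

namespace Entails

theorem refl (a : Om B) : Entails a a := by
  obtain ⟨⟨n, φ⟩, rfl⟩ := Quotient.exists_rep a
  exact entails_mk.2 (.hyp rfl)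

theorem trans {a b c : Om B} (h : Entails a b) (h' : Entails b c) : Entails a c := by
  obtain ⟨n, φ, ψ, χ, rfl, rfl, rfl⟩ := exists_mk₃ a b c
  rw [entails_mk] at *
  exact .cut h (h'.mono (by simp))

theorem inf_left (a b : Om B) : Entails (a ⊓ b) a := by
  obtain ⟨n, φ, ψ, rfl, rfl⟩ := exists_mk₂ a b
  rw [inf_mk, entails_mk]
  exact .andE₁ (.hyp rfl)

theorem inf_right (a b : Om B) : Entails (a ⊓ b) b := by
  obtain ⟨n, φ, ψ, rfl, rfl⟩ := exists_mk₂ a b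
  rw [inf_mk, entails_mk]
  exact .andE₂ (.hyp rfl)

theorem inf {a b c : Om B} (h : Entails a b) (h' : Entails a c) : Entails a (b ⊓ c) := by
  obtain ⟨n, φ, ψ, χ, rfl, rfl, rfl⟩ := exists_mk₃ a b c
  rw [inf_mk]
  rw [entails_mk] at *
  exact .andI h h'

theorem sup_left (a b : Om B) : Entails a (a ⊔ b) := by
  obtain ⟨n, φ, ψ, rfl, rfl⟩ := exists_mk₂ a b
  rw [sup_mk, entails_mk]
  exact .orI₁ (.hyp rfl)

theorem sup_right (a b : Om B) : Entails b (a ⊔ b) := by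
  obtain ⟨n, φ, ψ, rfl, rfl⟩ := exists_mk₂ a b
  rw [sup_mk, entails_mk]
  exact .orI₂ (.hyp rfl)

theorem himp {a b c : Om B} : Entails a (b ⇨ c) ↔ Entails (a ⊓ b) c := by
  obtain ⟨n, φ, ψ, χ, rfl, rfl, rfl⟩ := exists_mk₃ a b c
  rw [inf_mk, himp_mk, entails_mk, entails_mk]
  constructor
  · intro h
    exact .impE (.cut (.andE₁ (.hyp rfl)) (h.mono (by simp))) (.andE₂ (.hyp rfl))
  · intro h
    exact .impI (.cut (φ := φ ⋏ ψ) (.andI (.hyp (by simp)) (.hyp (by simp))) (h.mono (by simp)))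

theorem sup {a b c : Om B} (h : Entails a c) (h' : Entails b c) : Entails (a ⊔ b) c := by
  obtain ⟨n, φ, ψ, χ, rfl, rfl, rfl⟩ := exists_mk₃ a b c
  rw [sup_mk]
  rw [entails_mk] at *
  exact .orE (.hyp rfl) (h.mono (by simp)) (h'.mono (by simp))

theorem inf_sup {p a b c : Om B} (h : Entails (p ⊓ a) c) (h' : Entails (p ⊓ b) c) :
    Entails (p ⊓ (a ⊔ b)) c := by
  have : ∀ {x}, Entails (p ⊓ x) c → Entails x (p ⇨ c) := fun h =>
    himp.2 (((inf_right _ _).inf (inf_left _ _)).trans h)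
  exact ((inf_right _ _).inf (inf_left _ _)).trans (himp.1 (sup (this h) (this h')))

theorem bot (a : Om B) : Entails ⊥ a := by
  obtain ⟨⟨n, φ⟩, rfl⟩ := Quotient.exists_rep a
  rw [bot_eq_mk (n := n)]
  exact entails_mk.2 (.botE (.hyp rfl))

theorem exMem_of_mem {σ : Ty} (a : El B σ) (A : El B (.pow σ)) : Entails (mem a A) (exMem A) := by
  obtain ⟨n, s, t, rfl, rfl⟩ := exists_mk₂ a A
  rw [mem_mk, exMem_mk, entails_mk]
  refine .exI s ?_
  change Derives _ (s ∊ t.w.inst s)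
  rw [Tm.w_inst]
  exact .hyp rfl

theorem mem_of_allMem {σ : Ty} (a : El B σ) (A : El B (.pow σ)) : Entails (allMem A) (mem a A) := by
  obtain ⟨n, s, t, rfl, rfl⟩ := exists_mk₂ a A
  rw [mem_mk, allMem_mk, entails_mk]
  have : Derives {All _ fun x => x ∊ t.w} (s ∊ t.w.inst s) := 
    .allE (φ := .var .zero ∊ t.w) s (.hyp (Set.mem_singleton _))
  rwa [Tm.w_inst] at this

/-- A parameter introduced after the stages of `a` and `A` serves as the eigenvariable: what is
entailed for it is entailed for a generic element. `inf_exMem` uses the same device for the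
elimination of existential quantifiers. -/
theorem allMem {σ : Ty} [Inh B σ] {a : Om B} {A : El B (.pow σ)}
    (h : ∀ x, Entails a (mem x A)) : Entails a (allMem A) := by
  obtain ⟨n, φ, t, rfl, rfl⟩ := exists_mk₂ a A
  obtain ⟨m, hm, rfl⟩ := exists_parTy_eq B σ n
  have := h (El.mk (n := m + 1) (.var .zero))
  rw [← El.mk_up (Nat.le_succ_of_le hm) t, ← El.mk_up (Nat.le_succ_of_le hm) φ, mem_mk,
    entails_mk, up_succ hm, up_succ hm] at this
  rw [← El.mk_up hm t, ← El.mk_up hm φ, allMem_mk, entails_mk]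
  exact .allI (by rw [Set.image_singleton]; exact this)

theorem inf_exMem {σ : Ty} [Inh B σ] {a b : Om B} {A : El B (.pow σ)}
    (h : ∀ x, Entails (a ⊓ mem x A) b) : Entails (a ⊓ exMem A) b := by
  obtain ⟨n, φ, t, ψ, rfl, rfl, rfl⟩ := exists_mk₃ a A b
  obtain ⟨m, hm, rfl⟩ := exists_parTy_eq B σ n
  have := h (El.mk (n := m + 1) (.var .zero))
  rw [← El.mk_up (Nat.le_succ_of_le hm) t, ← El.mk_up (Nat.le_succ_of_le hm) φ,
    ← El.mk_up (Nat.le_succ_of_le hm) ψ, mem_mk, inf_mk, entails_mk, up_succ hm, up_succ hm,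
    up_succ hm] at this
  rw [← El.mk_up hm t, ← El.mk_up hm φ, ← El.mk_up hm ψ, exMem_mk, inf_mk, entails_mk]
  refine .exE (φ := .var .zero ∊ (up hm t).w) (.andE₂ (.hyp (Set.mem_singleton _)))
    (.cut (φ := (up hm φ).w ⋏ (.var .zero ∊ (up hm t).w)) (.andI (.andE₁ (ψ :=
      (Ex (parTy B m) fun x => x ∊ (up hm t).w).w) (.hyp ?_)) (.hyp (Set.mem_insert _ _)))
      (this.mono ?_))
  · rw [Set.image_singleton]; exact Or.inr rfl
  · exact Set.singleton_subset_iff.2 (Set.mem_insert _ _)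

end Entails

end BISH

namespace BISH

open El

variable {B : Ctx}

/-! ### Worlds: saturated prime theories -/

/-- A saturated prime theory in the language with parameters. -/
structure World (B : Ctx) where
  /-- The truth values that hold in the world. -/
  holds : Om B → Prop
  of_entails : ∀ {a b}, Entails a b → holds a → holds b
  inf : ∀ {a b}, holds a → holds b → holds (a ⊓ b)
  top : holds (⊥ ⇨ ⊥)
  not_bot : ¬ holds ⊥
  sup : ∀ {a b}, holds (a ⊔ b) → holds a ∨ holds b
  exMem : ∀ {σ : Ty} [Inh B σ] {A : El B (.pow σ)}, holds (exMem A) → ∃ x, holds (mem x A)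

/-- The truth value `a` holds in the world `w`. -/
def Forces (w : World B) (a : Om B) : Prop := w.holds a

infix:25 "⊩" => Forces

/-- Henkin's construction. The countably many disjunctions and existential statements are listed;
from `a` one descends through truth values that do not entail `b`, meeting one requirement at each
step. The world consists of everything entailed by some member of the chain. -/
theorem exists_world {a b : Om B} (hab : ¬ Entails a b) : ∃ w : World B, (w ⊩ a) ∧ ¬ (w ⊩ b) := by
  let R : Type := (Om B × Om B) ⊕ (Σ σ : {σ : Ty // Inh B σ}, El B (.pow σ.1))
  have : Nonempty R := ⟨.inl (a, a)⟩
  obtain ⟨e, he⟩ := exists_surjective_nat R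
  -- A requirement is met either by deciding for a side or a witness, or because adjoining the
  -- formula would yield `b`. In the latter case the formula can never enter the theory.
  let Q : R → Om B → Prop := fun r p => match r with
    | .inl (c, d) => Entails p c ∨ Entails p d ∨ Entails (p ⊓ (c ⊔ d)) b
    | .inr ⟨_, A⟩ => (∃ x, Entails p (mem x A)) ∨ Entails (p ⊓ El.exMem A) b
  have step : ∀ (r : R) (p : {p : Om B // ¬ Entails p b}),
      ∃ q : {p : Om B // ¬ Entails p b}, Entails q.1 p.1 ∧ Q r q.1 := by
    rintro (⟨c, d⟩ | ⟨⟨σ, hσ⟩, A⟩) p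
    · by_cases h : Entails (p.1 ⊓ (c ⊔ d)) b
      · exact ⟨p, .refl _, Or.inr (Or.inr h)⟩
      · by_cases hc : Entails (p.1 ⊓ c) b
        · by_cases hd : Entails (p.1 ⊓ d) b
          · exact (h (.inf_sup hc hd)).elim
          · exact ⟨⟨_, hd⟩, .inf_left _ _, Or.inr (Or.inl (.inf_right _ _))⟩
        · exact ⟨⟨_, hc⟩, .inf_left _ _, Or.inl (.inf_right _ _)⟩
    · by_cases h : Entails (p.1 ⊓ El.exMem A) b
      · exact ⟨p, .refl _, Or.inr h⟩
      · by_cases hx : ∃ x, ¬ Entails (p.1 ⊓ mem x A) b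
        · obtain ⟨x, hx⟩ := hx
          exact ⟨⟨_, hx⟩, .inf_left _ _, Or.inl ⟨x, .inf_right _ _⟩⟩
        · push Not at hx
          exact (h (.inf_exMem hx)).elim
  choose next hle hQ using step
  let p : ℕ → {p : Om B // ¬ Entails p b} :=
    fun n => n.rec ⟨a, hab⟩ fun k q => next (e k) q
  have anti : ∀ {m n}, m ≤ n → Entails (p n).1 (p m).1 := by
    intro m n h
    induction h with
    | refl => exact .refl _
    | step _ ih => exact (hle _ _).trans ih
  have hp : ∀ r, ∃ n, Q r (p n).1 := by
    intro r
    obtain ⟨k, rfl⟩ := he r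
    exact ⟨k + 1, hQ _ _⟩
  let T : Om B → Prop := fun c => ∃ n, Entails (p n).1 c
  have hsup : ∀ {c d}, T (c ⊔ d) → T c ∨ T d := by
    rintro c d ⟨m, hm⟩
    obtain ⟨n, hn | hn | hn⟩ := hp (.inl (c, d))
    · exact Or.inl ⟨n, hn⟩
    · exact Or.inr ⟨n, hn⟩
    · refine ((p (max m n)).2 (Entails.trans (.inf (anti (le_max_right m n)) ?_) hn)).elim
      exact (anti (le_max_left m n)).trans hm
  have hex : ∀ {σ : Ty} [Inh B σ] {A : El B (.pow σ)}, T (El.exMem A) → ∃ x, T (mem x A) := by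
    rintro σ hσ A ⟨m, hm⟩
    obtain ⟨n, ⟨x, hn⟩ | hn⟩ := hp (.inr ⟨⟨σ, hσ⟩, A⟩)
    · exact ⟨x, n, hn⟩
    · refine ((p (max m n)).2 (Entails.trans (.inf (anti (le_max_right m n)) ?_) hn)).elim
      exact (anti (le_max_left m n)).trans hm
  have hT : ∀ {c}, T c → ¬ Entails c b := fun ⟨n, hn⟩ h => (p n).2 (hn.trans h)
  have ha : T a := ⟨0, .refl _⟩
  have hinf : ∀ {c d}, T c → T d → T (c ⊓ d) := fun ⟨m, hm⟩ ⟨n, hn⟩ =>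
    ⟨max m n, ((anti (le_max_left m n)).trans hm).inf ((anti (le_max_right m n)).trans hn)⟩
  have hof : ∀ {c d}, Entails c d → T c → T d := fun h ⟨n, hn⟩ => ⟨n, hn.trans h⟩
  exact ⟨⟨T, hof, hinf, hof (Entails.himp.2 (.inf_right _ _)) ha, fun h => hT h (.bot _), hsup,
    hex⟩, ha, fun h => hT h (.refl _)⟩

theorem entails_iff {a b : Om B} : Entails a b ↔ ∀ w : World B, (w ⊩ a) → (w ⊩ b) := by
  constructor
  · exact fun h w ha => w.of_entails h ha
  · intro h
    by_contra hab
    obtain ⟨w, ha, hb⟩ := exists_world hab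
    exact hb (h w ha)

/-! ### Forcing -/

/-- The worlds near `w`: those that satisfy a truth value that holds in `w`. -/
def near (w : World B) : Filter (World B) where
  sets := {S | ∃ a, (w ⊩ a) ∧ ∀ v, (v ⊩ a) → v ∈ S}
  univ_sets := ⟨_, w.top, fun _ _ => trivial⟩
  sets_of_superset := fun ⟨a, ha, h⟩ hS => ⟨a, ha, fun v hv => hS (h v hv)⟩
  inter_sets := fun ⟨a, ha, h⟩ ⟨b, hb, h'⟩ => ⟨a ⊓ b, w.inf ha hb, fun v hv =>
    ⟨h v (v.of_entails (.inf_left _ _) hv), h' v (v.of_entails (.inf_right _ _) hv)⟩⟩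

section forces
variable {w : World B} {a b : Om B}

theorem Forces.near (h : w ⊩ a) : ∀ᶠ v in near w, v ⊩ a := ⟨a, h, fun _ hv => hv⟩

theorem near_self {Φ : World B → Prop} (h : ∀ᶠ v in near w, Φ v) : Φ w := by
  obtain ⟨a, ha, h⟩ := h
  exact h w ha

/-- Basic neighbourhoods are open: the truth value that defines one also defines a neighbourhood of
each of its points. This is used to carry facts along when passing below an implication or a
universal quantifier. -/
theorem near_near {Φ : World B → Prop} (h : ∀ᶠ v in near w, Φ v) :
    ∀ᶠ v in near w, ∀ᶠ u in near v, Φ u := by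
  obtain ⟨a, ha, h⟩ := h
  exact ⟨a, ha, fun v hv => ⟨a, hv, h⟩⟩

theorem near_of_forall {Φ : World B → Prop} (h : ∀ v, Φ v) : ∀ᶠ v in near w, Φ v :=
  Filter.Eventually.of_forall h

@[simp] theorem forces_inf : (w ⊩ a ⊓ b) ↔ (w ⊩ a) ∧ (w ⊩ b) :=
  ⟨fun h => ⟨w.of_entails (.inf_left _ _) h, w.of_entails (.inf_right _ _) h⟩,
    fun h => w.inf h.1 h.2⟩

@[simp] theorem forces_sup : (w ⊩ a ⊔ b) ↔ (w ⊩ a) ∨ (w ⊩ b) :=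
  ⟨w.sup, fun h => h.elim (w.of_entails (.sup_left _ _)) (w.of_entails (.sup_right _ _))⟩

@[simp] theorem forces_bot : (w ⊩ ⊥) ↔ False := ⟨w.not_bot, False.elim⟩

/-- From left to right the implication itself is the neighbourhood. Conversely, if `c` defines the
neighbourhood, then `c ⊓ a` forces `b` in all worlds, hence entails it. -/
theorem forces_himp : (w ⊩ a ⇨ b) ↔ ∀ᶠ v in near w, (v ⊩ a) → (v ⊩ b) := by
  constructor
  · exact fun h => ⟨_, h, fun v hv ha =>
      v.of_entails (Entails.himp.1 (.refl _)) (v.inf hv ha)⟩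
  · rintro ⟨c, hc, h⟩
    refine w.of_entails (Entails.himp.2 (entails_iff.2 fun v hv => ?_)) hc
    rw [forces_inf] at hv
    exact h v hv.1 hv.2

theorem forces_compl : (w ⊩ aᶜ) ↔ ∀ᶠ v in near w, ¬ (v ⊩ a) := by
  rw [compl_def, forces_himp]
  simp

theorem Forces.mp (h : w ⊩ a ⇨ b) (ha : w ⊩ a) : w ⊩ b := near_self (forces_himp.1 h) ha

theorem Forces.false (h : w ⊩ aᶜ) (ha : w ⊩ a) : False := near_self (forces_compl.1 h) ha

theorem forces_allMem {σ : Ty} [Inh B σ] {A : El B (.pow σ)} :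
    (w ⊩ allMem A) ↔ ∀ᶠ v in near w, ∀ x, v ⊩ mem x A := by
  constructor
  · exact fun h => ⟨_, h, fun v hv x => v.of_entails (.mem_of_allMem _ _) hv⟩
  · rintro ⟨c, hc, h⟩
    exact w.of_entails (.allMem fun x => entails_iff.2 fun v hv => h v hv x) hc

theorem forces_exMem {σ : Ty} [Inh B σ] {A : El B (.pow σ)} :
    (w ⊩ exMem A) ↔ ∃ x, w ⊩ mem x A :=
  ⟨w.exMem, fun ⟨_, h⟩ => w.of_entails (.exMem_of_mem _ _) h⟩

end forces

/-! ### Equality -/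

/-- An equation that holds in all worlds is entailed by the true proposition `⊥ ⇨ ⊥`, so it is
provable and the two classes coincide. -/
theorem El.eq_of_forces {σ : Ty} {a b : El B σ} (h : ∀ w : World B, w ⊩ El.eq a b) : a = b := by
  have : Entails (⊥ ⇨ ⊥) (El.eq a b) := entails_iff.2 fun w _ => h w
  obtain ⟨n, s, t, rfl, rfl⟩ := exists_mk₂ a b
  rw [bot_eq_mk (n := n), himp_mk, eq_mk, entails_mk] at this
  exact mk_eq_mk.2 (.cut (φ := .bot ⇛ .bot) (.impI (.hyp (Set.mem_insert _ _))) (this.mono (by simp)))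

@[simp] theorem forces_eq_refl {σ : Ty} (w : World B) (a : El B σ) : w ⊩ El.eq a a := by
  obtain ⟨⟨n, s⟩, rfl⟩ := Quotient.exists_rep a
  refine w.of_entails ?_ w.top
  change Entails _ (El.eq (mk s) (mk s))
  rw [bot_eq_mk (n := n), himp_mk, eq_mk, entails_mk]
  exact .eqRefl _

theorem forces_mem_of_eq {σ : Ty} {w : World B} {a b : El B σ} {A : El B (.pow σ)}
    (h : w ⊩ El.eq a b) (ha : w ⊩ mem a A) : w ⊩ mem b A := by
  refine w.of_entails ?_ (w.inf h ha)
  obtain ⟨n, s, t, u, rfl, rfl, rfl⟩ := exists_mk₃ a b A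
  rw [eq_mk, mem_mk, mem_mk, inf_mk, entails_mk]
  have : Derives {(s ≐ t) ⋏ (s ∊ u)} (t ∊ u.w.inst t) := by
    refine .eqSubst (s := s) (.var .zero ∊ u.w) (.andE₁ (.hyp rfl)) ?_
    change Derives _ (s ∊ u.w.inst s)
    rw [Tm.w_inst]
    exact .andE₂ (.hyp rfl)
  rwa [Tm.w_inst] at this

/-- The equivalence of the membership statements is applied to a fresh parameter; then the rule of
set extensionality gives the equation. -/
theorem forces_eq_of_near_mem_iff {σ : Ty} [Inh B σ] {w : World B} {A A' : El B (.pow σ)}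
    (h : ∀ᶠ v in near w, ∀ x, (v ⊩ mem x A) ↔ (v ⊩ mem x A')) : w ⊩ El.eq A A' := by
  obtain ⟨c, hc, h⟩ := h
  refine w.of_entails ?_ hc
  have h₁ : ∀ x, Entails c (mem x A ⇨ mem x A') := fun x =>
    Entails.himp.2 (entails_iff.2 fun v hv => by
      rw [forces_inf] at hv; exact (h v hv.1 x).1 hv.2)
  have h₂ : ∀ x, Entails c (mem x A' ⇨ mem x A) := fun x =>
    Entails.himp.2 (entails_iff.2 fun v hv => by
      rw [forces_inf] at hv; exact (h v hv.1 x).2 hv.2)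
  obtain ⟨n, φ, s, t, rfl, rfl, rfl⟩ := exists_mk₃ c A A'
  obtain ⟨m, hm, rfl⟩ := exists_parTy_eq B σ n
  have h := (h₁ (El.mk (n := m + 1) (.var .zero))).inf (h₂ (El.mk (n := m + 1) (.var .zero)))
  rw [← El.mk_up (Nat.le_succ_of_le hm) s, ← El.mk_up (Nat.le_succ_of_le hm) t,
    ← El.mk_up (Nat.le_succ_of_le hm) φ, mem_mk, mem_mk, himp_mk, himp_mk, inf_mk,
    entails_mk, up_succ hm, up_succ hm, up_succ hm] at h
  rw [← El.mk_up hm s, ← El.mk_up hm t, ← El.mk_up hm φ, eq_mk, entails_mk]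
  exact .setExt (.allI (by rw [Set.image_singleton]; exact h))

theorem El.ext {σ : Ty} [Inh B σ] {A A' : El B (.pow σ)} (h : ∀ x, mem x A = mem x A') : A = A' :=
  El.eq_of_forces fun _ => forces_eq_of_near_mem_iff (near_of_forall fun _ x => by rw [h x])

theorem forces_eq_of_forces_iff {w : World B} {a b : Om B}
    (h : ∀ᶠ v in near w, (v ⊩ a) ↔ (v ⊩ b)) : w ⊩ El.eq a b := by
  obtain ⟨c, hc, h⟩ := h
  refine w.of_entails ?_ hc
  have h₁ : Entails c (a ⇨ b) := Entails.himp.2 (entails_iff.2 fun v hv => by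
      rw [forces_inf] at hv; exact (h v hv.1).1 hv.2)
  have h₂ : Entails c (b ⇨ a) := Entails.himp.2 (entails_iff.2 fun v hv => by
      rw [forces_inf] at hv; exact (h v hv.1).2 hv.2)
  have h := h₁.inf h₂
  obtain ⟨n, φ, s, t, rfl, rfl, rfl⟩ := exists_mk₃ c a b
  rw [himp_mk, himp_mk, inf_mk, entails_mk] at h
  rw [eq_mk, entails_mk]
  exact .propExt h

/-! ### Definable functions, comprehension and quantifiers -/

/-- The values of the parameters. -/
noncomputable def parEnv (B : Ctx) (n : ℕ) : Env B (ctx B n) := fun _ x => El.mk (.var x)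

theorem ev_parEnv {n : ℕ} {σ : Ty} (t : Tm (ctx B n) σ) : ev t (parEnv B n) = El.mk t := by
  have h : (parEnv B n).Rep (fun _ x => .var x) := fun _ _ => rfl
  rw [ev_eq_mk t h, Tm.subst_var]

/-- The function `f` is given by a term with parameters. -/
class Dfn {σ τ : Ty} (f : El B σ → El B τ) : Prop where
  out : ∃ (n : ℕ) (t : Tm (σ :: ctx B n) τ), ∀ a, f a = ev t ((parEnv B n).cons a)

theorem ev_rename_upRen {n m : ℕ} (h : n ≤ m) {σ τ : Ty} (t : Tm (σ :: ctx B n) τ) (a : El B σ) :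
    ev (t.rename (liftRen (upRen h) σ)) ((parEnv B m).cons a) = ev t ((parEnv B n).cons a) := by
  rw [ev_rename]
  congr 1
  funext τ x
  cases x with
  | zero => rfl
  | succ x => exact El.mk_up h (.var x)

theorem Dfn.out₂ {σ τ υ : Ty} (f : El B σ → El B τ) (g : El B σ → El B υ) [hf : Dfn f]
    [hg : Dfn g] : ∃ (n : ℕ) (s : Tm (σ :: ctx B n) τ) (t : Tm (σ :: ctx B n) υ),
      (∀ a, f a = ev s ((parEnv B n).cons a)) ∧ ∀ a, g a = ev t ((parEnv B n).cons a) := by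
  obtain ⟨n, s, hs⟩ := hf.out
  obtain ⟨m, t, ht⟩ := hg.out
  refine ⟨max n m, s.rename (liftRen (upRen (le_max_left n m)) σ),
    t.rename (liftRen (upRen (le_max_right n m)) σ), fun a => ?_, fun a => ?_⟩
  · rw [ev_rename_upRen, hs]
  · rw [ev_rename_upRen, ht]

instance Dfn.id {σ : Ty} : Dfn fun a : El B σ => a := ⟨0, .var .zero, fun a => by simp⟩

instance Dfn.const {σ τ : Ty} (c : El B τ) : Dfn fun _ : El B σ => c := by
  obtain ⟨⟨n, s⟩, rfl⟩ := Quotient.exists_rep c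
  exact ⟨n, s.w, fun a => by rw [ev_w, ev_parEnv]; rfl⟩

theorem Dfn.op₁ {σ τ υ : Ty} (u : Tm [τ] υ) (f : El B σ → El B τ) [hf : Dfn f] :
    Dfn fun a => El.op₁ u (f a) := by
  obtain ⟨n, t, ht⟩ := hf.out
  refine ⟨n, u.subst (consSub t nilSub), fun a => ?_⟩
  rw [ev_subst, El.op₁, ht]
  congr 1
  funext τ x
  cases x with
  | zero => rfl
  | succ x => cases x

theorem Dfn.op₂ {σ τ τ' υ : Ty} (u : Tm [τ, τ'] υ) (f : El B σ → El B τ) (g : El B σ → El B τ')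
    [Dfn f] [Dfn g] : Dfn fun a => El.op₂ u (f a) (g a) := by
  obtain ⟨n, s, t, hs, ht⟩ := Dfn.out₂ f g
  refine ⟨n, u.subst (consSub s (consSub t nilSub)), fun a => ?_⟩
  rw [ev_subst, El.op₂, hs, ht]
  congr 1
  funext τ x
  cases x with
  | zero => rfl
  | succ x =>
    cases x with
    | zero => rfl
    | succ x => cases x

theorem Dfn.comp {σ τ υ : Ty} (g : El B τ → El B υ) (f : El B σ → El B τ) [hg : Dfn g]
    [hf : Dfn f] : Dfn fun a => g (f a) := by
  obtain ⟨n, s, hs⟩ := hf.out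
  obtain ⟨m, t, ht⟩ := hg.out
  refine ⟨max n m, (t.rename (liftRen (upRen (le_max_right n m)) τ)).subst
    (consSub (s.rename (liftRen (upRen (le_max_left n m)) σ)) fun _ x => .var (.succ x)),
    fun a => ?_⟩
  rw [ev_subst, ht, ← ev_rename_upRen (le_max_right n m)]
  congr 1
  funext υ x
  cases x with
  | zero => exact (hs a).trans (ev_rename_upRen _ _ _).symm
  | succ x => exact (ev_var (.succ x) ((parEnv B (max n m)).cons a)).symm

section
variable {σ τ υ : Ty} (f : El B σ → El B τ) [Dfn f]

instance Dfn.pair (g : El B σ → El B υ) [Dfn g] : Dfn fun a => El.pair (f a) (g a) :=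
  Dfn.op₂ _ f g
instance Dfn.eq (g : El B σ → El B τ) [Dfn g] : Dfn fun a => El.eq (f a) (g a) := Dfn.op₂ _ f g
instance Dfn.mem (g : El B σ → El B (.pow τ)) [Dfn g] : Dfn fun a => El.mem (f a) (g a) :=
  Dfn.op₂ _ f g

end

section
variable {σ τ υ : Ty}

instance Dfn.fst (f : El B σ → El B (.prod τ υ)) [Dfn f] : Dfn fun a => El.fst (f a) :=
  Dfn.op₁ _ f
instance Dfn.snd (f : El B σ → El B (.prod τ υ)) [Dfn f] : Dfn fun a => El.snd (f a) :=
  Dfn.op₁ _ f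
instance Dfn.allMem (f : El B σ → El B (.pow τ)) [Dfn f] : Dfn fun a => El.allMem (f a) :=
  Dfn.op₁ _ f
instance Dfn.exMem (f : El B σ → El B (.pow τ)) [Dfn f] : Dfn fun a => El.exMem (f a) :=
  Dfn.op₁ _ f
instance Dfn.inf (f g : El B σ → Om B) [Dfn f] [Dfn g] : Dfn fun a => f a ⊓ g a := Dfn.op₂ _ f g
instance Dfn.sup (f g : El B σ → Om B) [Dfn f] [Dfn g] : Dfn fun a => f a ⊔ g a := Dfn.op₂ _ f g
instance Dfn.himp (f g : El B σ → Om B) [Dfn f] [Dfn g] : Dfn fun a => f a ⇨ g a := Dfn.op₂ _ f g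
instance Dfn.compl (f : El B σ → Om B) [Dfn f] : Dfn fun a => (f a)ᶜ := Dfn.himp f fun _ => ⊥
instance Dfn.add (f g : El B σ → El B .nat) [Dfn f] [Dfn g] : Dfn fun a => f a + g a :=
  Dfn.op₂ _ f g
instance Dfn.mul (f g : El B σ → El B .nat) [Dfn f] [Dfn g] : Dfn fun a => f a * g a :=
  Dfn.op₂ _ f g

end

/-! Instance search sees `fun a => g c a` as `g c`, so these functions need instances of their own. -/

section
variable {σ τ : Ty}

instance Dfn.pair_left (c : El B σ) : Dfn (El.pair (τ := τ) c) :=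
  Dfn.pair (fun _ => c) fun a => a
instance Dfn.eq_left (c : El B σ) : Dfn (El.eq c) := Dfn.eq (fun _ => c) fun a => a
instance Dfn.fst_self : Dfn (El.fst : El B (.prod σ τ) → _) := Dfn.fst fun a => a
instance Dfn.snd_self : Dfn (El.snd : El B (.prod σ τ) → _) := Dfn.snd fun a => a
instance Dfn.inf_left (c : Om B) : Dfn (c ⊓ ·) := Dfn.inf (fun _ => c) fun a => a
instance Dfn.sup_left (c : Om B) : Dfn (c ⊔ ·) := Dfn.sup (fun _ => c) fun a => a
instance Dfn.compl_self : Dfn (Compl.compl : Om B → Om B) := Dfn.compl fun a => a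
instance Dfn.add_left (c : El B .nat) : Dfn (c + ·) := Dfn.add (fun _ => c) fun a => a
instance Dfn.mul_left (c : El B .nat) : Dfn (c * ·) := Dfn.mul (fun _ => c) fun a => a

end

open Classical in
/-- The set of all `x` with `f x`, for a definable `f`. -/
noncomputable def compr {σ : Ty} (f : El B σ → Om B) : El B (.pow σ) :=
  -- For a definable `f` the first case applies, and the set is unique by extensionality; the empty
  -- set is only a default value.
  if h : ∃ A, ∀ x, mem x A = f x then h.choose else ev (.compr .bot) Env.nil

/-- `f x` for all `x`. -/
noncomputable def fal {σ : Ty} (f : El B σ → Om B) : Om B := allMem (compr f)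

/-- `f x` for some `x`. -/
noncomputable def exi {σ : Ty} (f : El B σ → Om B) : Om B := exMem (compr f)

@[simp] theorem mem_compr {σ : Ty} (f : El B σ → Om B) [hf : Dfn f] (a : El B σ) :
    mem a (compr f) = f a := by
  obtain ⟨n, t, ht⟩ := hf.out
  have h : ∃ A, ∀ x, mem x A = f x :=
    ⟨ev (.compr t) (parEnv B n), fun x => by rw [mem_ev_compr, ht]⟩
  rw [compr, dif_pos h]
  exact h.choose_spec a

@[simp] theorem forces_exi {σ : Ty} [Inh B σ] {w : World B} {f : El B σ → Om B} [Dfn f] :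
    (w ⊩ exi f) ↔ ∃ a, w ⊩ f a := by
  simp only [exi, forces_exMem, mem_compr]

theorem forces_fal {σ : Ty} [Inh B σ] {w : World B} {f : El B σ → Om B} [Dfn f] :
    (w ⊩ fal f) ↔ ∀ᶠ v in near w, ∀ a, v ⊩ f a := by
  simp only [fal, forces_allMem, mem_compr]

theorem Forces.all {σ : Ty} [Inh B σ] {w : World B} {f : El B σ → Om B} [Dfn f]
    (h : w ⊩ fal f) (a : El B σ) : w ⊩ f a := near_self (forces_fal.1 h) a

theorem ev_compr {Γ : Ctx} {σ : Ty} [Inh B σ] (φ : Fm (σ :: Γ)) (ρ : Env B Γ) :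
    ev (.compr φ) ρ = compr fun a => ev φ (ρ.cons a) := by
  have h : ∃ A, ∀ x, mem x A = ev φ (ρ.cons x) := ⟨ev (.compr φ) ρ, fun x => mem_ev_compr ρ φ x⟩
  refine El.ext fun x => ?_
  rw [mem_ev_compr, compr, dif_pos h, h.choose_spec]

theorem ev_all {Γ : Ctx} {σ : Ty} [Inh B σ] (φ : Fm (σ :: Γ)) (ρ : Env B Γ) :
    ev (.all σ φ) ρ = fal fun a => ev φ (ρ.cons a) := by
  rw [ev_all_eq_allMem, ev_compr]; rfl

theorem ev_ex {Γ : Ctx} {σ : Ty} [Inh B σ] (φ : Fm (σ :: Γ)) (ρ : Env B Γ) :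
    ev (.ex σ φ) ρ = exi fun a => ev φ (ρ.cons a) := by
  rw [ev_ex_eq_exMem, ev_compr]; rfl

section
variable {σ τ : Ty} [Inh B τ] (f : El B σ → El B τ → Om B)
  [hf : Dfn fun p : El B (.prod σ τ) => f p.fst p.snd]

/-- Definability in two variables is expressed by one variable that ranges over pairs; in this way
one class handles nested binders. -/
instance Dfn.compr : Dfn fun a => BISH.compr fun b => f a b := by
  obtain ⟨n, t, ht⟩ := hf.out
  refine ⟨n, .compr (t.subst (consSub (.pair (.var (.succ .zero)) (.var .zero))
    fun _ x => .var (.succ (.succ x)))), fun a => ?_⟩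
  rw [ev_compr]
  congr 1
  funext b
  have := ht (El.pair a b)
  rw [fst_pair, snd_pair] at this
  rw [this, ev_subst]
  congr 1
  funext υ x
  cases x with
  | zero => simp [consSub]; rfl
  | succ x => simp [consSub, ev_var]; rfl

instance Dfn.fal : Dfn fun a => BISH.fal fun b => f a b := Dfn.allMem _
instance Dfn.exi : Dfn fun a => BISH.exi fun b => f a b := Dfn.exMem _

end

end BISH

namespace BISH

open El

variable {B : Ctx}

/-! ### Completeness -/

theorem derives_of_forces {φ ψ : Fm B}
    (h : ∀ w : World B, (w ⊩ ev φ (parEnv B 0)) → (w ⊩ ev ψ (parEnv B 0))) : Derives {φ} ψ := by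
  have e : ∀ φ : Fm B, ev (B := B) φ (parEnv B 0) = El.mk (n := 0) φ := fun φ => ev_parEnv _
  have := entails_iff.2 h
  rw [e, e] at this
  exact entails_mk.1 this

theorem derives_sentence_of_forces {φ ψ : Sentence}
    (h : ∀ w : World [], (w ⊩ ev φ Env.nil) → (w ⊩ ev ψ Env.nil)) : Derives {φ} ψ := by
  have e : parEnv [] 0 = Env.nil := by funext σ x; cases x
  exact derives_of_forces (by rwa [e])

/-- With one variable of type `σ` in the base context the type is inhabited in every world; for an
arbitrary type over the empty context this may fail. -/
theorem derives_w_of_forces {σ : Ty} {φ ψ : Sentence}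
    (h : ∀ w : World [σ], (w ⊩ ev φ Env.nil) → (w ⊩ ev ψ Env.nil)) :
    Derives {φ.w (τ := σ)} (ψ.w (τ := σ)) := by
  have e : ∀ φ : Sentence, ev (φ.w (τ := σ)) (parEnv [σ] 0) = ev φ Env.nil := fun φ => by
    refine (ev_rename φ _ _).trans ?_
    congr 1; funext τ x; cases x
  exact derives_of_forces (by rwa [e, e])

/-! ### Equality in a world -/

section
variable {w : World B} {σ τ : Ty} {a b c : El B σ}

/-- Elements that are equal in one world need not be the same element, so they can be exchanged only
inside definable properties. -/
theorem Forces.subst (f : El B σ → Om B) [Dfn f] (h : w ⊩ El.eq a b) (ha : w ⊩ f a) : w ⊩ f b := by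
  have := forces_mem_of_eq (A := compr f) h (by rwa [mem_compr])
  rwa [mem_compr] at this

theorem Forces.congr (g : El B σ → El B τ) [Dfn g] (h : w ⊩ El.eq a b) :
    w ⊩ El.eq (g a) (g b) := by
  have : Dfn fun x => El.eq (g a) (g x) := Dfn.comp (fun y => El.eq (g a) y) g
  exact Forces.subst (fun x => El.eq (g a) (g x)) h (forces_eq_refl w _)

theorem Forces.symm (h : w ⊩ El.eq a b) : w ⊩ El.eq b a :=
  Forces.subst (fun x => El.eq x a) h (forces_eq_refl w a)

theorem Forces.trans (h : w ⊩ El.eq a b) (h' : w ⊩ El.eq b c) : w ⊩ El.eq a c :=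
  Forces.subst (fun x => El.eq a x) h' h

end

/-! ### Arithmetic -/

namespace El

theorem add_zero' (m : El B .nat) : m + 0 = m := by
  obtain ⟨⟨n, m⟩, rfl⟩ := Quotient.exists_rep m
  change mk m + 0 = mk m
  rw [zero_eq_mk (n := n), add_mk, mk_eq_mk]; exact .addZero _

theorem add_succ' (m k : El B .nat) : m + succ k = succ (m + k) := by
  obtain ⟨n, m, k, rfl, rfl⟩ := exists_mk₂ m k
  rw [succ_mk, add_mk, add_mk, succ_mk, mk_eq_mk]; exact .addSucc _ _

theorem mul_zero' (m : El B .nat) : m * 0 = 0 := by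
  obtain ⟨⟨n, m⟩, rfl⟩ := Quotient.exists_rep m
  change mk m * 0 = 0
  rw [zero_eq_mk (n := n), mul_mk, mk_eq_mk]; exact .mulZero _

theorem mul_succ' (m k : El B .nat) : m * succ k = m * k + m := by
  obtain ⟨n, m, k, rfl, rfl⟩ := exists_mk₂ m k
  rw [succ_mk, mul_mk, mul_mk, add_mk, mk_eq_mk]; exact .mulSucc _ _

theorem succ_eq_add_one (m : El B .nat) : succ m = m + 1 := by
  change _ = m + succ 0
  rw [add_succ', add_zero']

theorem add_add_one (m k : El B .nat) : m + (k + 1) = m + k + 1 := by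
  rw [← succ_eq_add_one, ← succ_eq_add_one, add_succ']

theorem mul_add_one' (m k : El B .nat) : m * (k + 1) = m * k + m := by
  rw [← succ_eq_add_one, mul_succ']

end El

@[simp] theorem ev_succ {Γ : Ctx} (ρ : Env B Γ) (s : Tm Γ .nat) :
    ev (.succ s) ρ = ev s ρ + 1 := by
  rw [ev_succ', succ_eq_add_one]

theorem forces_add_one_ne_zero {w : World B} {m : El B .nat} (h : w ⊩ El.eq (m + 1) 0) :
    False := by
  obtain ⟨⟨n, m⟩, rfl⟩ := Quotient.exists_rep m
  change w ⊩ El.eq (mk m + 1) 0 at h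
  rw [← succ_eq_add_one, zero_eq_mk (n := n), succ_mk, eq_mk] at h
  refine w.not_bot (w.of_entails ?_ h)
  rw [bot_eq_mk (n := n), entails_mk]
  exact .succNeZero (.hyp rfl)

theorem forces_add_one_inj {w : World B} {m k : El B .nat} (h : w ⊩ El.eq (m + 1) (k + 1)) :
    w ⊩ El.eq m k := by
  obtain ⟨n, m, k, rfl, rfl⟩ := exists_mk₂ m k
  rw [← succ_eq_add_one, ← succ_eq_add_one, succ_mk, succ_mk, eq_mk] at h
  refine w.of_entails ?_ h
  rw [eq_mk, entails_mk]
  exact .succInj (.hyp rfl)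

/-- The induction rule is applied to the set of all `n` with `f n`. The step is required in all
nearby worlds because its premise is a universally quantified implication. -/
theorem forces_induction {w : World B} {f : El B .nat → Om B} [Dfn f] (h₀ : w ⊩ f 0)
    (hs : ∀ᶠ v in near w, ∀ n, (v ⊩ f n) → (v ⊩ f (n + 1))) (n : El B .nat) : w ⊩ f n := by
  let Z : Fm [.pow .nat] := .zero ∊ .var .zero
  let S : Fm [.pow .nat] := AllIn (.var .zero) fun n => n.succ ∊ (.var .zero : Tm [.pow .nat] _).w
  let C : Fm [.pow .nat] := All .nat fun n => n ∊ (.var .zero : Tm [.pow .nat] _).w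
  have key : ∀ A : El B (.pow .nat),
      Entails (ev (Z ⋏ S) (Env.nil.cons A)) (ev C (Env.nil.cons A)) := by
    intro A
    obtain ⟨⟨k, t⟩, rfl⟩ := Quotient.exists_rep A
    have hr := nil_rep.cons t
    change Entails (ev _ (Env.nil.cons (mk t))) (ev _ (Env.nil.cons (mk t)))
    rw [ev_eq_mk _ hr, ev_eq_mk _ hr, entails_mk]
    exact .induction (.andE₁ (.hyp rfl)) (.andE₂ (.hyp rfl))
  have := w.of_entails (key (compr f)) (a := ev (Z ⋏ S) (Env.nil.cons (compr f))) (by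
    change w ⊩ _
    simp only [Z, S, ev_and, ev_mem, ev_zero, ev_var_zero, ev_all, ev_imp, ev_w, ev_succ,
      mem_compr, forces_inf]
    have : Dfn fun n => f (n + 1) := Dfn.comp f (fun n => n + 1)
    refine ⟨h₀, ?_⟩
    rw [forces_fal]
    filter_upwards [near_near hs] with v hv n
    rw [forces_himp]
    filter_upwards [hv] with u hu using hu n)
  change w ⊩ _ at this
  simp only [C, ev_all, ev_mem, ev_var_zero, ev_w, mem_compr] at this
  exact this.all n

namespace El

/-- Induction in each world shows that two definable functions with the same recursion agree there,
and agreement in all worlds is equality of elements. All the semiring laws are obtained in this way.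
-/
theorem eq_of_recursion {σ : Ty} {F G : El B .nat → El B σ} [hF : Dfn F] [hG : Dfn G]
    (s : El B σ → El B σ) [Dfn s] (h₀ : F 0 = G 0) (hF : ∀ n, F (n + 1) = s (F n))
    (hG : ∀ n, G (n + 1) = s (G n)) (n : El B .nat) : F n = G n := by
  refine El.eq_of_forces fun w => forces_induction (f := fun n => El.eq (F n) (G n)) ?_ ?_ n
  · rw [h₀]; exact forces_eq_refl _ _
  · refine near_of_forall fun v n h => ?_
    rw [hF, hG]
    exact h.congr s

theorem zero_add' (n : El B .nat) : 0 + n = n :=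
  eq_of_recursion (F := fun n => 0 + n) (G := fun n => n) (fun x => x + 1) (add_zero' 0)
    (fun _ => add_add_one _ _) (fun _ => rfl) n

theorem add_one_add (m n : El B .nat) : m + 1 + n = m + n + 1 :=
  eq_of_recursion (F := fun n => m + 1 + n) (G := fun n => m + n + 1) (fun x => x + 1)
    (by simp only [add_zero']) (fun _ => add_add_one _ _) (fun _ => by rw [add_add_one]) n

theorem add_comm' (m n : El B .nat) : m + n = n + m :=
  eq_of_recursion (F := fun n => m + n) (G := fun n => n + m) (fun x => x + 1)
    (by simp only [add_zero', zero_add']) (fun _ => add_add_one _ _) (fun _ => add_one_add _ _) n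

theorem add_assoc' (a b c : El B .nat) : a + b + c = a + (b + c) :=
  eq_of_recursion (F := fun c => a + b + c) (G := fun c => a + (b + c)) (fun x => x + 1)
    (by simp only [add_zero']) (fun _ => add_add_one _ _) (fun _ => by simp only [add_add_one]) c

noncomputable instance : AddCommMonoid (El B .nat) where
  add_assoc := add_assoc'
  zero_add := zero_add'
  add_zero := add_zero'
  add_comm := add_comm'
  nsmul := nsmulRec

theorem zero_mul' (n : El B .nat) : 0 * n = 0 :=
  eq_of_recursion (F := fun n => 0 * n) (G := fun _ => 0) (fun x => x + 0) (mul_zero' 0)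
    (fun _ => mul_add_one' _ _) (fun _ => by simp only [add_zero]) n

theorem add_one_mul' (m n : El B .nat) : (m + 1) * n = m * n + n :=
  eq_of_recursion (F := fun n => (m + 1) * n) (G := fun n => m * n + n) (fun x => x + (m + 1))
    (by simp only [mul_zero', add_zero]) (fun _ => mul_add_one' _ _)
    (fun _ => by rw [mul_add_one']; abel) n

theorem mul_comm' (m n : El B .nat) : m * n = n * m :=
  eq_of_recursion (F := fun n => m * n) (G := fun n => n * m) (fun x => x + m)
    (by simp only [mul_zero', zero_mul']) (fun _ => mul_add_one' _ _)
    (fun _ => add_one_mul' _ _) n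

theorem mul_add' (a b c : El B .nat) : a * (b + c) = a * b + a * c :=
  eq_of_recursion (F := fun c => a * (b + c)) (G := fun c => a * b + a * c) (fun x => x + a)
    (by simp only [mul_zero', add_zero]) (fun _ => by rw [add_add_one, mul_add_one'])
    (fun _ => by rw [mul_add_one', add_assoc]) c

theorem mul_assoc' (a b c : El B .nat) : a * b * c = a * (b * c) :=
  eq_of_recursion (F := fun c => a * b * c) (G := fun c => a * (b * c)) (fun x => x + a * b)
    (by simp only [mul_zero']) (fun _ => mul_add_one' _ _)
    (fun _ => by rw [mul_add_one', mul_add']) c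

theorem mul_one' (a : El B .nat) : a * 1 = a := by
  change a * succ 0 = a
  rw [mul_succ', mul_zero', zero_add]

noncomputable instance : CommSemiring (El B .nat) where
  mul_assoc := mul_assoc'
  mul_comm := mul_comm'
  one_mul a := by rw [mul_comm', mul_one']
  mul_one := mul_one'
  zero_mul := zero_mul'
  mul_zero := mul_zero'
  left_distrib := mul_add'
  right_distrib a b c := by simp only [mul_comm' _ c, mul_add']
  npow := npowRec

end El

end BISH

namespace BISH

open El

variable {B : Ctx}

/-! ### Collapsing iterated passages to nearby worlds -/

section
variable {w : World B}

/-- Each internal quantifier or implication contributes its own passage to nearby worlds. This lemma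
and the next two merge all of them into a single one, which keeps the pointwise descriptions below
readable. -/
theorem near_forall_near {ι : Sort*} {Φ : ι → World B → Prop} :
    (∀ᶠ v in near w, ∀ i, ∀ᶠ u in near v, Φ i u) ↔ ∀ᶠ v in near w, ∀ i, Φ i v := by
  constructor
  · intro h
    filter_upwards [h] with v hv i using near_self (hv i)
  · intro h
    filter_upwards [near_near h] with v hv i
    filter_upwards [hv] with u hu using hu i

theorem near_imp_near {a : Om B} {Φ : World B → Prop} :
    (∀ᶠ v in near w, (v ⊩ a) → ∀ᶠ u in near v, Φ u) ↔ ∀ᶠ v in near w, (v ⊩ a) → Φ v := by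
  constructor
  · intro h
    filter_upwards [h] with v hv ha using near_self (hv ha)
  · intro h
    filter_upwards [near_near h] with v hv ha
    filter_upwards [hv, ha.near] with u hu ha using hu ha

theorem near_and_near {Φ Ψ : World B → Prop} :
    ((∀ᶠ v in near w, Φ v) ∧ (∀ᶠ v in near w, Ψ v)) ↔ ∀ᶠ v in near w, Φ v ∧ Ψ v :=
  Filter.eventually_and.symm

end

/-! ### The natural numbers of a world -/

/-- Equality of natural numbers in a world. -/
def natCon (w : World B) : RingCon (El B .nat) where
  r a b := w ⊩ El.eq a b
  iseqv := ⟨forces_eq_refl w, Forces.symm, Forces.trans⟩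
  add' h h' := (h.congr (fun x => x + _)).trans (h'.congr (fun x => _ + x))
  mul' h h' := (h.congr (fun x => x * _)).trans (h'.congr (fun x => _ * x))

/-- The natural numbers of a world. -/
def Num (w : World B) : Type := (natCon w).Quotient

noncomputable instance (w : World B) : CommSemiring (Num w) :=
  inferInstanceAs (CommSemiring (natCon w).Quotient)

/-- The natural number denoted by an element. -/
noncomputable def num (w : World B) : El B .nat →+* Num w := (natCon w).mk'

section
variable {w : World B}

theorem num_eq_num {a b : El B .nat} : num w a = num w b ↔ (w ⊩ El.eq a b) :=
  (natCon w).eq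

theorem num_surjective : Function.Surjective (num w) := (natCon w).mk'_surjective

namespace Num

theorem add_one_ne_zero (x : Num w) : x + 1 ≠ 0 := by
  obtain ⟨a, rfl⟩ := num_surjective x
  intro h
  rw [← map_one (num w), ← map_add, ← map_zero (num w), num_eq_num] at h
  exact forces_add_one_ne_zero h

theorem add_one_inj {x y : Num w} (h : x + 1 = y + 1) : x = y := by
  obtain ⟨a, rfl⟩ := num_surjective x
  obtain ⟨b, rfl⟩ := num_surjective y
  rw [← map_one (num w), ← map_add, ← map_add, num_eq_num] at h
  exact num_eq_num.2 (forces_add_one_inj h)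

theorem eq_zero_or_eq_add_one (x : Num w) : x = 0 ∨ ∃ y, x = y + 1 := by
  obtain ⟨a, rfl⟩ := num_surjective x
  have : w ⊩ El.eq a 0 ⊔ exi fun b => El.eq a (b + 1) := by
    refine forces_induction (f := fun a => El.eq a 0 ⊔ exi fun b => El.eq a (b + 1)) (by simp)
      (near_of_forall fun v n _ => ?_) a
    rw [forces_sup, forces_exi]
    exact Or.inr ⟨n, forces_eq_refl _ _⟩
  rw [forces_sup, forces_exi] at this
  obtain h | ⟨b, h⟩ := this
  · exact Or.inl (by rw [num_eq_num.2 h, map_zero])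
  · exact Or.inr ⟨num w b, by rw [num_eq_num.2 h, map_add, map_one]⟩

theorem add_right_cancel {x y z : Num w} (h : x + z = y + z) : x = y := by
  obtain ⟨a, rfl⟩ := num_surjective x
  obtain ⟨b, rfl⟩ := num_surjective y
  obtain ⟨c, rfl⟩ := num_surjective z
  have : w ⊩ El.eq (a + c) (b + c) ⇨ El.eq a b := by
    refine forces_induction (f := fun c => El.eq (a + c) (b + c) ⇨ El.eq a b) ?_ ?_ c
    · rw [forces_himp, add_zero, add_zero]
      exact near_of_forall fun _ h => h
    · refine near_of_forall fun v n hn => ?_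
      rw [forces_himp]
      filter_upwards [hn.near] with u hu h
      rw [← add_assoc, ← add_assoc] at h
      exact hu.mp (forces_add_one_inj h)
  rw [← map_add, ← map_add, num_eq_num] at h
  exact num_eq_num.2 (this.mp h)

theorem total (x y : Num w) : (∃ z, x + z = y) ∨ ∃ z, y + z = x := by
  obtain ⟨a, rfl⟩ := num_surjective x
  obtain ⟨b, rfl⟩ := num_surjective y
  -- Comparability is written as a truth value so that induction applies to it; `key` translates it
  -- back to the numbers of each world.
  let f : El B .nat → Om B := fun b =>
    (exi fun k => El.eq (a + k) b) ⊔ exi fun k => El.eq (b + k) a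
  have hf : Dfn f := inferInstance
  have key : ∀ (v : World B) (b : El B .nat), (v ⊩ f b) ↔
      (∃ z, num v a + z = num v b) ∨ ∃ z, num v b + z = num v a := by
    intro v b
    simp only [f, forces_sup, forces_exi, ← num_eq_num, map_add, num_surjective.exists]
  rw [← key]
  refine forces_induction ((key w 0).2 (Or.inr ⟨num w a, by simp⟩))
    (near_of_forall fun v n hn => ?_) b
  rw [key] at hn ⊢
  rw [map_add, map_one]
  obtain ⟨z, hz⟩ | ⟨z, hz⟩ := hn
  · exact Or.inl ⟨z + 1, by rw [← hz]; ring⟩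
  · obtain rfl | ⟨z, rfl⟩ := eq_zero_or_eq_add_one z
    · exact Or.inl ⟨1, by rw [← hz]; ring⟩
    · exact Or.inr ⟨z, by rw [← hz]; ring⟩

theorem eq_zero_of_add_eq_zero {x y : Num w} (h : x + y = 0) : x = 0 := by
  obtain rfl | ⟨y, rfl⟩ := eq_zero_or_eq_add_one y
  · simpa using h
  · exact (add_one_ne_zero (x + y) (by rw [← h]; ring)).elim

-- In each world the numbers form a linearly ordered semiring, because comparability is proved by
-- induction. Computations with codes of rationals are therefore left to ordinary ordered algebra.
open Classical in
noncomputable instance : LinearOrder (Num w) where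
  le x y := ∃ z, x + z = y
  le_refl x := ⟨0, add_zero x⟩
  le_trans := by
    rintro x y z ⟨u, rfl⟩ ⟨v, rfl⟩
    exact ⟨u + v, by ring⟩
  le_antisymm := by
    rintro x y ⟨u, rfl⟩ ⟨v, h⟩
    have : u + v + x = 0 + x := by rw [zero_add, ← add_comm x, ← add_assoc, h]
    rw [eq_zero_of_add_eq_zero (add_right_cancel this), add_zero]
  le_total := total
  toDecidableLE := fun _ _ => Classical.propDecidable _

theorem le_def {x y : Num w} : x ≤ y ↔ ∃ z, x + z = y := Iff.rfl

theorem lt_def {x y : Num w} : x < y ↔ ∃ z, x + (z + 1) = y := by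
  rw [lt_iff_le_and_ne, le_def]
  constructor
  · rintro ⟨⟨z, rfl⟩, h⟩
    obtain rfl | ⟨z, rfl⟩ := eq_zero_or_eq_add_one z
    · simp at h
    · exact ⟨z, rfl⟩
  · rintro ⟨z, rfl⟩
    refine ⟨⟨_, rfl⟩, fun h => add_one_ne_zero z (add_right_cancel (z := x) ?_)⟩
    rw [zero_add, add_comm]; exact h.symm

noncomputable instance : IsStrictOrderedRing (Num w) where
  add_le_add_left := by
    rintro x y ⟨u, rfl⟩ z
    exact ⟨u, by ring⟩
  le_of_add_le_add_left := by
    rintro x y z ⟨u, h⟩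
    exact ⟨u, add_right_cancel (z := x) (by rw [add_comm z, ← h]; ring)⟩
  zero_le_one := ⟨1, zero_add 1⟩
  exists_pair_ne := ⟨1, 0, by rw [← zero_add (1 : Num w)]; exact add_one_ne_zero 0⟩
  mul_lt_mul_of_pos_left := by
    intro x hx y z hyz
    obtain ⟨u, rfl⟩ := lt_def.1 hyz
    obtain ⟨v, rfl⟩ := lt_def.1 hx
    exact lt_def.2 ⟨v * u + v + u, by ring⟩
  mul_lt_mul_of_pos_right := by
    intro x hx y z hyz
    obtain ⟨u, rfl⟩ := lt_def.1 hyz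
    obtain ⟨v, rfl⟩ := lt_def.1 hx
    exact lt_def.2 ⟨v * u + v + u, by ring⟩

theorem zero_le (x : Num w) : 0 ≤ x := ⟨x, zero_add x⟩

theorem add_one_pos (x : Num w) : 0 < x + 1 := lt_def.2 ⟨x, zero_add _⟩

theorem lt_add_one_iff {x y : Num w} : x < y + 1 ↔ x ≤ y := by
  rw [lt_def, le_def]
  refine exists_congr fun z => ?_
  rw [← add_assoc]
  exact ⟨add_one_inj, fun h => by rw [h]⟩

end Num

end

/-- `m < n`. -/
noncomputable def El.natLt (m n : El B .nat) : Om B := exi fun k => El.eq (m + (k + 1)) n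

/-- `m ≤ n`. -/
noncomputable def El.natLe (m n : El B .nat) : Om B := exi fun k => El.eq (m + k) n

theorem ev_natLt {Γ : Ctx} (ρ : Env B Γ) (m n : Tm Γ .nat) :
    ev (BISH.natLt m n) ρ = El.natLt (ev m ρ) (ev n ρ) := by
  simp [BISH.natLt, ev_ex, El.natLt]

theorem ev_natLe {Γ : Ctx} (ρ : Env B Γ) (m n : Tm Γ .nat) :
    ev (BISH.natLe m n) ρ = El.natLe (ev m ρ) (ev n ρ) := by
  simp [BISH.natLe, ev_ex, El.natLe]

instance Dfn.natLt {σ : Ty} (f g : El B σ → El B .nat) [Dfn f] [Dfn g] :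
    Dfn fun a => El.natLt (f a) (g a) := by
  have := Dfn.comp f (El.fst : El B (.prod σ .nat) → _)
  have := Dfn.comp g (El.fst : El B (.prod σ .nat) → _)
  unfold El.natLt
  infer_instance
instance Dfn.natLe {σ : Ty} (f g : El B σ → El B .nat) [Dfn f] [Dfn g] :
    Dfn fun a => El.natLe (f a) (g a) := by
  have := Dfn.comp f (El.fst : El B (.prod σ .nat) → _)
  have := Dfn.comp g (El.fst : El B (.prod σ .nat) → _)
  unfold El.natLe
  infer_instance
instance Dfn.natLe_left (c : El B .nat) : Dfn (El.natLe c) := Dfn.natLe (fun _ => c) fun a => a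

theorem forces_natLt {w : World B} {m n : El B .nat} :
    (w ⊩ El.natLt m n) ↔ num w m < num w n := by
  simp only [El.natLt, forces_exi, ← num_eq_num, map_add, map_one, Num.lt_def,
    num_surjective.exists]

theorem forces_natLe {w : World B} {m n : El B .nat} :
    (w ⊩ El.natLe m n) ↔ num w m ≤ num w n := by
  simp only [El.natLe, forces_exi, ← num_eq_num, map_add, Num.le_def, num_surjective.exists]

end BISH

namespace BISH

open El

variable {B : Ctx}

/-! ### Rational numbers -/

namespace El

/-- `p < q`. -/
noncomputable def ratLt (p q : El B ratTy) : Om B :=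
  natLt (p.fst.fst * (q.snd + 1) + q.fst.snd * (p.snd + 1))
    (q.fst.fst * (p.snd + 1) + p.fst.snd * (q.snd + 1))

/-- `p + q`. -/
noncomputable def ratAdd (p q : El B ratTy) : El B ratTy :=
  pair (pair (p.fst.fst * (q.snd + 1) + q.fst.fst * (p.snd + 1))
    (p.fst.snd * (q.snd + 1) + q.fst.snd * (p.snd + 1))) (p.snd * q.snd + p.snd + q.snd)

/-- `0`. -/
noncomputable def ratZero : El B ratTy := pair (pair 0 0) 0

/-- `1`. -/
noncomputable def ratOne : El B ratTy := pair (pair 1 0) 0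

/-- `1 / (n + 1)`. -/
noncomputable def ratInv (n : El B .nat) : El B ratTy := pair (pair 1 0) n

/-- `q / (n + 1)`. -/
noncomputable def ratDiv (q : El B ratTy) (n : El B .nat) : El B ratTy :=
  pair q.fst (q.snd * n + q.snd + n)

end El

theorem ev_ratLt {Γ : Ctx} (ρ : Env B Γ) (p q : Tm Γ ratTy) :
    ev (BISH.ratLt p q) ρ = El.ratLt (ev p ρ) (ev q ρ) := by
  simp [BISH.ratLt, ev_natLt, El.ratLt]

theorem ev_ratAdd {Γ : Ctx} (ρ : Env B Γ) (p q : Tm Γ ratTy) :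
    ev (BISH.ratAdd p q) ρ = El.ratAdd (ev p ρ) (ev q ρ) := by
  simp [BISH.ratAdd, El.ratAdd]

theorem ev_ratZero {Γ : Ctx} (ρ : Env B Γ) : ev BISH.ratZero ρ = El.ratZero := by
  simp [BISH.ratZero, El.ratZero]

theorem ev_ratOne {Γ : Ctx} (ρ : Env B Γ) : ev BISH.ratOne ρ = El.ratOne := by
  simp [BISH.ratOne, El.ratOne]

instance Dfn.ratLt {σ : Ty} (f g : El B σ → El B ratTy) [Dfn f] [Dfn g] :
    Dfn fun a => El.ratLt (f a) (g a) := by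
  unfold El.ratLt; infer_instance
instance Dfn.ratLt_left (c : El B ratTy) : Dfn (El.ratLt c) := Dfn.ratLt (fun _ => c) fun a => a
instance Dfn.ratAdd {σ : Ty} (f g : El B σ → El B ratTy) [Dfn f] [Dfn g] :
    Dfn fun a => El.ratAdd (f a) (g a) := by
  unfold El.ratAdd; infer_instance
instance Dfn.ratAdd_left (c : El B ratTy) : Dfn (El.ratAdd c) := Dfn.ratAdd (fun _ => c) fun a => a
instance Dfn.ratInv {σ : Ty} (f : El B σ → El B .nat) [Dfn f] :
    Dfn fun a => El.ratInv (f a) := by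
  unfold El.ratInv; infer_instance
instance Dfn.ratInv_self : Dfn (El.ratInv : El B .nat → _) := Dfn.ratInv fun a => a
instance Dfn.ratDiv {σ : Ty} (f : El B σ → El B ratTy) (g : El B σ → El B .nat) [Dfn f] [Dfn g] :
    Dfn fun a => El.ratDiv (f a) (g a) := by
  unfold El.ratDiv; infer_instance
instance Dfn.ratDiv_left (c : El B ratTy) : Dfn (El.ratDiv c) := Dfn.ratDiv (fun _ => c) fun a => a

namespace El

section
variable {w : World B} {p q r : El B ratTy} {n : El B .nat}

theorem forces_ratLt : (w ⊩ ratLt p q) ↔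
    num w p.fst.fst * (num w q.snd + 1) + num w q.fst.snd * (num w p.snd + 1) <
      num w q.fst.fst * (num w p.snd + 1) + num w p.fst.snd * (num w q.snd + 1) := by
  rw [El.ratLt, forces_natLt]; simp

theorem ratLt_irrefl : ¬ (w ⊩ ratLt p p) := by
  rw [forces_ratLt]; exact lt_irrefl _

theorem ratLt_trans (h : w ⊩ ratLt p q) (h' : w ⊩ ratLt q r) : w ⊩ ratLt p r := by
  rw [forces_ratLt] at *
  have hp := Num.add_one_pos (num w p.snd)
  have hq := Num.add_one_pos (num w q.snd)
  have hr := Num.add_one_pos (num w r.snd)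
  generalize num w p.snd + 1 = C at *
  generalize num w q.snd + 1 = C' at *
  generalize num w r.snd + 1 = C'' at *
  generalize num w p.fst.fst = a at *
  generalize num w p.fst.snd = b at *
  generalize num w q.fst.fst = a' at *
  generalize num w q.fst.snd = b' at *
  have := add_lt_add (mul_lt_mul_of_pos_right h hr) (mul_lt_mul_of_pos_right h' hp)
  refine lt_of_mul_lt_mul_right (a := C') (lt_of_add_lt_add_right
    (a := b' * C * C'' + a' * C'' * C) ?_) hq.le
  convert this using 1 <;> ring

theorem ratLt_or_ratLt (h : w ⊩ ratLt p q) (r : El B ratTy) :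
    (w ⊩ ratLt p r) ∨ (w ⊩ ratLt r q) := by
  by_contra hn
  rw [not_or] at hn
  simp only [forces_ratLt, not_lt] at *
  have hp := Num.add_one_pos (num w p.snd)
  have hq := Num.add_one_pos (num w q.snd)
  have hr := Num.add_one_pos (num w r.snd)
  generalize num w p.snd + 1 = C at *
  generalize num w q.snd + 1 = C' at *
  generalize num w r.snd + 1 = C'' at *
  generalize num w p.fst.fst = a at *
  generalize num w p.fst.snd = b at *
  generalize num w q.fst.fst = a' at *
  generalize num w q.fst.snd = b' at *
  generalize num w r.fst.fst = a'' at *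
  generalize num w r.fst.snd = b'' at *
  have := add_le_add (mul_le_mul_of_nonneg_right hn.1 hq.le) (mul_le_mul_of_nonneg_right hn.2 hp.le)
  refine h.not_ge (le_of_mul_le_mul_right (a := C'') (le_of_add_le_add_right
    (a := b'' * C * C' + a'' * C' * C) ?_) hr)
  convert this using 1 <;> ring

theorem ratLt_asymm (h : w ⊩ ratLt p q) : ¬ (w ⊩ ratLt q p) := fun h' =>
  ratLt_irrefl (ratLt_trans h h')

theorem exists_ratLt_ratLt (h : w ⊩ ratLt p q) : ∃ r, (w ⊩ ratLt p r) ∧ (w ⊩ ratLt r q) := by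
  -- The mediant. Codes store the denominator minus one, so the denominators `p.snd + 1` and `q.snd
  -- + 1` add up to the one coded by `p.snd + q.snd + 1`.
  refine ⟨pair (pair (p.fst.fst + q.fst.fst) (p.fst.snd + q.fst.snd)) (p.snd + q.snd + 1), ?_, ?_⟩
  all_goals
    rw [forces_ratLt] at *
    simp only [fst_pair, snd_pair, map_add, map_one]
    generalize num w p.fst.fst = a at *
    generalize num w p.fst.snd = b at *
    generalize num w q.fst.fst = a' at *
    generalize num w q.fst.snd = b' at *
    generalize num w p.snd = c at *
    generalize num w q.snd = c' at *
  · have := add_lt_add_left h (a * (c + 1) + b * (c + 1))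
    convert this using 1 <;> ring
  · have := add_lt_add_left h (a' * (c' + 1) + b' * (c' + 1))
    convert this using 1 <;> ring

theorem exists_ratLt (w : World B) (p : El B ratTy) : ∃ q, w ⊩ ratLt q p := by
  -- This codes p - 1.
  refine ⟨pair (pair p.fst.fst (p.fst.snd + p.snd + 1)) p.snd, ?_⟩
  rw [forces_ratLt]
  simp only [fst_pair, snd_pair, map_add, map_one]
  have := lt_add_of_pos_right (num w p.fst.fst * (num w p.snd + 1) +
    num w p.fst.snd * (num w p.snd + 1)) (mul_pos (Num.add_one_pos (num w p.snd))
      (Num.add_one_pos (num w p.snd)))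
  convert this using 1; ring

theorem exists_ratGt (w : World B) (p : El B ratTy) : ∃ q, w ⊩ ratLt p q := by
  refine ⟨pair (pair (p.fst.fst + p.snd + 1) p.fst.snd) p.snd, ?_⟩
  rw [forces_ratLt]
  simp only [fst_pair, snd_pair, map_add, map_one]
  have := lt_add_of_pos_right (num w p.fst.fst * (num w p.snd + 1) +
    num w p.fst.snd * (num w p.snd + 1)) (mul_pos (Num.add_one_pos (num w p.snd))
      (Num.add_one_pos (num w p.snd)))
  convert this using 1; ring

theorem ratZero_lt_iff : (w ⊩ ratLt ratZero p) ↔ num w p.fst.snd < num w p.fst.fst := by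
  rw [forces_ratLt]; simp [El.ratZero]

theorem ratZero_lt_ratInv (w : World B) (n : El B .nat) : w ⊩ ratLt ratZero (ratInv n) := by
  rw [ratZero_lt_iff]; simp [El.ratInv]

theorem ratZero_lt_ratOne (w : World B) : w ⊩ ratLt ratZero ratOne := by
  rw [ratZero_lt_iff]; simp [El.ratOne]

theorem exists_ratInv_lt (h : w ⊩ ratLt ratZero p) : ∃ n, w ⊩ ratLt (ratInv n) p := by
  rw [ratZero_lt_iff, Num.lt_def] at h
  obtain ⟨z, hz⟩ := h
  -- The numerator of `p` is at least 1, so `p` is at least 1/(`p.snd` + 1), and the next unit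
  -- fraction is smaller.
  refine ⟨p.snd + 1, ?_⟩
  rw [forces_ratLt]
  simp only [El.ratInv, fst_pair, snd_pair, map_add, map_one, ← hz, map_zero, Num.lt_def]
  exact ⟨z * (num w p.snd + 1) + z, by ring⟩

theorem ratInv_le_ratInv {m : El B .nat} (h : num w m ≤ num w n) :
    ¬ (w ⊩ ratLt (ratInv m) (ratInv n)) := by
  rw [forces_ratLt]
  simpa [El.ratInv] using h

theorem ratDiv_lt_ratDiv (h : w ⊩ ratLt p q) : w ⊩ ratLt (ratDiv p n) (ratDiv q n) := by
  rw [forces_ratLt] at *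
  simp only [El.ratDiv, fst_pair, snd_pair, map_add, map_mul]
  have := mul_lt_mul_of_pos_right h (Num.add_one_pos (num w n))
  convert this using 1 <;> ring

theorem ratDiv_ratOne (n : El B .nat) : ratDiv ratOne n = ratInv n := by
  simp [El.ratDiv, El.ratOne, El.ratInv]

theorem ratZero_lt_ratDiv_iff : (w ⊩ ratLt ratZero (ratDiv p n)) ↔ (w ⊩ ratLt ratZero p) := by
  rw [ratZero_lt_iff, ratZero_lt_iff]; simp [El.ratDiv]

theorem ratDiv_lt_ratZero_iff : (w ⊩ ratLt (ratDiv p n) ratZero) ↔ (w ⊩ ratLt p ratZero) := by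
  rw [forces_ratLt, forces_ratLt]; simp [El.ratDiv, El.ratZero]

theorem lt_ratAdd_left (h : w ⊩ ratLt ratZero q) : w ⊩ ratLt p (ratAdd p q) := by
  rw [ratZero_lt_iff, Num.lt_def] at h
  obtain ⟨z, hz⟩ := h
  rw [forces_ratLt, Num.lt_def]
  simp only [El.ratAdd, fst_pair, snd_pair, map_add, map_mul, map_one, ← hz]
  generalize num w p.snd = c
  generalize num w q.snd = c'
  exact ⟨z * (c + 1) * (c + 1) + (c * c + c + c), by ring⟩

theorem lt_ratAdd_right (h : w ⊩ ratLt ratZero p) : w ⊩ ratLt q (ratAdd p q) := by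
  have e : ratAdd p q = ratAdd q p :=
    congrArg₂ pair (congrArg₂ pair (by ring) (by ring)) (by ring)
  rw [e]; exact lt_ratAdd_left h

end

end El

end BISH

namespace BISH

open El

variable {B : Ctx}

/-! ### Real numbers -/

namespace El

/-- `q < x` for a rational `q` and a real `x`. -/
noncomputable def lo (x : El B realTy) (q : El B ratTy) : Om B := mem q x.fst

/-- `x < q` for a rational `q` and a real `x`. -/
noncomputable def hi (x : El B realTy) (q : El B ratTy) : Om B := mem q x.snd

/-- `x` is a Dedekind cut. -/
noncomputable def isReal (x : El B realTy) : Om B :=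
  (exi fun q => lo x q) ⊓ ((exi fun q => hi x q) ⊓
  ((fal fun q => (lo x q ⇨ exi fun r => ratLt q r ⊓ lo x r) ⊓
    ((exi fun r => ratLt q r ⊓ lo x r) ⇨ lo x q)) ⊓
  ((fal fun q => (hi x q ⇨ exi fun r => ratLt r q ⊓ hi x r) ⊓
    ((exi fun r => ratLt r q ⊓ hi x r) ⇨ hi x q)) ⊓
  ((fal fun q => (lo x q ⊓ hi x q)ᶜ) ⊓
  (fal fun q => fal fun r => ratLt q r ⇨ (lo x q ⊔ hi x r))))))

/-- The set of real numbers. -/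
noncomputable def reals : El B (.pow realTy) := compr fun x => isReal x

/-- `x < y`. -/
noncomputable def realLt (x y : El B realTy) : Om B := exi fun q => hi x q ⊓ lo y q

/-- `x ≤ y`. -/
noncomputable def realLe (x y : El B realTy) : Om B := (realLt y x)ᶜ

/-- `x ≠ y`. -/
noncomputable def realNe (x y : El B realTy) : Om B := realLt x y ⊔ realLt y x

/-- A rational number as a real number. -/
noncomputable def ofRat (q : El B ratTy) : El B realTy :=
  pair (compr fun p => ratLt p q) (compr fun p => ratLt q p)

/-- `x + y`. -/
noncomputable def realAdd (x y : El B realTy) : El B realTy :=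
  pair (compr fun q => exi fun r => lo x r ⊓ exi fun s => lo y s ⊓ ratLt q (ratAdd r s))
    (compr fun q => exi fun r => hi x r ⊓ exi fun s => hi y s ⊓ ratLt (ratAdd r s) q)

/-- The closed unit interval. -/
noncomputable def unitInterval : El B (.pow realTy) :=
  compr fun x => isReal x ⊓ (realLe (ofRat ratZero) x ⊓ realLe x (ofRat ratOne))

end El

instance Dfn.lo {σ : Ty} (f : El B σ → El B realTy) (g : El B σ → El B ratTy) [Dfn f] [Dfn g] :
    Dfn fun a => El.lo (f a) (g a) := by
  unfold El.lo; infer_instance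
instance Dfn.lo_left (c : El B realTy) : Dfn (El.lo c) := Dfn.lo (fun _ => c) fun a => a
instance Dfn.hi {σ : Ty} (f : El B σ → El B realTy) (g : El B σ → El B ratTy) [Dfn f] [Dfn g] :
    Dfn fun a => El.hi (f a) (g a) := by
  unfold El.hi; infer_instance
instance Dfn.hi_left (c : El B realTy) : Dfn (El.hi c) := Dfn.hi (fun _ => c) fun a => a
set_option synthInstance.maxSize 1000 in
instance Dfn.isReal_self : Dfn (El.isReal : El B realTy → _) := by
  unfold El.isReal; infer_instance
instance Dfn.realLt {σ : Ty} (f g : El B σ → El B realTy) [Dfn f] [Dfn g] :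
    Dfn fun a => El.realLt (f a) (g a) := by
  have := Dfn.comp f (El.fst : El B (.prod σ ratTy) → _)
  have := Dfn.comp g (El.fst : El B (.prod σ ratTy) → _)
  unfold El.realLt; infer_instance
instance Dfn.realLt_left (c : El B realTy) : Dfn (El.realLt c) := Dfn.realLt (fun _ => c) fun a => a
instance Dfn.realLe {σ : Ty} (f g : El B σ → El B realTy) [Dfn f] [Dfn g] :
    Dfn fun a => El.realLe (f a) (g a) := by
  unfold El.realLe; infer_instance
instance Dfn.realLe_left (c : El B realTy) : Dfn (El.realLe c) := Dfn.realLe (fun _ => c) fun a => a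
instance Dfn.realNe {σ : Ty} (f g : El B σ → El B realTy) [Dfn f] [Dfn g] :
    Dfn fun a => El.realNe (f a) (g a) := by
  unfold El.realNe; infer_instance
instance Dfn.ofRat_self : Dfn (El.ofRat : El B ratTy → _) := by
  unfold El.ofRat; infer_instance
instance Dfn.ofRat {σ : Ty} (f : El B σ → El B ratTy) [Dfn f] : Dfn fun a => El.ofRat (f a) :=
  Dfn.comp _ f

section
variable {Γ : Ctx} (ρ : Env B Γ)

theorem ev_isReal (x : Tm Γ realTy) : ev (BISH.IsReal x) ρ = El.isReal (ev x ρ) := by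
  simp [BISH.IsReal, ev_ex, ev_all, compl_def, ev_ratLt, El.isReal, El.lo, El.hi]

theorem ev_reals : ev BISH.reals ρ = El.reals := by
  simp [BISH.reals, ev_compr, ev_isReal, El.reals]

theorem ev_realLt (x y : Tm Γ realTy) :
    ev (BISH.realLt x y) ρ = El.realLt (ev x ρ) (ev y ρ) := by
  simp [BISH.realLt, ev_ex, El.realLt, El.lo, El.hi]

theorem ev_realLe (x y : Tm Γ realTy) :
    ev (BISH.realLe x y) ρ = El.realLe (ev x ρ) (ev y ρ) := by
  simp only [BISH.realLe, ev_neg, El.realLe, ev_realLt]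

theorem ev_realNe (x y : Tm Γ realTy) :
    ev (BISH.realNe x y) ρ = El.realNe (ev x ρ) (ev y ρ) := by
  simp [BISH.realNe, El.realNe, ev_realLt]

theorem ev_ofRat (q : Tm Γ ratTy) : ev (BISH.ofRat q) ρ = El.ofRat (ev q ρ) := by
  simp [BISH.ofRat, El.ofRat, ev_compr, ev_ratLt]

theorem ev_realAdd (x y : Tm Γ realTy) :
    ev (BISH.realAdd x y) ρ = El.realAdd (ev x ρ) (ev y ρ) := by
  simp [BISH.realAdd, El.realAdd, ev_compr, ev_ex, ev_ratLt, ev_ratAdd, El.lo, El.hi]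

theorem ev_unitInterval : ev BISH.unitInterval ρ = El.unitInterval := by
  simp [BISH.unitInterval, El.unitInterval, ev_compr, ev_isReal, ev_realLe, ev_ofRat, ev_ratZero,
    ev_ratOne]

end

namespace El

/-- `x` is a Dedekind cut in the world `w`. -/
structure IsRealAt (w : World B) (x : El B realTy) : Prop where
  exists_lo : ∃ q, w ⊩ lo x q
  exists_hi : ∃ q, w ⊩ hi x q
  lo_of_lt : ∀ {q r}, (w ⊩ ratLt q r) → (w ⊩ lo x r) → (w ⊩ lo x q)
  exists_gt : ∀ {q}, (w ⊩ lo x q) → ∃ r, (w ⊩ ratLt q r) ∧ (w ⊩ lo x r)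
  hi_of_lt : ∀ {q r}, (w ⊩ ratLt r q) → (w ⊩ hi x r) → (w ⊩ hi x q)
  exists_lt : ∀ {q}, (w ⊩ hi x q) → ∃ r, (w ⊩ ratLt r q) ∧ (w ⊩ hi x r)
  disjoint : ∀ {q}, (w ⊩ lo x q) → (w ⊩ hi x q) → False
  located : ∀ {q r}, (w ⊩ ratLt q r) → (w ⊩ lo x q) ∨ (w ⊩ hi x r)

section
variable {w : World B} {x y z : El B realTy} {p q r : El B ratTy}

theorem forces_isReal : (w ⊩ isReal x) ↔ ∀ᶠ v in near w, IsRealAt v x := by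
  simp only [isReal, forces_inf, forces_fal, forces_himp, forces_compl, near_and_near,
    near_forall_near, forces_exi, forces_sup]
  constructor
  · rintro ⟨⟨q, hq⟩, ⟨r, hr⟩, h⟩
    filter_upwards [hq.near, hr.near, h] with v hq hr ⟨h₁, h₂, h₃, h₄⟩
    exact ⟨⟨q, hq⟩, ⟨r, hr⟩, fun h h' => (h₁ _).2 ⟨_, h, h'⟩, fun h => (h₁ _).1 h,
      fun h h' => (h₂ _).2 ⟨_, h, h'⟩, fun h => (h₂ _).1 h, fun h h' => h₃ _ ⟨h, h'⟩,
      fun h => h₄ _ _ h⟩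
  · intro h
    have h' := near_self h
    refine ⟨h'.exists_lo, h'.exists_hi, ?_⟩
    filter_upwards [h] with v h
    exact ⟨fun q => ⟨h.exists_gt, fun ⟨r, hr⟩ => h.lo_of_lt hr.1 hr.2⟩,
      fun q => ⟨h.exists_lt, fun ⟨r, hr⟩ => h.hi_of_lt hr.1 hr.2⟩,
      fun q hq => h.disjoint hq.1 hq.2, fun q r => h.located⟩

theorem forces_mem_reals : (w ⊩ mem x reals) ↔ (w ⊩ isReal x) := by
  rw [reals, mem_compr]

theorem _root_.BISH.Forces.isRealAt (h : w ⊩ isReal x) : IsRealAt w x := near_self (forces_isReal.1 h)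

theorem forces_realLt : (w ⊩ realLt x y) ↔ ∃ q, (w ⊩ hi x q) ∧ (w ⊩ lo y q) := by
  simp only [realLt, forces_exi, forces_inf]

theorem forces_realLe : (w ⊩ realLe x y) ↔ ∀ᶠ v in near w, ¬ (v ⊩ realLt y x) := by
  rw [realLe, forces_compl]

theorem forces_realNe : (w ⊩ realNe x y) ↔ (w ⊩ realLt x y) ∨ (w ⊩ realLt y x) := by
  simp only [realNe, forces_sup]

@[simp] theorem lo_pair {L U : El B (.pow ratTy)} : lo (pair L U) q = mem q L := by
  rw [lo, fst_pair]

@[simp] theorem hi_pair {L U : El B (.pow ratTy)} : hi (pair L U) q = mem q U := by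
  rw [hi, snd_pair]

@[simp] theorem lo_ofRat : lo (ofRat p) q = ratLt q p := by
  rw [ofRat, lo_pair, mem_compr]

@[simp] theorem hi_ofRat : hi (ofRat p) q = ratLt p q := by
  rw [ofRat, hi_pair, mem_compr]

theorem isReal_ofRat (w : World B) (p : El B ratTy) : w ⊩ isReal (ofRat p) := by
  refine forces_isReal.2 (near_of_forall fun v => ?_)
  constructor <;> simp only [lo_ofRat, hi_ofRat]
  · exact exists_ratLt v p
  · exact exists_ratGt v p
  · exact ratLt_trans
  · exact exists_ratLt_ratLt
  · exact fun h h' => ratLt_trans h' h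
  · exact fun h => (exists_ratLt_ratLt h).imp fun _ h => h.symm
  · exact ratLt_asymm
  · exact fun h => ratLt_or_ratLt h p

theorem realLt_ofRat_left (hx : IsRealAt w x) : (w ⊩ realLt (ofRat q) x) ↔ (w ⊩ lo x q) := by
  rw [forces_realLt]
  simp only [hi_ofRat]
  exact ⟨fun ⟨r, h, h'⟩ => hx.lo_of_lt h h', hx.exists_gt⟩

theorem realLt_ofRat_right (hx : IsRealAt w x) : (w ⊩ realLt x (ofRat q)) ↔ (w ⊩ hi x q) := by
  rw [forces_realLt]
  simp only [lo_ofRat]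
  exact ⟨fun ⟨r, h, h'⟩ => hx.hi_of_lt h' h, fun h => (hx.exists_lt h).imp fun _ h => h.symm⟩

theorem not_realLt_self (hx : IsRealAt w x) : ¬ (w ⊩ realLt x x) := by
  rw [forces_realLt]
  rintro ⟨q, h, h'⟩
  exact hx.disjoint h' h

theorem realNe_irrefl (hx : IsRealAt w x) : ¬ (w ⊩ realNe x x) := by
  rw [forces_realNe, or_self]
  exact not_realLt_self hx

theorem realLt_or_realLt (hy : IsRealAt w y) (hz : IsRealAt w z) (h : w ⊩ realLt x y) :
    (w ⊩ realLt x z) ∨ (w ⊩ realLt z y) := by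
  simp only [forces_realLt] at *
  obtain ⟨q, hq, hq'⟩ := h
  obtain ⟨r, hr, hr'⟩ := hy.exists_gt hq'
  exact (hz.located hr).imp (fun h => ⟨q, hq, h⟩) fun h => ⟨r, h, hr'⟩

/-- Cotransitivity of the inequality, which comes from the locatedness of `z`. -/
theorem realNe_or_realNe (hx : IsRealAt w x) (hy : IsRealAt w y) (hz : IsRealAt w z)
    (h : w ⊩ realNe x y) : (w ⊩ realNe z x) ∨ (w ⊩ realNe z y) := by
  simp only [forces_realNe] at *
  obtain h | h := h
  · exact (realLt_or_realLt hy hz h).imp Or.inr Or.inl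
  · exact (realLt_or_realLt hx hz h).symm.imp Or.inl Or.inr

theorem eq_of_near_lo_hi_iff
    (h : ∀ᶠ v in near w, ∀ q, ((v ⊩ lo x q) ↔ (v ⊩ lo y q)) ∧ ((v ⊩ hi x q) ↔ (v ⊩ hi y q))) :
    w ⊩ El.eq x y := by
  have h₁ : w ⊩ El.eq x.fst y.fst := forces_eq_of_near_mem_iff (h.mono fun v h q => (h q).1)
  have h₂ : w ⊩ El.eq x.snd y.snd := forces_eq_of_near_mem_iff (h.mono fun v h q => (h q).2)
  have := (h₁.congr fun a => pair a x.snd).trans (h₂.congr fun a => pair y.fst a)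
  rwa [pair_fst_snd, pair_fst_snd] at this

theorem eq_of_realLe_of_realLe (hx : w ⊩ isReal x) (hy : w ⊩ isReal y)
    (h : ∀ᶠ v in near w, ¬ (v ⊩ realLt x y)) (h' : ∀ᶠ v in near w, ¬ (v ⊩ realLt y x)) :
    w ⊩ El.eq x y := by
  refine eq_of_near_lo_hi_iff ?_
  filter_upwards [h, h', forces_isReal.1 hx, forces_isReal.1 hy] with v h h' hx hy q
  have key : ∀ {x y}, IsRealAt v x → IsRealAt v y → ¬ (v ⊩ realLt y x) → (v ⊩ lo x q) →
      (v ⊩ lo y q) := by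
    intro x y hx hy h hq
    obtain ⟨r, hr, hr'⟩ := hx.exists_gt hq
    refine (hy.located hr).resolve_right fun hy => h ?_
    rw [forces_realLt]
    exact ⟨r, hy, hr'⟩
  have key' : ∀ {x y}, IsRealAt v x → IsRealAt v y → ¬ (v ⊩ realLt x y) → (v ⊩ hi x q) →
      (v ⊩ hi y q) := by
    intro x y hx hy h hq
    obtain ⟨r, hr, hr'⟩ := hx.exists_lt hq
    refine (hy.located hr).resolve_left fun hy => h ?_
    rw [forces_realLt]
    exact ⟨r, hr', hy⟩
  exact ⟨⟨key hx hy h', key hy hx h⟩, key' hx hy h, key' hy hx h'⟩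

end

end El

end BISH

namespace BISH

open El

variable {B : Ctx}

/-! ### Sets and functions -/

namespace El

/-- The set of all elements of type `σ`. -/
noncomputable def univ (σ : Ty) : El B (.pow σ) := compr fun x => El.eq x x

/-- Cartesian product. -/
noncomputable def times {σ τ : Ty} (A : El B (.pow σ)) (A' : El B (.pow τ)) :
    El B (.pow (.prod σ τ)) := compr fun p => mem p.fst A ⊓ mem p.snd A'

/-- Inclusion. -/
noncomputable def subset {σ : Ty} (A A' : El B (.pow σ)) : Om B := fal fun x => mem x A ⇨ mem x A'

/-- `F` is a function from `A` to `A'`. -/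
noncomputable def isFun {σ τ : Ty} (A : El B (.pow σ)) (A' : El B (.pow τ))
    (F : El B (.pow (.prod σ τ))) : Om B :=
  subset F (times A A') ⊓ ((fal fun x => mem x A ⇨ exi fun y => mem (pair x y) F) ⊓
    fal fun x => fal fun y => fal fun z =>
      mem (pair x y) F ⇨ mem (pair x z) F ⇨ El.eq y z)

end El

instance Dfn.isFun_left {σ τ : Ty} [Inh B σ] [Inh B τ] (A : El B (.pow σ)) (A' : El B (.pow τ)) :
    Dfn (El.isFun A A') := by
  unfold El.isFun El.subset El.times; infer_instance

section
variable {Γ : Ctx} {σ τ : Ty} [Inh B σ] [Inh B τ] (ρ : Env B Γ)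

theorem ev_univ : ev (BISH.univ σ) ρ = El.univ σ := by
  simp [BISH.univ, El.univ, ev_compr]

theorem ev_times (A : Tm Γ (.pow σ)) (A' : Tm Γ (.pow τ)) :
    ev (BISH.times A A') ρ = El.times (ev A ρ) (ev A' ρ) := by
  simp [BISH.times, El.times, ev_compr]

theorem ev_subset (A A' : Tm Γ (.pow σ)) :
    ev (BISH.subset A A') ρ = El.subset (ev A ρ) (ev A' ρ) := by
  simp [BISH.subset, El.subset, ev_all]

theorem ev_isFun (A : Tm Γ (.pow σ)) (A' : Tm Γ (.pow τ)) (F : Tm Γ (.pow (.prod σ τ))) :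
    ev (BISH.IsFun A A' F) ρ = El.isFun (ev A ρ) (ev A' ρ) (ev F ρ) := by
  simp [BISH.IsFun, El.isFun, ev_subset, ev_times, ev_all, ev_ex]

end

namespace El

/-- `F` is a function from `A` to `A'` in the world `w`. -/
structure IsFunAt (w : World B) {σ τ : Ty} (A : El B (.pow σ)) (A' : El B (.pow τ))
    (F : El B (.pow (.prod σ τ))) : Prop where
  dom : ∀ {x y}, (w ⊩ mem (pair x y) F) → (w ⊩ mem x A)
  cod : ∀ {x y}, (w ⊩ mem (pair x y) F) → (w ⊩ mem y A')
  total : ∀ {x}, (w ⊩ mem x A) → ∃ y, w ⊩ mem (pair x y) F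
  unique : ∀ {x y z}, (w ⊩ mem (pair x y) F) → (w ⊩ mem (pair x z) F) → (w ⊩ El.eq y z)

@[simp] theorem forces_mem_univ {w : World B} {σ : Ty} (x : El B σ) : w ⊩ mem x (univ σ) := by
  rw [univ, mem_compr]; exact forces_eq_refl _ _

section
variable {w : World B} {σ τ : Ty} [Inh B σ] [Inh B τ]

theorem forces_subset {A A' : El B (.pow σ)} :
    (w ⊩ subset A A') ↔ ∀ᶠ v in near w, ∀ x, (v ⊩ mem x A) → (v ⊩ mem x A') := by
  simp only [subset, forces_fal, forces_himp, near_forall_near]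

theorem forces_isFun {A : El B (.pow σ)} {A' : El B (.pow τ)} {F : El B (.pow (.prod σ τ))} :
    (w ⊩ isFun A A' F) ↔ ∀ᶠ v in near w, IsFunAt v A A' F := by
  simp only [isFun, forces_inf, forces_subset, times, mem_compr, forces_fal, forces_himp,
    near_forall_near, near_imp_near, forces_exi, near_and_near]
  constructor
  · intro h
    filter_upwards [h] with v ⟨h₁, h₂, h₃⟩
    refine ⟨fun h => ?_, fun h => ?_, h₂ _, h₃ _ _ _⟩
    · have := (h₁ _ h).1
      rwa [fst_pair] at this
    · have := (h₁ _ h).2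
      rwa [snd_pair] at this
  · intro h
    filter_upwards [h] with v h
    refine ⟨fun p hp => ?_, fun x => h.total, fun x y z => h.unique⟩
    rw [← pair_fst_snd p] at hp
    exact ⟨h.dom hp, h.cod hp⟩

theorem _root_.BISH.Forces.isFunAt {A : El B (.pow σ)} {A' : El B (.pow τ)}
    {F : El B (.pow (.prod σ τ))} (h : w ⊩ isFun A A' F) : IsFunAt w A A' F :=
  near_self (forces_isFun.1 h)

/-! ### Countable choice -/

/-- The rule of countable choice is applied to the set of all pairs that satisfy `f`, which is
available because `f` is definable. -/
theorem forces_choice {f : El B .nat → El B σ → Om B}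
    [hf : Dfn fun p : El B (.prod .nat σ) => f p.fst p.snd]
    (h : ∀ᶠ v in near w, ∀ n, ∃ b, v ⊩ f n b) :
    ∃ F, (w ⊩ isFun (univ .nat) (univ σ) F) ∧
      ∀ᶠ v in near w, ∀ n b, (v ⊩ mem (pair n b) F) → (v ⊩ f n b) := by
  let S : Tm [.pow (.prod .nat σ)] (.pow (.prod .nat σ)) := .var .zero
  let φ : Fm [.pow (.prod .nat σ)] :=
    All .nat fun n => Ex σ fun b => .pair n.w b ∊ S.w.w
  let ψ : Fm [.pow (.prod .nat σ)] := Ex (.pow (.prod .nat σ)) fun F =>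
    BISH.IsFun (BISH.univ .nat) (BISH.univ σ) F ⋏ BISH.subset F S.w
  have key : ∀ A : El B (.pow (.prod .nat σ)),
      Entails (ev φ (Env.nil.cons A)) (ev ψ (Env.nil.cons A)) := by
    intro A
    obtain ⟨⟨k, t⟩, rfl⟩ := Quotient.exists_rep A
    have hr := nil_rep.cons t
    change Entails (ev _ (Env.nil.cons (mk t))) (ev _ (Env.nil.cons (mk t)))
    rw [ev_eq_mk _ hr, ev_eq_mk _ hr, entails_mk]
    exact .countableChoice (.hyp rfl)
  let A : El B (.pow (.prod .nat σ)) := compr fun p => f p.fst p.snd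
  have hA : ∀ n b, mem (pair n b) A = f n b := fun n b => by
    simp only [A, mem_compr, fst_pair, snd_pair]
  have := w.of_entails (key A) (a := ev φ (Env.nil.cons A)) (by
    change w ⊩ _
    simp only [φ, S, ev_all, ev_ex, ev_mem, ev_pair, ev_w, ev_var_zero, forces_fal, forces_exi]
    filter_upwards [h] with v h n
    obtain ⟨b, hb⟩ := h n
    exact ⟨b, by rwa [hA]⟩)
  change w ⊩ _ at this
  simp only [ψ, S, ev_ex, ev_and, ev_isFun, ev_univ, ev_subset, ev_var_zero, ev_w] at this
  have hd : Dfn fun F => isFun (univ .nat) (univ σ) F ⊓ subset F A := by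
    unfold subset; infer_instance
  rw [forces_exi] at this
  obtain ⟨F, hF⟩ := this
  rw [forces_inf, forces_subset] at hF
  refine ⟨F, hF.1, hF.2.mono fun v hv n b hb => ?_⟩
  rw [← hA]
  exact hv _ hb

/-- Classical trichotomy in the world suffices: a strict inequality is itself a truth value, so it
persists nearby and refutes equality there. -/
theorem eq_or_compl (w : World B) (a b : El B .nat) : (w ⊩ El.eq a b) ∨ (w ⊩ (El.eq a b)ᶜ) := by
  obtain h | h | h := lt_trichotomy (num w a) (num w b)
  · refine Or.inr (forces_compl.2 ?_)
    filter_upwards [(forces_natLt.2 h).near] with v hv h'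
    rw [forces_natLt, num_eq_num.2 h'] at hv
    exact lt_irrefl _ hv
  · exact Or.inl (num_eq_num.1 h)
  · refine Or.inr (forces_compl.2 ?_)
    filter_upwards [(forces_natLt.2 h).near] with v hv h'
    rw [forces_natLt, num_eq_num.2 h'] at hv
    exact lt_irrefl _ hv

/-- A choice between two alternatives for each natural number. -/
theorem exists_decision {f g : El B .nat → Om B} [Dfn f] [Dfn g]
    (h : ∀ᶠ v in near w, ∀ n, (v ⊩ f n) ∨ (v ⊩ g n)) :
    ∃ A : El B (.pow .nat), ∀ᶠ v in near w, ∀ n,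
      ((v ⊩ mem n A) ∧ (v ⊩ f n)) ∨ ((v ⊩ (mem n A)ᶜ) ∧ (v ⊩ g n)) := by
  have h₁ : Dfn fun p : El B (.prod .nat .nat) => f p.fst := Dfn.comp f _
  have h₂ : Dfn fun p : El B (.prod .nat .nat) => g p.fst := Dfn.comp g _
  obtain ⟨F, hF, hFf⟩ := forces_choice
    -- The chosen number records the alternative: 1 stands for `f n`, anything else for `g n`. The
    -- set of all `n` with value 1 is then detachable.
    (f := fun (n b : El B .nat) => (El.eq b 1 ⊓ f n) ⊔ ((El.eq b 1)ᶜ ⊓ g n)) (w := w) (by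
      filter_upwards [h] with v hv n
      simp only [forces_sup, forces_inf]
      obtain h | h := hv n
      · exact ⟨1, Or.inl ⟨forces_eq_refl _ _, h⟩⟩
      · refine ⟨0, Or.inr ⟨forces_compl.2 (near_of_forall fun u hu => ?_), h⟩⟩
        have := hu.symm
        rw [← zero_add (1 : El B .nat)] at this
        exact forces_add_one_ne_zero this)
  refine ⟨compr fun n => mem (pair n 1) F, ?_⟩
  filter_upwards [hFf, near_near (forces_isFun.1 hF)] with v hv hF n
  obtain ⟨b, hb⟩ := (near_self hF).total (forces_mem_univ n)
  have := hv n b hb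
  simp only [forces_sup, forces_inf, mem_compr] at this ⊢
  refine this.imp (fun h => ⟨?_, h.2⟩) fun h => ⟨?_, h.2⟩
  · exact h.1.subst (fun b => mem (pair n b) F) hb
  · rw [forces_compl]
    filter_upwards [h.1.near, hb.near, hF] with u h hb hF h'
    exact h.false (hF.unique hb h')

end

/-! ### Detachable sets of natural numbers with at most one element -/

/-- In the world `w`, the set `A` is detachable and has at most one element. -/
structure IsUniqAt (w : World B) (A : El B (.pow .nat)) : Prop where
  dec : ∀ n, (w ⊩ mem n A) ∨ (w ⊩ (mem n A)ᶜ)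
  uniq : ∀ {m n}, (w ⊩ mem m A) → (w ⊩ mem n A) → (w ⊩ El.eq m n)

/-- No element of `A` is smaller than `n`. -/
noncomputable def noneBelow (A : El B (.pow .nat)) (n : El B .nat) : Om B :=
  fal fun k => natLt k n ⇨ (mem k A)ᶜ

/-- The set `A` is inhabited. -/
noncomputable def inhabited (A : El B (.pow .nat)) : Om B := exi fun n => mem n A

end El

instance Dfn.noneBelow {σ : Ty} (f : El B σ → El B (.pow .nat)) (g : El B σ → El B .nat) [Dfn f]
    [Dfn g] : Dfn fun a => El.noneBelow (f a) (g a) := by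
  have := Dfn.comp f (El.fst : El B (.prod σ .nat) → _)
  have := Dfn.comp g (El.fst : El B (.prod σ .nat) → _)
  unfold El.noneBelow; infer_instance
instance Dfn.noneBelow_left (A : El B (.pow .nat)) : Dfn (El.noneBelow A) :=
  Dfn.noneBelow (fun _ => A) fun a => a

namespace El

section
variable {w : World B} {A : El B (.pow .nat)} {n : El B .nat}

theorem forces_noneBelow :
    (w ⊩ noneBelow A n) ↔ ∀ᶠ v in near w, ∀ k, num v k < num v n → ¬ (v ⊩ mem k A) := by
  simp only [noneBelow, forces_fal, forces_himp, forces_compl, near_imp_near, near_forall_near]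
  simp only [forces_natLt]

theorem forces_inhabited : (w ⊩ inhabited A) ↔ ∃ n, w ⊩ mem n A := by
  rw [inhabited, forces_exi]

/-- The set of least elements of `A`. -/
noncomputable def least (A : El B (.pow .nat)) : El B (.pow .nat) :=
  compr fun n => mem n A ⊓ noneBelow A n

theorem forces_mem_least : (w ⊩ mem n (least A)) ↔ (w ⊩ mem n A) ∧ (w ⊩ noneBelow A n) := by
  rw [least, mem_compr, forces_inf]

/-- Bounded search, by induction on the bound. -/
theorem noneBelow_or_exists_least
    (h : ∀ᶠ v in near w, ∀ n, (v ⊩ mem n A) ∨ (v ⊩ (mem n A)ᶜ)) (n : El B .nat) :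
    (w ⊩ noneBelow A n) ∨ ∃ m, (w ⊩ mem m (least A)) ∧ num w m < num w n := by
  have := forces_induction (w := w)
    (f := fun n => noneBelow A n ⊔ exi fun m => mem m (least A) ⊓ natLt m n) ?_ ?_ n
  · simpa only [forces_sup, forces_exi, forces_inf, forces_natLt] using this
  · simp only [forces_sup, forces_noneBelow]
    exact Or.inl (near_of_forall fun v k hk => by
      rw [map_zero] at hk; exact (hk.not_ge (Num.zero_le _)).elim)
  · filter_upwards [h] with v h n hn
    simp only [forces_sup, forces_exi, forces_inf, forces_natLt] at hn ⊢
    obtain hn | ⟨m, hm, hmn⟩ := hn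
    · obtain hA | hA := h n
      · exact Or.inr ⟨n, forces_mem_least.2 ⟨hA, hn⟩, by simp⟩
      · left
        rw [forces_noneBelow] at hn ⊢
        filter_upwards [hn, hA.near] with u hn hA k hk hkA
        rw [map_add, map_one, Num.lt_add_one_iff] at hk
        obtain hk | hk := hk.lt_or_eq
        · exact hn k hk hkA
        · exact hA.false (forces_mem_of_eq (num_eq_num.1 hk) hkA)
    · exact Or.inr ⟨m, hm, by rw [map_add, map_one]; exact hmn.trans (by simp)⟩

theorem isUniqAt_least (h : ∀ᶠ v in near w, ∀ n, (v ⊩ mem n A) ∨ (v ⊩ (mem n A)ᶜ)) :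
    IsUniqAt w (least A) := by
  constructor
  · intro n
    obtain hn | ⟨m, hm, hmn⟩ := noneBelow_or_exists_least h n
    · obtain hA | hA := near_self h n
      · exact Or.inl (forces_mem_least.2 ⟨hA, hn⟩)
      · right
        rw [forces_compl]
        filter_upwards [hA.near] with v hA h
        exact hA.false (forces_mem_least.1 h).1
    · right
      rw [forces_compl]
      filter_upwards [hm.near, (forces_natLt.2 hmn).near] with v hm hmn h
      exact near_self (forces_noneBelow.1 (forces_mem_least.1 h).2) m (forces_natLt.1 hmn)
        (forces_mem_least.1 hm).1
  · intro m n hm hn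
    rw [forces_mem_least, forces_noneBelow] at hm hn
    obtain h | h | h := lt_trichotomy (num w m) (num w n)
    · exact (near_self hn.2 m h hm.1).elim
    · exact num_eq_num.1 h
    · exact (near_self hm.2 n h hn.1).elim

/-- Together with `isUniqAt_least` this replaces a detachable set by one with at most one element
without changing whether it is inhabited. -/
theorem inhabited_least_iff (h : ∀ᶠ v in near w, ∀ n, (v ⊩ mem n A) ∨ (v ⊩ (mem n A)ᶜ)) :
    (∃ n, w ⊩ mem n (least A)) ↔ ∃ n, w ⊩ mem n A := by
  constructor
  · rintro ⟨n, hn⟩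
    exact ⟨n, (forces_mem_least.1 hn).1⟩
  · rintro ⟨n, hn⟩
    obtain h | ⟨m, hm, -⟩ := noneBelow_or_exists_least h n
    · exact ⟨n, forces_mem_least.2 ⟨hn, h⟩⟩
    · exact ⟨m, hm⟩

end

end El

end BISH

namespace BISH

open El

variable {B : Ctx}

/-! ### Splitting -/

namespace El

/-- Whenever `φ` implies one of two incompatible propositions, one of them is not false. -/
noncomputable def split (φ : Om B) : Om B :=
  fal fun P : Om B => fal fun Q : Om B => (P ⊓ Q)ᶜ ⇨ (φ ⇨ P ⊔ Q) ⇨ Pᶜᶜ ⊔ Qᶜᶜ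

/-- `x` is pseudo-positive. -/
noncomputable def pseudoPositive (x : El B realTy) : Om B :=
  fal fun y => mem y reals ⇨ (realLt (ofRat ratZero) y)ᶜᶜ ⊔ (realLt y x)ᶜᶜ

section
variable {w : World B}

theorem forces_split {φ : Om B} : (w ⊩ split φ) ↔ ∀ᶠ v in near w, ∀ P Q,
    (v ⊩ (P ⊓ Q)ᶜ) → (v ⊩ φ ⇨ P ⊔ Q) → (v ⊩ Pᶜᶜ) ∨ (v ⊩ Qᶜᶜ) := by
  have key : ∀ {v : World B} {a b c d : Om B}, (v ⊩ a ⇨ b ⇨ c ⊔ d) ↔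
      ∀ᶠ u in near v, (u ⊩ a) → (u ⊩ b) → (u ⊩ c) ∨ (u ⊩ d) := by
    intro v a b c d
    simp only [forces_himp, near_imp_near, forces_sup]
  simp only [split, forces_fal, key, near_forall_near]

theorem forces_pseudoPositive {x : El B realTy} : (w ⊩ pseudoPositive x) ↔
    ∀ᶠ v in near w, ∀ y, (v ⊩ isReal y) →
      (v ⊩ (realLt (ofRat ratZero) y)ᶜᶜ) ∨ (v ⊩ (realLt y x)ᶜᶜ) := by
  simp only [pseudoPositive, forces_fal, forces_himp, near_forall_near, forces_sup,
    forces_mem_reals]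

theorem _root_.BISH.Forces.compl_compl_mono {a b : Om B} (h : w ⊩ aᶜᶜ)
    (hab : ∀ᶠ v in near w, (v ⊩ a) → (v ⊩ b)) : w ⊩ bᶜᶜ := by
  rw [forces_compl] at h ⊢
  filter_upwards [h, near_near hab] with v h hab hb
  refine h (forces_compl.2 ?_)
  filter_upwards [hb.near, hab] with u hb hab ha
  exact hb.false (hab ha)

theorem forces_compl_of_compl_compl {a b : Om B} (h : w ⊩ aᶜᶜ)
    (hab : ∀ᶠ v in near w, (v ⊩ a) → ¬ (v ⊩ b)) : w ⊩ bᶜ := by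
  rw [forces_compl] at h ⊢
  filter_upwards [h, near_near hab] with v h hab hb
  refine h (forces_compl.2 ?_)
  filter_upwards [hb.near, hab] with u hb hab ha
  exact hab ha hb

theorem split_congr {φ ψ : Om B} (h : ∀ᶠ v in near w, (v ⊩ φ) ↔ (v ⊩ ψ)) (hφ : w ⊩ split φ) :
    w ⊩ split ψ := by
  have : Dfn (split : Om B → Om B) := by unfold split; infer_instance
  exact (forces_eq_of_forces_iff h).subst split hφ

end

end El

theorem ev_pseudoPositive {Γ : Ctx} (ρ : Env B Γ) (x : Tm Γ realTy) :
    ev (PseudoPositive x) ρ = El.pseudoPositive (ev x ρ) := by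
  simp [PseudoPositive, El.pseudoPositive, ev_all, ev_reals, ev_realLt, ev_ofRat, ev_ratZero,
    compl_def]

theorem forces_wmp {w : World B} : (w ⊩ ev WMP Env.nil) ↔ ∀ᶠ v in near w, ∀ x,
    (v ⊩ isReal x) → (v ⊩ pseudoPositive x) → (v ⊩ El.realLt (El.ofRat El.ratZero) x) := by
  have : Dfn fun x : El B realTy => pseudoPositive x := by
    unfold pseudoPositive; infer_instance
  simp only [WMP, ev_all, ev_imp, ev_mem, ev_var_zero, ev_w, ev_reals, ev_pseudoPositive,
    ev_realLt, ev_ofRat, ev_ratZero, forces_fal, forces_himp, near_forall_near, near_imp_near,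
    forces_mem_reals]

/-! ### Weak Markov's principle as a statement on detachable sets with at most one element -/

namespace El

section
variable {w : World B} {A : El B (.pow .nat)}

/-- Pseudo-positivity is tested on the real `y` that is x under P and 0 under Q: then ¬¬(0 < y)
gives ¬¬P, and ¬¬(y < x) gives ¬¬Q. -/
theorem split_of_pseudoPositive {x : El B realTy} (hx : w ⊩ isReal x)
    (h : w ⊩ pseudoPositive x) : w ⊩ split (realLt (ofRat ratZero) x) := by
  rw [forces_pseudoPositive] at h
  -- Pseudo-positivity at y = 0 gives ¬¬(0 < x), so x is not negative.
  have h₀ : ∀ᶠ v in near w, ¬ (v ⊩ hi x ratZero) := by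
    obtain h | h := near_self h _ (isReal_ofRat w ratZero)
    · exact (h.false (forces_compl.2 (near_of_forall fun v =>
        not_realLt_self (isReal_ofRat v _).isRealAt))).elim
    · rw [← forces_compl]
      refine forces_compl_of_compl_compl h ?_
      filter_upwards [forces_isReal.1 hx] with v hx h
      exact hx.disjoint ((realLt_ofRat_left hx).1 h)
  rw [forces_split]
  filter_upwards [near_near (forces_isReal.1 hx), near_near h₀, h] with v hx h₀ h P Q hPQ hφ
  let y : El B realTy := pair (compr fun q => ratLt q ratZero ⊔ (lo x q ⊓ P))
    (compr fun q => hi x q ⊔ (ratLt ratZero q ⊓ Q))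
  have lo_y : ∀ {u : World B} {q}, (u ⊩ lo y q) ↔
      (u ⊩ ratLt q ratZero) ∨ (u ⊩ lo x q) ∧ (u ⊩ P) := by
    intro u q; simp only [y, lo_pair, mem_compr, forces_sup, forces_inf]
  have hi_y : ∀ {u : World B} {q}, (u ⊩ hi y q) ↔
      (u ⊩ hi x q) ∨ (u ⊩ ratLt ratZero q) ∧ (u ⊩ Q) := by
    intro u q; simp only [y, hi_pair, mem_compr, forces_sup, forces_inf]
  have hy : ∀ᶠ u in near v, IsRealAt u y := by
    rw [forces_compl] at hPQ
    rw [forces_himp] at hφ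
    filter_upwards [hx, h₀, hPQ, hφ] with u hx h₀ hPQ hφ
    constructor <;> simp only [lo_y, hi_y]
    · exact (exists_ratLt u ratZero).imp fun _ => Or.inl
    · exact hx.exists_hi.imp fun _ => Or.inl
    · exact fun h => Or.imp (ratLt_trans h) (And.imp_left (hx.lo_of_lt h))
    · rintro q (h | ⟨h, hP⟩)
      · exact (exists_ratLt_ratLt h).imp fun _ h => ⟨h.1, Or.inl h.2⟩
      · exact (hx.exists_gt h).imp fun _ h => ⟨h.1, Or.inr ⟨h.2, hP⟩⟩
    · exact fun h => Or.imp (hx.hi_of_lt h) (And.imp_left fun h' => ratLt_trans h' h)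
    · rintro q (h | ⟨h, hQ⟩)
      · exact (hx.exists_lt h).imp fun _ h => ⟨h.1, Or.inl h.2⟩
      · exact (exists_ratLt_ratLt h).imp fun _ h => ⟨h.2, Or.inr ⟨h.1, hQ⟩⟩
    · rintro q (h | ⟨h, hP⟩) (h' | ⟨h', hQ⟩)
      · exact h₀ (hx.hi_of_lt h h')
      · exact ratLt_asymm h h'
      · exact hx.disjoint h h'
      · exact hPQ (forces_inf.2 ⟨hP, hQ⟩)
    -- Locatedness of `y`: either q < 0, or 0 < r. In the second case x < r settles the matter; if q
    -- < x, a rational s between them shows q < 0 or 0 < s < x, and the latter makes P ∨ Q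
    -- available.
    · intro q r h
      obtain hq | hr := ratLt_or_ratLt h ratZero
      · exact Or.inl (Or.inl hq)
      obtain h' | h' := hx.located h
      · obtain ⟨s, hs, hs'⟩ := hx.exists_gt h'
        obtain hq | hs := ratLt_or_ratLt hs ratZero
        · exact Or.inl (Or.inl hq)
        · refine (forces_sup.1 (hφ ((realLt_ofRat_left hx).2 (hx.lo_of_lt hs hs')))).imp
            (fun hP => Or.inr ⟨h', hP⟩) fun hQ => Or.inr ⟨hr, hQ⟩
      · exact Or.inr (Or.inl h')
  refine (h y (forces_isReal.2 hy)).imp (fun h => h.compl_compl_mono ?_)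
    fun h => h.compl_compl_mono ?_
  · filter_upwards [hy] with u hy h
    rw [realLt_ofRat_left hy, lo_y] at h
    exact (h.resolve_left ratLt_irrefl).2
  · filter_upwards [hx] with u hx h
    obtain ⟨q, hq, hq'⟩ := forces_realLt.1 h
    rw [hi_y] at hq
    exact (hq.resolve_left (hx.disjoint hq')).2

/-- A real number is positive if and only if some detachable set of natural numbers with at most one
element is inhabited. -/
theorem exists_isUniqAt_iff {x : El B realTy} (hx : w ⊩ isReal x) :
    ∃ A : El B (.pow .nat), ∀ᶠ v in near w, IsUniqAt v A ∧
      ((v ⊩ realLt (ofRat ratZero) x) ↔ (v ⊩ inhabited A)) := by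
  rw [forces_isReal] at hx
  -- For each n choose between 0 < x and x < 1/(n+1). If x is positive, the second alternative fails
  -- for some n, so the first one has been chosen there.
  obtain ⟨A, hA⟩ := exists_decision (w := w) (f := fun _ => lo x ratZero)
    (g := fun n => hi x (ratInv n)) (by
      filter_upwards [hx] with v hx n
      exact hx.located (ratZero_lt_ratInv _ _))
  have hdec : ∀ᶠ v in near w, ∀ n, (v ⊩ mem n A) ∨ (v ⊩ (mem n A)ᶜ) :=
    hA.mono fun v h n => (h n).imp And.left And.left
  refine ⟨least A, ?_⟩
  filter_upwards [hx, near_near hdec, hA] with v hx hdec hA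
  refine ⟨isUniqAt_least hdec, ?_⟩
  rw [realLt_ofRat_left hx, forces_inhabited, inhabited_least_iff hdec]
  constructor
  · intro h
    obtain ⟨r, hr, hr'⟩ := hx.exists_gt h
    obtain ⟨n, hn⟩ := exists_ratInv_lt hr
    exact ⟨n, ((hA n).resolve_right fun h => hx.disjoint (hx.lo_of_lt hn hr') h.2).1⟩
  · rintro ⟨n, hn⟩
    exact ((hA n).resolve_right fun h => h.1.false hn).2

/-- The alternatives at the element of `A` may overlap, whereas splitting concerns incompatible
propositions. Countable choice first decides for each number which alternative to use, and the
resulting propositions are incompatible because `A` has at most one element. -/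
theorem split_or {f g : El B .nat → Om B} [Dfn f] [Dfn g]
    (hA : ∀ᶠ v in near w, IsUniqAt v A) (hs : w ⊩ split (inhabited A))
    (h : ∀ᶠ v in near w, ∀ n, (v ⊩ mem n A) → (v ⊩ f n) ∨ (v ⊩ g n)) :
    (w ⊩ (exi fun n => mem n A ⊓ f n)ᶜᶜ) ∨ (w ⊩ (exi fun n => mem n A ⊓ g n)ᶜᶜ) := by
  -- Non-members of `A` are put on the first side, so that there is a decision for every number.
  obtain ⟨C, hC⟩ := exists_decision (w := w) (f := fun n => f n ⊔ (mem n A)ᶜ) (g := g) (by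
    filter_upwards [h, hA] with v h hA n
    rw [forces_sup]
    obtain h' | h' := hA.dec n
    · exact (h n h').imp_left Or.inl
    · exact Or.inl (Or.inr h'))
  refine (near_self (forces_split.1 hs) (exi fun n => mem n A ⊓ mem n C)
    (exi fun n => mem n A ⊓ (mem n C)ᶜ) ?_ ?_).imp
      (fun h => h.compl_compl_mono ?_) fun h => h.compl_compl_mono ?_
  · rw [forces_compl]
    filter_upwards [hA] with v hA h
    simp only [forces_inf, forces_exi] at h
    obtain ⟨⟨m, hm, hmC⟩, n, hn, hnC⟩ := h
    exact hnC.false (forces_mem_of_eq (hA.uniq hm hn) hmC)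
  · rw [forces_himp]
    filter_upwards [hC] with v hC h
    obtain ⟨n, hn⟩ := forces_inhabited.1 h
    simp only [forces_sup, forces_exi, forces_inf]
    exact (hC n).imp (fun h => ⟨n, hn, h.1⟩) fun h => ⟨n, hn, h.1⟩
  · filter_upwards [hC] with v hC
    simp only [forces_exi, forces_inf]
    rintro ⟨n, hn, hnC⟩
    obtain h | h := hC n
    · exact ⟨n, hn, (forces_sup.1 h.2).resolve_right fun h => h.false hn⟩
    · exact (h.1.false hnC).elim
  · filter_upwards [hC] with v hC
    simp only [forces_exi, forces_inf]
    rintro ⟨n, hn, hnC⟩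
    obtain h | h := hC n
    · exact (hnC.false h.1).elim
    · exact ⟨n, hn, h.2⟩

/-- The real number that is `1 / (n + 1)` for the element `n` of `A` and `0` if there is none. -/
noncomputable def elemReal (A : El B (.pow .nat)) : El B realTy :=
  pair (compr fun q => ratLt q ratZero ⊔ exi fun n => mem n A ⊓ ratLt q (ratInv n))
    (compr fun q => exi fun n => noneBelow A n ⊓ ratLt (ratInv n) q)

theorem lo_elemReal {q : El B ratTy} : (w ⊩ lo (elemReal A) q) ↔
    (w ⊩ ratLt q ratZero) ∨ ∃ n, (w ⊩ mem n A) ∧ (w ⊩ ratLt q (ratInv n)) := by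
  simp only [elemReal, lo_pair, mem_compr, forces_sup, forces_exi, forces_inf]

theorem hi_elemReal {q : El B ratTy} : (w ⊩ hi (elemReal A) q) ↔
    ∃ n, (w ⊩ noneBelow A n) ∧ (w ⊩ ratLt (ratInv n) q) := by
  simp only [elemReal, hi_pair, mem_compr, forces_exi, forces_inf]

theorem IsUniqAt.noneBelow {n : El B .nat} (hA : ∀ᶠ v in near w, IsUniqAt v A)
    (hn : w ⊩ mem n A) : w ⊩ noneBelow A n := by
  rw [forces_noneBelow]
  filter_upwards [hA, hn.near] with v hA hn k hk hkA
  exact hk.ne (num_eq_num.2 (hA.uniq hkA hn))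

theorem noneBelow_or_exists_lt (hA : ∀ᶠ v in near w, IsUniqAt v A) (n : El B .nat) :
    (w ⊩ noneBelow A n) ∨ ∃ m, (w ⊩ mem m A) ∧ num w m < num w n :=
  (noneBelow_or_exists_least (hA.mono fun _ h => h.dec) n).imp_right
    fun ⟨m, hm, h⟩ => ⟨m, (forces_mem_least.1 hm).1, h⟩

/-- Locatedness is a bounded search: for 0 < r take 1/(n+1) < r. If `A` has no element below n, the
number is less than r; if m is found, the number is 1/(m+1), which is compared directly. -/
theorem isReal_elemReal (hA : ∀ᶠ v in near w, IsUniqAt v A) : w ⊩ isReal (elemReal A) := by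
  rw [forces_isReal]
  filter_upwards [near_near hA] with v hA
  constructor <;> simp only [lo_elemReal, hi_elemReal]
  · exact (exists_ratLt v ratZero).imp fun _ => Or.inl
  · have h0 : v ⊩ El.noneBelow A 0 := forces_noneBelow.2 (near_of_forall fun v k hk => by
      rw [map_zero] at hk; exact (hk.not_ge (Num.zero_le _)).elim)
    exact (exists_ratGt v (ratInv 0)).imp fun _ h => ⟨0, h0, h⟩
  · exact fun h => Or.imp (ratLt_trans h) fun ⟨n, hn, h'⟩ => ⟨n, hn, ratLt_trans h h'⟩
  · rintro q (h | ⟨n, hn, h⟩)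
    · exact (exists_ratLt_ratLt h).imp fun _ h => ⟨h.1, Or.inl h.2⟩
    · exact (exists_ratLt_ratLt h).imp fun _ h => ⟨h.1, Or.inr ⟨n, hn, h.2⟩⟩
  · exact fun h ⟨n, hn, h'⟩ => ⟨n, hn, ratLt_trans h' h⟩
  · rintro q ⟨n, hn, h⟩
    exact (exists_ratLt_ratLt h).imp fun _ h => ⟨h.2, n, hn, h.1⟩
  · rintro q (h | ⟨m, hm, h⟩) ⟨n, hn, h'⟩
    · exact ratLt_asymm (ratLt_trans h' h) (ratZero_lt_ratInv _ _)
    · exact ratInv_le_ratInv (not_lt.1 fun h => near_self (forces_noneBelow.1 hn) m h hm)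
        (ratLt_trans h' h)
  · intro q r h
    obtain hq | hr := ratLt_or_ratLt h ratZero
    · exact Or.inl (Or.inl hq)
    obtain ⟨n, hn⟩ := exists_ratInv_lt hr
    obtain h' | ⟨m, hm, h'⟩ := noneBelow_or_exists_lt hA n
    · exact Or.inr ⟨n, h', hn⟩
    · exact (ratLt_or_ratLt h (ratInv m)).imp (fun h => Or.inr ⟨m, hm, h⟩)
        fun h => ⟨m, IsUniqAt.noneBelow hA hm, h⟩

theorem elemReal_pos_iff (hA : ∀ᶠ v in near w, IsUniqAt v A) :
    (w ⊩ realLt (ofRat ratZero) (elemReal A)) ↔ (w ⊩ inhabited A) := by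
  rw [realLt_ofRat_left (isReal_elemReal hA).isRealAt, lo_elemReal, forces_inhabited]
  exact ⟨fun h => (h.resolve_left ratLt_irrefl).imp fun _ => And.left,
    fun ⟨n, hn⟩ => Or.inr ⟨n, hn, ratZero_lt_ratInv _ _⟩⟩

/-- Weak Markov's principle for detachable sets with at most one element, in a world. -/
def WMPAt (w : World B) : Prop := ∀ᶠ v in near w, ∀ A : El B (.pow .nat),
  (∀ᶠ u in near v, IsUniqAt u A) → (v ⊩ split (inhabited A)) → (v ⊩ inhabited A)

end

/-- The real of `A` is pseudo-positive: at the element n of `A`, a real y satisfies 0 < y or y <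
1/(n+1), and `split_or` turns this into the required disjunction of double negations. -/
theorem wmpAt_of_forces {w : World B} (h : w ⊩ ev WMP Env.nil) : WMPAt w := by
  filter_upwards [forces_wmp.1 h] with v h A hA hs
  rw [← elemReal_pos_iff hA]
  refine h _ (isReal_elemReal hA) (forces_pseudoPositive.2 ?_)
  filter_upwards [near_near hA, hs.near] with u hA hs y hy
  rw [forces_isReal] at hy
  refine (split_or (f := fun _ => lo y ratZero) (g := fun n => hi y (ratInv n)) hA hs ?_).imp
    (fun h => h.compl_compl_mono ?_) fun h => h.compl_compl_mono ?_
  · filter_upwards [hy] with t hy n _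
    exact hy.located (ratZero_lt_ratInv _ _)
  · filter_upwards [hy] with t hy
    simp only [forces_exi, forces_inf]
    rintro ⟨n, -, h⟩
    exact (realLt_ofRat_left hy).2 h
  · filter_upwards [hy] with t hy
    simp only [forces_exi, forces_inf]
    rintro ⟨n, hn, h⟩
    obtain ⟨q, hq, hq'⟩ := hy.exists_lt h
    exact forces_realLt.2 ⟨q, hq', lo_elemReal.2 (Or.inr ⟨n, hn, hq⟩)⟩

theorem forces_wmp_of_wmpAt {w : World B} (h : WMPAt w) : w ⊩ ev WMP Env.nil := by
  rw [forces_wmp]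
  filter_upwards [h] with v h x hx hp
  obtain ⟨A, hA⟩ := exists_isUniqAt_iff hx
  refine (near_self hA).2.2 (h A (hA.mono fun _ => And.left) ?_)
  exact split_congr (hA.mono fun _ => And.right) (split_of_pseudoPositive hx hp)

end El

end BISH

namespace BISH

open El

variable {B : Ctx}

/-! ### Strong extensionality -/

theorem forces_ev_all {Γ : Ctx} {σ : Ty} [Inh B σ] {w : World B} {φ : Fm (σ :: Γ)} {ρ : Env B Γ} :
    (w ⊩ ev (.all σ φ) ρ) ↔ ∀ᶠ v in near w, ∀ a, v ⊩ ev φ (ρ.cons a) := by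
  simp only [ev_all_eq_allMem, forces_allMem, mem_ev_compr]

theorem forces_ev_ex {Γ : Ctx} {σ : Ty} [Inh B σ] {w : World B} {φ : Fm (σ :: Γ)} {ρ : Env B Γ} :
    (w ⊩ ev (.ex σ φ) ρ) ↔ ∃ a, w ⊩ ev φ (ρ.cons a) := by
  simp only [ev_ex_eq_exMem, forces_exMem, mem_ev_compr]

theorem forces_allStronglyExtensional {Γ : Ctx} {σ : Ty} [Inh B σ] {w : World B} {ρ : Env B Γ}
    {X : Tm Γ (.pow σ)} {N : Tm Γ (.pow (.prod σ σ))} :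
    (w ⊩ ev (AllStronglyExtensional X N) ρ) ↔ ∀ᶠ v in near w, ∀ F,
      (v ⊩ isFun (ev X ρ) El.reals F) → ∀ x y a b, (v ⊩ mem (pair x a) F) →
        (v ⊩ mem (pair y b) F) → (v ⊩ El.realNe a b) → (v ⊩ mem (pair x y) (ev N ρ)) := by
  simp only [AllStronglyExtensional, forces_ev_all, ev_imp, ev_isFun, ev_w, ev_var_zero, ev_reals,
    ev_mem, ev_pair, ev_realNe, forces_himp, near_forall_near, near_imp_near]

namespace El

section
variable {w : World B}

/-- The argument common to all the spaces: `A` stands for the inequality of `x` and `y`, and `hz`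
says that the two points can be glued along any splitting of it. -/
theorem forces_inhabited_of_wmpAt (hw : WMPAt w) {σ : Ty} [Inh B σ] {X : El B (.pow σ)}
    {F : El B (.pow (.prod σ realTy))} (hF : w ⊩ isFun X reals F) {x y : El B σ}
    {a b : El B realTy} (hx : w ⊩ mem (pair x a) F) (hy : w ⊩ mem (pair y b) F)
    (hab : w ⊩ realNe a b) {A : El B (.pow .nat)} (hA : ∀ᶠ v in near w, IsUniqAt v A)
    (hxy : w ⊩ (inhabited A)ᶜ ⇨ El.eq x y)
    (hz : ∀ᶠ v in near w, ∀ P Q, (v ⊩ (P ⊓ Q)ᶜ) → (v ⊩ inhabited A ⇨ P ⊔ Q) →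
      ∃ z, (v ⊩ mem z X) ∧ (v ⊩ P ⇨ El.eq z x) ∧ (v ⊩ Q ⇨ El.eq z y)) :
    w ⊩ inhabited A := by
  refine near_self hw A hA (forces_split.2 ?_)
  filter_upwards [hz, near_near (forces_isFun.1 hF), hx.near, hy.near, hab.near, hxy.near]
    with v hz hF hx hy hab hxy P Q hPQ hφ
  obtain ⟨z, hzX, hP, hQ⟩ := hz P Q hPQ hφ
  have hF' := near_self hF
  obtain ⟨c, hc⟩ := hF'.total hzX
  have real : ∀ {u : World B} {z c}, IsFunAt u X reals F → (u ⊩ mem (pair z c) F) →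
      IsRealAt u c := fun hF h => (forces_mem_reals.1 (hF.cod h)).isRealAt
  -- If the value at z differs from the value at x, then z = x is impossible, and so is P. The same
  -- applies to y and Q.
  have key : ∀ {P : Om B} {x a}, (v ⊩ mem (pair x a) F) → (v ⊩ P ⇨ El.eq z x) →
      (v ⊩ realNe c a) → (v ⊩ Pᶜ) := by
    intro P x a hx hP hca
    rw [forces_compl]
    filter_upwards [hx.near, hP.near, hca.near, hc.near, hF] with u hx hP hca hc hF h
    have := hF.unique ((hP.mp h).subst (fun z => mem (pair z c) F) hc) hx
    exact realNe_irrefl (real hF hx) (this.subst (fun c => realNe c a) hca)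
  -- If P and Q both failed, `A` would be empty, so x = y and the values at x and y would be equal.
  have main : ∀ {P Q : Om B}, (v ⊩ inhabited A ⇨ P ⊔ Q) → (v ⊩ Pᶜ) → (v ⊩ Qᶜᶜ) := by
    intro P Q hφ hP
    rw [forces_compl]
    filter_upwards [near_near (forces_himp.1 hφ), near_near hP.near, hxy.near, hx.near, hy.near,
      hab.near, hF] with u hφ hP hxy hx hy hab hF hQ
    have := hxy.mp (forces_compl.2 (by
      filter_upwards [hφ, hP, hQ.near] with t hφ hP hQ h
      exact (forces_sup.1 (hφ h)).elim hP.false hQ.false))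
    have := hF.unique (this.subst (fun x => mem (pair x a) F) hx) hy
    exact realNe_irrefl (real hF hy) (this.subst (fun a => realNe a b) hab)
  obtain h | h := realNe_or_realNe (real hF' hx) (real hF' hy) (real hF' hc) hab
  · exact Or.inr (main hφ (key hx hP h))
  · refine Or.inl (main ?_ (key hy hQ h))
    rw [forces_himp] at hφ ⊢
    filter_upwards [hφ] with u hφ h
    exact forces_sup.2 (forces_sup.1 (hφ h)).symm

end

end El

/-! ### Spaces of sequences -/

/-- The type of sequences of natural numbers. -/
abbrev seqTy : Ty := .pow (.prod .nat .nat)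

namespace El

/-- The sequence `α` is nondecreasing in the world `w`. -/
def MonoAt (w : World B) (α : El B seqTy) : Prop := ∀ {n i j : El B .nat},
  (w ⊩ mem (pair n i) α) → (w ⊩ mem (pair (n + 1) j) α) → num w i ≤ num w j

/-- The set `{0, 1}`. -/
noncomputable def two : El B (.pow .nat) := compr fun n => El.eq n 0 ⊔ El.eq n 1

/-- The sequence that is `α` if `P` and `β` if `Q`. -/
noncomputable def glue (P Q : Om B) (α β : El B seqTy) : El B seqTy :=
  compr fun p => (P ⊓ mem p α) ⊔ ((Q ⊓ mem p β) ⊔ (mem p α ⊓ mem p β))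

section
variable {w : World B}

theorem forces_mem_two {n : El B .nat} : (w ⊩ mem n two) ↔ num w n = 0 ∨ num w n = 1 := by
  rw [two, mem_compr, forces_sup, ← num_eq_num, ← num_eq_num, map_zero, map_one]

end

end El

section
variable {w : World B} {Γ : Ctx} {ρ : Env B Γ} {α β : El B seqTy}

theorem ev_two : ev BISH.two ρ = El.two := by
  simp [BISH.two, El.two, ev_compr]

theorem forces_mem_baire :
    (w ⊩ mem α (ev baire ρ)) ↔ ∀ᶠ v in near w, IsFunAt v (El.univ .nat) (El.univ .nat) α := by
  simp only [baire, mem_ev_compr, ev_isFun, ev_univ, ev_var_zero, forces_isFun]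

theorem forces_mem_cantor :
    (w ⊩ mem α (ev cantor ρ)) ↔ ∀ᶠ v in near w, IsFunAt v (El.univ .nat) El.two α := by
  simp only [cantor, mem_ev_compr, ev_isFun, ev_univ, ev_two, ev_var_zero, forces_isFun]

theorem forces_mem_natInfty : (w ⊩ mem α (ev natInfty ρ)) ↔
    ∀ᶠ v in near w, IsFunAt v (El.univ .nat) El.two α ∧ MonoAt v α := by
  simp only [natInfty, mem_ev_compr, ev_and, ev_isFun, ev_univ, ev_two, ev_var_zero, forces_inf,
    forces_isFun, forces_ev_all, ev_imp, ev_mem, ev_pair, ev_w, ev_succ, ev_natLe, forces_himp,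
    near_forall_near, near_imp_near, near_and_near]
  simp only [forces_natLe, MonoAt]

theorem forces_mem_seqNeSet : (w ⊩ mem (pair α β) (ev seqNeSet ρ)) ↔
    ∃ n i j, (w ⊩ mem (pair n i) α) ∧ (w ⊩ mem (pair n j) β) ∧ (w ⊩ (El.eq i j)ᶜ) := by
  simp only [seqNeSet, mem_ev_compr, forces_ev_ex, ev_and, ev_mem, ev_pair, ev_w, ev_var_zero,
    ev_fst, ev_snd, fst_pair, snd_pair, ev_neg, ev_eq, forces_inf]

end

end BISH

/-! ### Gluing of sequences; Baire space, Cantor space and the increasing binary sequences -/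

namespace BISH

open El

variable {B : Ctx}

namespace El

section
variable {w : World B} {P Q : Om B} {α β : El B seqTy} {T : El B (.pow .nat)}

theorem forces_mem_glue {p : El B (.prod .nat .nat)} : (w ⊩ mem p (glue P Q α β)) ↔
    (w ⊩ P) ∧ (w ⊩ mem p α) ∨ (w ⊩ Q) ∧ (w ⊩ mem p β) ∨ (w ⊩ mem p α) ∧ (w ⊩ mem p β) := by
  simp only [glue, mem_compr, forces_sup, forces_inf]

/-- Equality of the two terms at n is decidable: if they agree, the common part of the graphs
supplies the value; if not, the sequences differ and P or Q selects one of them. -/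
theorem IsFunAt.glue (hα : IsFunAt w (univ .nat) T α) (hβ : IsFunAt w (univ .nat) T β)
    (hPQ : (w ⊩ P) → ¬ (w ⊩ Q))
    (h : ∀ {n i j}, (w ⊩ mem (pair n i) α) → (w ⊩ mem (pair n j) β) → (w ⊩ (El.eq i j)ᶜ) →
      (w ⊩ P) ∨ (w ⊩ Q)) : IsFunAt w (univ .nat) T (glue P Q α β) := by
  constructor
  · exact fun _ => forces_mem_univ _
  · intro n i hi
    obtain ⟨-, h⟩ | ⟨-, h⟩ | ⟨h, -⟩ := forces_mem_glue.1 hi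
    · exact hα.cod h
    · exact hβ.cod h
    · exact hα.cod h
  · intro n hn
    obtain ⟨i, hi⟩ := hα.total hn
    obtain ⟨j, hj⟩ := hβ.total hn
    simp only [forces_mem_glue]
    obtain hij | hij := eq_or_compl w i j
    · exact ⟨j, Or.inr (Or.inr ⟨hij.subst (fun i => mem (pair n i) α) hi, hj⟩)⟩
    · obtain hP | hQ := h hi hj hij
      · exact ⟨i, Or.inl ⟨hP, hi⟩⟩
      · exact ⟨j, Or.inr (Or.inl ⟨hQ, hj⟩)⟩
  · intro n i j hi hj
    obtain ⟨hP, hi⟩ | ⟨hQ, hi⟩ | ⟨hi, hi'⟩ := forces_mem_glue.1 hi <;>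
    obtain ⟨hP', hj⟩ | ⟨hQ', hj⟩ | ⟨hj, hj'⟩ := forces_mem_glue.1 hj
    · exact hα.unique hi hj
    · exact (hPQ hP hQ').elim
    · exact hα.unique hi hj
    · exact (hPQ hP' hQ).elim
    · exact hβ.unique hi hj
    · exact hβ.unique hi hj'
    · exact hα.unique hi hj
    · exact hβ.unique hi' hj
    · exact hα.unique hi hj

theorem MonoAt.glue (hα : MonoAt w α) (hβ : MonoAt w β) (hPQ : (w ⊩ P) → ¬ (w ⊩ Q)) :
    MonoAt w (glue P Q α β) := by
  intro n i j hi hj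
  obtain ⟨hP, hi⟩ | ⟨hQ, hi⟩ | ⟨hi, hi'⟩ := forces_mem_glue.1 hi <;>
  obtain ⟨hP', hj⟩ | ⟨hQ', hj⟩ | ⟨hj, hj'⟩ := forces_mem_glue.1 hj
  · exact hα hi hj
  · exact (hPQ hP hQ').elim
  · exact hα hi hj
  · exact (hPQ hP' hQ).elim
  · exact hβ hi hj
  · exact hβ hi hj'
  · exact hα hi hj
  · exact hβ hi' hj
  · exact hα hi hj

theorem glue_eq_left (hPQ : w ⊩ (P ⊓ Q)ᶜ) : w ⊩ P ⇨ El.eq (glue P Q α β) α := by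
  rw [forces_himp]
  filter_upwards [near_near hPQ.near] with v hPQ hP
  refine forces_eq_of_near_mem_iff ?_
  filter_upwards [hP.near, hPQ] with u hP hPQ p
  rw [forces_mem_glue]
  refine ⟨?_, fun h => Or.inl ⟨hP, h⟩⟩
  rintro (h | h | h)
  · exact h.2
  · exact (hPQ.false (forces_inf.2 ⟨hP, h.1⟩)).elim
  · exact h.1

theorem glue_eq_right (hPQ : w ⊩ (P ⊓ Q)ᶜ) : w ⊩ Q ⇨ El.eq (glue P Q α β) β := by
  rw [forces_himp]
  filter_upwards [near_near hPQ.near] with v hPQ hQ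
  refine forces_eq_of_near_mem_iff ?_
  filter_upwards [hQ.near, hPQ] with u hQ hPQ p
  rw [forces_mem_glue]
  refine ⟨?_, fun h => Or.inr (Or.inl ⟨hQ, h⟩)⟩
  rintro (h | h | h)
  · exact (hPQ.false (forces_inf.2 ⟨h.1, hQ⟩)).elim
  · exact h.2
  · exact h.2

/-- The properties of a space of sequences that are used in the comparison with weak Markov's
principle. -/
structure IsSeqSpace (X : El B (.pow seqTy)) : Prop where
  isFun : ∀ {w : World B} {α}, (w ⊩ mem α X) → (w ⊩ isFun (univ .nat) (univ .nat) α)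
  mem : ∀ {w : World B} {α}, (∀ᶠ v in near w, IsFunAt v (univ .nat) two α ∧ MonoAt v α) →
    (w ⊩ El.mem α X)
  glue : ∀ {w : World B} {α β P Q}, (w ⊩ El.mem α X) → (w ⊩ El.mem β X) →
    (∀ᶠ v in near w, (v ⊩ P) → ¬ (v ⊩ Q)) →
    (∀ᶠ v in near w, ∀ {n i j}, (v ⊩ El.mem (pair n i) α) → (v ⊩ El.mem (pair n j) β) →
      (v ⊩ (El.eq i j)ᶜ) → (v ⊩ P) ∨ (v ⊩ Q)) → (w ⊩ El.mem (glue P Q α β) X)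

theorem IsFunAt.mono_cod {σ τ : Ty} {C : El B (.pow σ)} {D E : El B (.pow τ)}
    {F : El B (.pow (.prod σ τ))} (hF : IsFunAt w C D F)
    (h : ∀ x, (w ⊩ El.mem x D) → (w ⊩ El.mem x E)) : IsFunAt w C E F :=
  ⟨hF.dom, fun h' => h _ (hF.cod h'), hF.total, hF.unique⟩

end

section
variable {Γ : Ctx} {ρ : Env B Γ}

theorem isSeqSpace_baire : IsSeqSpace (ev baire ρ) where
  isFun h := forces_isFun.2 (forces_mem_baire.1 h)
  mem h := forces_mem_baire.2 (h.mono fun _ h => h.1.mono_cod fun _ _ => forces_mem_univ _)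
  glue hα hβ hPQ h := by
    rw [forces_mem_baire] at *
    filter_upwards [hα, hβ, hPQ, h] with v hα hβ hPQ h
    exact hα.glue hβ hPQ h

theorem isSeqSpace_cantor : IsSeqSpace (ev cantor ρ) where
  isFun h := forces_isFun.2 ((forces_mem_cantor.1 h).mono fun _ h =>
    h.mono_cod fun _ _ => forces_mem_univ _)
  mem h := forces_mem_cantor.2 (h.mono fun _ h => h.1)
  glue hα hβ hPQ h := by
    rw [forces_mem_cantor] at *
    filter_upwards [hα, hβ, hPQ, h] with v hα hβ hPQ h
    exact hα.glue hβ hPQ h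

theorem isSeqSpace_natInfty : IsSeqSpace (ev natInfty ρ) where
  isFun h := forces_isFun.2 ((forces_mem_natInfty.1 h).mono fun _ h =>
    h.1.mono_cod fun _ _ => forces_mem_univ _)
  mem := forces_mem_natInfty.2
  glue hα hβ hPQ h := by
    rw [forces_mem_natInfty] at *
    filter_upwards [hα, hβ, hPQ, h] with v hα hβ hPQ h
    exact ⟨hα.1.glue hβ.1 hPQ h, MonoAt.glue hα.2 hβ.2 hPQ⟩

end

section
variable {w : World B} {Γ : Ctx} {ρ : Env B Γ} {X : Tm Γ (.pow seqTy)}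

/-- The set `A` of the general argument consists of the least index at which the sequences differ;
the glued point is `El.glue`. -/
theorem IsSeqSpace.allStronglyExtensional (hX : IsSeqSpace (ev X ρ)) (hw : WMPAt w) :
    w ⊩ ev (AllStronglyExtensional X seqNeSet) ρ := by
  rw [forces_allStronglyExtensional]
  filter_upwards [near_near hw] with w hw F hF α β a b hα hβ hab
  have hαX := hF.isFunAt.dom hα
  have hβX := hF.isFunAt.dom hβ
  let N : El B (.pow .nat) := compr fun n => exi fun i => exi fun j =>
    El.mem (pair n i) α ⊓ (El.mem (pair n j) β ⊓ (El.eq i j)ᶜ)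
  have hN : ∀ {v : World B} {n}, (v ⊩ El.mem n N) ↔ ∃ i j, (v ⊩ El.mem (pair n i) α) ∧
      (v ⊩ El.mem (pair n j) β) ∧ (v ⊩ (El.eq i j)ᶜ) := by
    intro v n; simp only [N, mem_compr, forces_exi, forces_inf]
  have hα' := forces_isFun.1 (hX.isFun hαX)
  have hβ' := forces_isFun.1 (hX.isFun hβX)
  have hdec : ∀ᶠ v in near w, ∀ n, (v ⊩ El.mem n N) ∨
      (v ⊩ (El.mem n N)ᶜ) ∧ ∃ i, (v ⊩ El.mem (pair n i) α) ∧ (v ⊩ El.mem (pair n i) β) := by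
    filter_upwards [near_near hα', near_near hβ'] with v hα' hβ' n
    obtain ⟨i, hi⟩ := (near_self hα').total (forces_mem_univ n)
    obtain ⟨j, hj⟩ := (near_self hβ').total (forces_mem_univ n)
    obtain h | h := eq_or_compl v i j
    · refine Or.inr ⟨forces_compl.2 ?_, i, hi, h.symm.subst (fun j => El.mem (pair n j) β) hj⟩
      filter_upwards [h.near, hi.near, hj.near, hα', hβ'] with u h hi hj hα' hβ' hn
      obtain ⟨i', j', hi', hj', hne⟩ := hN.1 hn
      exact hne.false (((hα'.unique hi' hi).trans h).trans (hβ'.unique hj hj'))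
    · exact Or.inl (hN.2 ⟨i, j, hi, hj, h⟩)
  have hdec' : ∀ᶠ v in near w, ∀ n, (v ⊩ El.mem n N) ∨ (v ⊩ (El.mem n N)ᶜ) :=
    hdec.mono fun v h n => (h n).imp_right And.left
  have hinh : ∀ᶠ v in near w, (v ⊩ inhabited (least N)) ↔ ∃ n, v ⊩ El.mem n N := by
    filter_upwards [near_near hdec'] with v h
    rw [forces_inhabited, inhabited_least_iff h]
  have := forces_inhabited_of_wmpAt hw hF hα hβ hab (A := least N)
    ((near_near hdec').mono fun _ => isUniqAt_least) ?_ ?_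
  · rw [near_self hinh] at this
    simp only [hN] at this
    exact forces_mem_seqNeSet.2 this
  · rw [forces_himp]
    filter_upwards [near_near hdec, near_near hinh, near_near hα', near_near hβ']
      with v hdec hinh hα' hβ' h
    refine forces_eq_of_near_mem_iff ?_
    filter_upwards [hdec, hinh, h.near, hα', hβ'] with u hdec hinh h hα' hβ' p
    obtain h' | ⟨-, i, hi, hi'⟩ := hdec p.fst
    · exact (h.false (hinh.2 ⟨_, h'⟩)).elim
    · rw [← pair_fst_snd p]
      exact ⟨fun h => (hα'.unique hi h).subst (fun i => El.mem (pair p.fst i) β) hi',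
        fun h => (hβ'.unique hi' h).subst (fun i => El.mem (pair p.fst i) α) hi⟩
  · filter_upwards [near_near hinh, hαX.near, hβX.near] with v hinh hαX hβX P Q hPQ hφ
    refine ⟨El.glue P Q α β, hX.glue hαX hβX ?_ ?_, glue_eq_left hPQ, glue_eq_right hPQ⟩
    · exact (forces_compl.1 hPQ).mono fun u h hP hQ => h (forces_inf.2 ⟨hP, hQ⟩)
    · filter_upwards [hinh, hφ.near] with u hinh hφ n i j hi hj hij
      exact forces_sup.1 (hφ.mp (hinh.2 ⟨n, hN.2 ⟨i, j, hi, hj, hij⟩⟩))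

/-- Split φ into itself and falsity. -/
theorem compl_compl_of_split {φ : Om B} (h : w ⊩ split φ) : w ⊩ φᶜᶜ := by
  refine (near_self (forces_split.1 h) φ ⊥ ?_ ?_).elim id fun h =>
    (h.false (forces_compl.2 (near_of_forall fun v h => forces_bot.1 h))).elim
  · exact forces_compl.2 (near_of_forall fun v h => forces_bot.1 (forces_inf.1 h).2)
  · exact forces_himp.2 (near_of_forall fun v h => forces_sup.2 (Or.inl h))

theorem false_of_compl_compl {a b : Om B} (ha : w ⊩ aᶜᶜ) (hb : w ⊩ bᶜᶜ)
    (h : ∀ᶠ v in near w, (v ⊩ a) → ¬ (v ⊩ b)) : False :=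
  hb.false (forces_compl_of_compl_compl ha h)

theorem not_one_eq_zero : ¬ (w ⊩ El.eq (1 : El B .nat) 0) := fun h => by
  rw [← zero_add (1 : El B .nat)] at h
  exact forces_add_one_ne_zero h

theorem IsSeqSpace.wmpAt (hX : IsSeqSpace (ev X ρ))
    (h : w ⊩ ev (AllStronglyExtensional X seqNeSet) ρ) : WMPAt w := by
  filter_upwards [forces_allStronglyExtensional.1 h] with w h A hA hs
  -- The n-th term is 0 as long as `A` has no element up to n inclusive, and 1 from its element on.
  -- The sequence is compared with the zero sequence `O`.
  let α : El B seqTy := compr fun p => (noneBelow A (p.fst + 1) ⊓ El.eq p.snd 0) ⊔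
    ((exi fun k => El.mem k A ⊓ natLt k (p.fst + 1)) ⊓ El.eq p.snd 1)
  have hα : ∀ {v : World B} {n i}, (v ⊩ El.mem (pair n i) α) ↔
      (v ⊩ noneBelow A (n + 1)) ∧ (v ⊩ El.eq i 0) ∨
      (∃ k, (v ⊩ El.mem k A) ∧ num v k < num v (n + 1)) ∧ (v ⊩ El.eq i 1) := by
    intro v n i
    simp only [α, mem_compr, forces_sup, forces_exi, forces_inf, forces_natLt, fst_pair, snd_pair]
  let O : El B seqTy := compr fun p => El.eq p.snd 0
  have hO : ∀ {v : World B} {n i}, (v ⊩ El.mem (pair n i) O) ↔ (v ⊩ El.eq i 0) := by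
    intro v n i; simp only [O, mem_compr, snd_pair]
  have disj : ∀ {v : World B} {m n : El B .nat}, num v m ≤ num v n → (v ⊩ noneBelow A (n + 1)) →
      ¬ ∃ k, (v ⊩ El.mem k A) ∧ num v k < num v (m + 1) := by
    rintro v m n hmn h ⟨k, hk, hkm⟩
    refine near_self (forces_noneBelow.1 h) k (hkm.trans_le ?_) hk
    rw [map_add, map_add]
    exact add_le_add_left hmn _
  have hαX : w ⊩ El.mem α (ev X ρ) := by
    refine hX.mem ?_
    filter_upwards [near_near hA] with v hA
    refine ⟨⟨fun _ => forces_mem_univ _, ?_, ?_, ?_⟩, ?_⟩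
    · intro n i hi
      rw [forces_mem_two, ← map_zero (num v), ← map_one (num v), num_eq_num, num_eq_num]
      exact (hα.1 hi).imp And.right And.right
    · intro n _
      simp only [hα]
      exact (noneBelow_or_exists_lt hA (n + 1)).elim
        (fun h => ⟨0, Or.inl ⟨h, forces_eq_refl _ _⟩⟩)
        fun h => ⟨1, Or.inr ⟨h, forces_eq_refl _ _⟩⟩
    · intro n i j hi hj
      obtain ⟨h, hi⟩ | ⟨h, hi⟩ := hα.1 hi <;> obtain ⟨h', hj⟩ | ⟨h', hj⟩ := hα.1 hj
      · exact hi.trans hj.symm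
      · exact (disj le_rfl h h').elim
      · exact (disj le_rfl h' h).elim
      · exact hi.trans hj.symm
    · intro n i j hi hj
      obtain ⟨h, hi⟩ | ⟨h, hi⟩ := hα.1 hi
      · rw [num_eq_num.2 hi, map_zero]
        exact Num.zero_le _
      · obtain ⟨h', hj⟩ | ⟨h', hj⟩ := hα.1 hj
        · exact (disj (by rw [map_add]; simp) h' h).elim
        · exact (num_eq_num.2 (hi.trans hj.symm)).le
  have hOX : w ⊩ El.mem O (ev X ρ) := by
    refine hX.mem (near_of_forall fun v => ⟨⟨fun _ => forces_mem_univ _, ?_, ?_, ?_⟩, ?_⟩)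
    · intro n i hi
      rw [forces_mem_two, ← map_zero (num v), num_eq_num]
      exact Or.inl (hO.1 hi)
    · exact fun _ => ⟨0, hO.2 (forces_eq_refl _ _)⟩
    · exact fun hi hj => (hO.1 hi).trans (hO.1 hj).symm
    · exact fun hi hj => (num_eq_num.2 ((hO.1 hi).trans (hO.1 hj).symm)).le
  let f₁ : El B seqTy → Om B := fun γ => (exi fun n => El.mem n A ⊓ (El.mem (pair n 0) γ)ᶜ)ᶜᶜ
  let f₀ : El B seqTy → Om B := fun γ => (exi fun n => El.mem n A ⊓ El.mem (pair n 0) γ)ᶜᶜ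
  -- The value at γ is 1 or 0 according to whether the term of γ at the element of `A` is nonzero or
  -- zero, up to double negation. `split_or` gives a value for every γ, and uniqueness in `A` makes
  -- the cases exclusive.
  let F : El B (.pow (.prod seqTy realTy)) := compr fun p => El.mem p.fst (ev X ρ) ⊓
    ((f₁ p.fst ⊓ El.eq p.snd (ofRat ratOne)) ⊔ (f₀ p.fst ⊓ El.eq p.snd (ofRat ratZero)))
  have hF : ∀ {v : World B} {γ u}, (v ⊩ El.mem (pair γ u) F) ↔ (v ⊩ El.mem γ (ev X ρ)) ∧
      ((v ⊩ f₁ γ) ∧ (v ⊩ El.eq u (ofRat ratOne)) ∨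
      (v ⊩ f₀ γ) ∧ (v ⊩ El.eq u (ofRat ratZero))) := by
    intro v γ u
    simp only [F, f₁, f₀, mem_compr, forces_sup, forces_inf, fst_pair, snd_pair]
  have hdisj : ∀ᶠ v in near w, ∀ γ, (v ⊩ f₁ γ) → ¬ (v ⊩ f₀ γ) := by
    filter_upwards [near_near hA] with v hA γ h₁ h₀
    refine false_of_compl_compl h₁ h₀ ?_
    filter_upwards [hA] with u hA h₁ h₀
    simp only [forces_exi, forces_inf] at h₁ h₀
    obtain ⟨m, hm, hm'⟩ := h₁
    obtain ⟨n, hn, hn'⟩ := h₀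
    exact hm'.false ((hA.uniq hn hm).subst (fun n => El.mem (pair n 0) γ) hn')
  have hFf : w ⊩ El.isFun (ev X ρ) reals F := by
    rw [forces_isFun]
    filter_upwards [near_near hA, hs.near, hdisj] with v hA hs hdisj
    constructor
    · exact fun h => (hF.1 h).1
    · intro γ u h
      rw [forces_mem_reals]
      obtain h | h := (hF.1 h).2
      · exact h.2.symm.subst isReal (isReal_ofRat _ _)
      · exact h.2.symm.subst isReal (isReal_ofRat _ _)
    · intro γ hγ
      simp only [hF]
      refine (split_or (f := fun n : El B .nat => (El.mem (pair n (0 : El B .nat)) γ)ᶜ)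
        (g := fun n : El B .nat => El.mem (pair n (0 : El B .nat)) γ) hA hs ?_).elim
        (fun h => ⟨_, hγ, Or.inl ⟨h, forces_eq_refl _ _⟩⟩)
        fun h => ⟨_, hγ, Or.inr ⟨h, forces_eq_refl _ _⟩⟩
      filter_upwards [near_near (forces_isFun.1 (hX.isFun hγ))] with u hγ n _
      obtain ⟨i, hi⟩ := (near_self hγ).total (forces_mem_univ n)
      obtain h | h := eq_or_compl u i 0
      · exact Or.inr (h.subst (fun i => El.mem (pair n i) γ) hi)
      · refine Or.inl (forces_compl.2 ?_)
        filter_upwards [h.near, hγ, hi.near] with t h hγ hi h'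
        exact h.false (hγ.unique hi h')
    · intro γ a b ha hb
      obtain ha | ha := (hF.1 ha).2 <;> obtain hb | hb := (hF.1 hb).2
      · exact ha.2.trans hb.2.symm
      · exact (hdisj γ ha.1 hb.1).elim
      · exact (hdisj γ hb.1 ha.1).elim
      · exact ha.2.trans hb.2.symm
  have hinh := compl_compl_of_split hs
  have h₁ : w ⊩ f₁ α := by
    refine hinh.compl_compl_mono (near_of_forall fun v h => ?_)
    obtain ⟨n, hn⟩ := forces_inhabited.1 h
    simp only [forces_exi, forces_inf]
    refine ⟨n, hn, forces_compl.2 ?_⟩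
    filter_upwards [hn.near] with u hn h
    obtain h | h := hα.1 h
    · exact disj le_rfl h.1 ⟨n, hn, by rw [map_add]; simp⟩
    · exact not_one_eq_zero h.2.symm
  have h₀ : w ⊩ f₀ O := by
    refine hinh.compl_compl_mono (near_of_forall fun v h => ?_)
    obtain ⟨n, hn⟩ := forces_inhabited.1 h
    simp only [forces_exi, forces_inf]
    exact ⟨n, hn, hO.2 (forces_eq_refl _ _)⟩
  -- Strong extensionality yields an index at which `α` is not 0, and by the definition of `α` an
  -- element of `A` lies at or below it.
  obtain ⟨n, i, j, hi, hj, hij⟩ := forces_mem_seqNeSet.1 (h F hFf α O (ofRat ratOne) (ofRat ratZero)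
    (hF.2 ⟨hαX, Or.inl ⟨h₁, forces_eq_refl _ _⟩⟩) (hF.2 ⟨hOX, Or.inr ⟨h₀, forces_eq_refl _ _⟩⟩)
    (forces_realNe.2 (Or.inr ((realLt_ofRat_left (isReal_ofRat _ _).isRealAt).2
      (by rw [lo_ofRat]; exact ratZero_lt_ratOne _)))))
  obtain h | h := hα.1 hi
  · exact (hij.false (h.2.trans (hO.1 hj).symm)).elim
  · exact forces_inhabited.2 (h.1.imp fun _ => And.left)

end

end El

theorem El.IsSeqSpace.equivalent {X : Tm [] (.pow seqTy)}
    (hX : IsSeqSpace (B := []) (ev X Env.nil)) :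
    Equivalent {WMP} {AllStronglyExtensional X seqNeSet} := by
  refine ⟨fun φ hφ => ?_, fun φ hφ => ?_⟩
  · rw [Set.mem_singleton_iff.1 hφ]
    exact derives_sentence_of_forces fun w h => hX.allStronglyExtensional (wmpAt_of_forces h)
  · rw [Set.mem_singleton_iff.1 hφ]
    exact derives_sentence_of_forces fun w h => forces_wmp_of_wmpAt (hX.wmpAt h)

theorem equivalent_wmp_seBaire : Equivalent {WMP} {SEBaire} := isSeqSpace_baire.equivalent

theorem equivalent_wmp_seCantor : Equivalent {WMP} {SECantor} := isSeqSpace_cantor.equivalent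

theorem equivalent_wmp_seNatInfty : Equivalent {WMP} {SENatInfty} := isSeqSpace_natInfty.equivalent

end BISH

namespace BISH

open El

variable {B : Ctx}

/-! ### The unit interval -/

namespace El

section
variable {w : World B}

/-- `a / (n + 1)`. -/
noncomputable def ratFrac (a n : El B .nat) : El B ratTy := pair (pair a 0) n

theorem exists_ratFrac {p r : El B ratTy} (h₀ : w ⊩ ratLt ratZero p) (h : w ⊩ ratLt p r) :
    ∃ a n, (w ⊩ ratLt p (ratFrac a n)) ∧ (w ⊩ ratLt (ratFrac (a + 1) n) r) := by
  obtain ⟨q, hpq, hqr⟩ := exists_ratLt_ratLt h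
  obtain ⟨q', hqq', hqr'⟩ := exists_ratLt_ratLt hqr
  have hq := ratLt_trans h₀ hpq
  rw [ratZero_lt_iff, Num.lt_def] at hq
  obtain ⟨z, hz⟩ := hq
  obtain ⟨k, hk⟩ := num_surjective (z + 1)
  rw [← hk] at hz
  -- With p < q < q' < r and q = k/(`q.snd` + 1), pass to the common denominator of q and q': the
  -- first fraction is q, and the next one is at most q' because numerators are whole numbers.
  refine ⟨k * (q'.snd + 1), q.snd * q'.snd + q.snd + q'.snd, ?_⟩
  rw [forces_ratLt] at *
  rw [forces_ratLt]
  simp only [ratFrac, fst_pair, snd_pair, map_add, map_mul, map_one, map_zero, ← hz] at *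
  have hq := Num.add_one_pos (num w q.snd)
  have hq' := Num.add_one_pos (num w q'.snd)
  have hr := Num.add_one_pos (num w r.snd)
  have e : num w q.snd * num w q'.snd + num w q.snd + num w q'.snd + 1 =
    (num w q.snd + 1) * (num w q'.snd + 1) := by ring
  rw [e]
  generalize num w q.snd + 1 = C at *
  generalize num w q'.snd + 1 = C' at *
  generalize num w r.snd + 1 = C'' at *
  generalize num w p.snd + 1 = D at *
  generalize num w k = k at *
  generalize num w q.fst.snd = b at *
  generalize num w q'.fst.fst = a' at *
  generalize num w q'.fst.snd = b' at *
  constructor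
  · have h₁ : num w p.fst.fst * C < k * D + num w p.fst.snd * C := by
      refine lt_of_add_lt_add_right (a := b * D) ?_
      convert hpq using 1; ring
    convert mul_lt_mul_of_pos_right h₁ hq' using 1 <;> ring
  · have h₁ : k * C' + b' * C + 1 ≤ a' * C := by
      rw [← Num.lt_add_one_iff]
      refine add_lt_add_left (lt_of_add_lt_add_right (a := b * C') ?_) 1
      convert hqq' using 1; ring
    have h₂ := mul_lt_mul_of_pos_right hqr' hq
    have h₃ := mul_le_mul_of_nonneg_right h₁ hr.le
    refine lt_of_add_lt_add_right (a := b' * C * C'') ?_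
    refine lt_of_le_of_lt (b := a' * C * C'' + num w r.fst.snd * (C * C')) ?_ ?_
    · convert add_le_add_left h₃ (num w r.fst.snd * (C * C')) using 1; ring
    · convert h₂ using 1 <;> ring

theorem forces_mem_unitInterval {x : El B realTy} : (w ⊩ mem x unitInterval) ↔
    ∀ᶠ v in near w, IsRealAt v x ∧ ¬ (v ⊩ hi x ratZero) ∧ ¬ (v ⊩ lo x ratOne) := by
  rw [unitInterval, mem_compr, forces_inf, forces_inf, forces_isReal, forces_realLe, forces_realLe,
    near_and_near, near_and_near]
  refine Filter.eventually_congr (near_of_forall fun v => and_congr_right fun hx => ?_)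
  rw [realLt_ofRat_left hx, realLt_ofRat_right hx]

/-- A choice between `s` and all the alternatives below a bound. -/
theorem forces_or_forall_lt {s : Om B} {f : El B .nat → Om B} [Dfn f]
    (h : ∀ᶠ v in near w, ∀ a, (v ⊩ s) ∨ (v ⊩ f a)) (n : El B .nat) :
    (w ⊩ s) ∨ (w ⊩ fal fun a => natLt a n ⇨ f a) := by
  have hf : Dfn fun p : El B (.prod .nat .nat) => f p.snd := Dfn.comp f _
  rw [← forces_sup]
  refine forces_induction (f := fun n => s ⊔ fal fun a => natLt a n ⇨ f a) ?_ ?_ n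
  · simp only [forces_sup, forces_fal, forces_himp, near_forall_near]
    refine Or.inr (near_of_forall fun v a h => ?_)
    rw [forces_natLt, map_zero] at h
    exact (h.not_ge (Num.zero_le _)).elim
  · filter_upwards [h] with v h n hn
    simp only [forces_sup, forces_fal, forces_himp, near_forall_near] at hn ⊢
    obtain hn | hn := hn
    · exact Or.inl hn
    obtain h' | h' := h n
    · exact Or.inl h'
    right
    filter_upwards [hn, h'.near] with u hn h' a ha
    rw [forces_natLt, map_add, map_one, Num.lt_add_one_iff] at ha
    obtain ha | ha := ha.lt_or_eq
    · exact hn a (forces_natLt.2 ha)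
    · exact (num_eq_num.1 ha).symm.subst f h'

theorem realLt_or {x y : El B realTy} {p r : El B ratTy} (hx : IsRealAt w x) (hy : IsRealAt w y)
    (h : w ⊩ ratLt p r) : (w ⊩ realLt x y) ∨ (w ⊩ lo x p) ∨ (w ⊩ hi y r) := by
  obtain ⟨s, hs, hs'⟩ := exists_ratLt_ratLt h
  obtain h | h := hx.located hs
  · exact Or.inr (Or.inl h)
  obtain h' | h' := hy.located hs'
  · exact Or.inl (forces_realLt.2 ⟨s, h, h'⟩)
  · exact Or.inr (Or.inr h')

theorem ratFrac_lt_ratFrac_succ (w : World B) (a n : El B .nat) :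
    w ⊩ ratLt (ratFrac a n) (ratFrac (a + 1) n) := by
  rw [forces_ratLt]
  simp only [ratFrac, fst_pair, snd_pair, map_add, map_one, map_zero]
  simpa using mul_lt_mul_of_pos_right (lt_add_one (num w a)) (Num.add_one_pos (num w n))

/-- Inequality in the unit interval is inhabitedness of a detachable set of natural numbers with at
most one element. -/
theorem exists_isUniqAt_realNe_iff {x y : El B realTy} (hx : w ⊩ mem x unitInterval)
    (hy : w ⊩ mem y unitInterval) :
    ∃ A : El B (.pow .nat), ∀ᶠ v in near w, IsUniqAt v A ∧
      ((v ⊩ realNe x y) ↔ (v ⊩ inhabited A)) := by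
  rw [forces_mem_unitInterval] at hx hy
  -- T n a excludes that a/(n+1) and (a+1)/(n+1) both lie between x and y, in either order. For each
  -- n one chooses between x ≠ y and T n a for all a < n. If x ≠ y, some such grid interval does
  -- separate the points, and then the second alternative is impossible.
  let T : El B .nat → El B .nat → Om B := fun n a =>
    (lo x (ratFrac a n) ⊔ hi y (ratFrac (a + 1) n)) ⊓
      (lo y (ratFrac a n) ⊔ hi x (ratFrac (a + 1) n))
  have hT : ∀ {v : World B} {n a}, (v ⊩ T n a) ↔
      ((v ⊩ lo x (ratFrac a n)) ∨ (v ⊩ hi y (ratFrac (a + 1) n))) ∧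
      ((v ⊩ lo y (ratFrac a n)) ∨ (v ⊩ hi x (ratFrac (a + 1) n))) := by
    intro v n a; simp only [T, forces_inf, forces_sup]
  have hT₁ : Dfn fun p : El B (.prod .nat .nat) => T p.fst p.snd := by
    unfold T ratFrac; infer_instance
  have hT₂ : ∀ n, Dfn (T n) := by
    intro n; unfold T ratFrac; infer_instance
  obtain ⟨A, hA⟩ := exists_decision (w := w) (f := fun _ => realNe x y)
    (g := fun n => fal fun a => natLt a n ⇨ T n a) (by
      filter_upwards [near_near hx, near_near hy] with v hx hy n
      refine forces_or_forall_lt ?_ n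
      filter_upwards [hx, hy] with v hx hy a
      have h := ratFrac_lt_ratFrac_succ v a n
      rw [forces_realNe, hT]
      obtain h₁ | h₁ := realLt_or hx.1 hy.1 h
      · exact Or.inl (Or.inl h₁)
      obtain h₂ | h₂ := realLt_or hy.1 hx.1 h
      · exact Or.inl (Or.inr h₂)
      exact Or.inr ⟨h₁, h₂⟩)
  have hdec : ∀ᶠ v in near w, ∀ n, (v ⊩ mem n A) ∨ (v ⊩ (mem n A)ᶜ) :=
    hA.mono fun v h n => (h n).imp And.left And.left
  refine ⟨least A, ?_⟩
  filter_upwards [hx, hy, near_near hdec, hA] with v hx hy hdec hA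
  refine ⟨isUniqAt_least hdec, ?_⟩
  rw [forces_inhabited, inhabited_least_iff hdec]
  constructor
  · have key : ∀ {x y : El B realTy}, IsRealAt v x → ¬ (v ⊩ hi x ratZero) → IsRealAt v y →
        ¬ (v ⊩ lo y ratOne) → (v ⊩ realLt x y) → ∃ n a : El B .nat, num v a < num v n ∧
          (v ⊩ hi x (ratFrac a n)) ∧ (v ⊩ lo y (ratFrac (a + 1) n)) := by
      intro x y hx h₀ hy h₁ h
      obtain ⟨p, hp, hp'⟩ := forces_realLt.1 h
      obtain ⟨r, hr, hr'⟩ := hy.exists_gt hp'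
      obtain ⟨p', hp', hxp⟩ := hx.exists_lt hp
      obtain ⟨a, n, ha, ha'⟩ := exists_ratFrac ((ratLt_or_ratLt hp' ratZero).resolve_left fun h =>
        h₀ (hx.hi_of_lt h hxp)) hr
      -- Since y is at most 1, (a+1)/(n+1) < 1, so that a < n and the bounded quantifier covers a.
      have ha₁ := (ratLt_or_ratLt ha' ratOne).resolve_right fun h => h₁ (hy.lo_of_lt h hr')
      refine ⟨n, a, ?_, hx.hi_of_lt ha hp, hy.lo_of_lt ha' hr'⟩
      rw [forces_ratLt] at ha₁
      simp only [ratFrac, ratOne, fst_pair, snd_pair, map_add, map_one, map_zero, zero_mul,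
        add_zero, zero_add, one_mul, mul_one] at ha₁
      exact lt_of_add_lt_add_right ha₁
    intro h
    rw [forces_realNe] at h
    obtain h | h := h
    · obtain ⟨n, a, ha, hxa, hya⟩ := key hx.1 hx.2.1 hy.1 hy.2.2 h
      refine ⟨n, ((hA n).resolve_right fun h => ?_).1⟩
      obtain h | h := (hT.1 ((h.2.all a).mp (forces_natLt.2 ha))).1
      · exact hx.1.disjoint h hxa
      · exact hy.1.disjoint hya h
    · obtain ⟨n, a, ha, hya, hxa⟩ := key hy.1 hy.2.1 hx.1 hx.2.2 h
      refine ⟨n, ((hA n).resolve_right fun h => ?_).1⟩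
      obtain h | h := (hT.1 ((h.2.all a).mp (forces_natLt.2 ha))).2
      · exact hy.1.disjoint h hya
      · exact hx.1.disjoint hxa h
  · rintro ⟨n, hn⟩
    exact ((hA n).resolve_right fun h => h.1.false hn).2

/-- The real number that is `x` if `P` and `y` if `Q`. -/
noncomputable def glueReal (P Q : Om B) (x y : El B realTy) : El B realTy :=
  pair (compr fun q => (lo x q ⊓ lo y q) ⊔ ((P ⊓ lo x q) ⊔ (Q ⊓ lo y q)))
    (compr fun q => (hi x q ⊓ hi y q) ⊔ ((P ⊓ hi x q) ⊔ (Q ⊓ hi y q)))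

section
variable {P Q : Om B} {x y : El B realTy} {q : El B ratTy}

theorem lo_glueReal : (w ⊩ lo (glueReal P Q x y) q) ↔ (w ⊩ lo x q) ∧ (w ⊩ lo y q) ∨
    (w ⊩ P) ∧ (w ⊩ lo x q) ∨ (w ⊩ Q) ∧ (w ⊩ lo y q) := by
  simp only [glueReal, lo_pair, mem_compr, forces_sup, forces_inf]

theorem hi_glueReal : (w ⊩ hi (glueReal P Q x y) q) ↔ (w ⊩ hi x q) ∧ (w ⊩ hi y q) ∨
    (w ⊩ P) ∧ (w ⊩ hi x q) ∨ (w ⊩ Q) ∧ (w ⊩ hi y q) := by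
  simp only [glueReal, hi_pair, mem_compr, forces_sup, forces_inf]

/-- Only locatedness needs P ∨ Q. If x and y fall on different sides of an interval, its two halves
at a rational s show that they can be put on the same side or that s separates them; then x ≠ y, and
P or Q selects one of the two. -/
theorem IsRealAt.glueReal (hx : IsRealAt w x) (hy : IsRealAt w y) (hPQ : (w ⊩ P) → ¬ (w ⊩ Q))
    (h : (w ⊩ realNe x y) → (w ⊩ P) ∨ (w ⊩ Q)) : IsRealAt w (glueReal P Q x y) := by
  constructor <;> simp only [lo_glueReal, hi_glueReal]
  · obtain ⟨p, hp⟩ := hx.exists_lo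
    obtain ⟨q, hq⟩ := hy.exists_lo
    obtain ⟨r, hr⟩ := exists_ratLt w p
    obtain h | h := ratLt_or_ratLt hr q
    · exact ⟨r, Or.inl ⟨hx.lo_of_lt hr hp, hy.lo_of_lt h hq⟩⟩
    · exact ⟨q, Or.inl ⟨hx.lo_of_lt h hp, hq⟩⟩
  · obtain ⟨p, hp⟩ := hx.exists_hi
    obtain ⟨q, hq⟩ := hy.exists_hi
    obtain ⟨r, hr⟩ := exists_ratGt w p
    obtain h | h := ratLt_or_ratLt hr q
    · exact ⟨q, Or.inl ⟨hx.hi_of_lt h hp, hq⟩⟩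
    · exact ⟨r, Or.inl ⟨hx.hi_of_lt hr hp, hy.hi_of_lt h hq⟩⟩
  · exact fun h => Or.imp (And.imp (hx.lo_of_lt h) (hy.lo_of_lt h))
      (Or.imp (And.imp_right (hx.lo_of_lt h)) (And.imp_right (hy.lo_of_lt h)))
  · rintro q (⟨h, h'⟩ | ⟨hP, h⟩ | ⟨hQ, h⟩)
    · obtain ⟨r, hr, hxr⟩ := hx.exists_gt h
      obtain ⟨r', hr', hyr⟩ := hy.exists_gt h'
      obtain ⟨s, hs, hs'⟩ := exists_ratLt_ratLt hr
      obtain h | h := ratLt_or_ratLt hs' r'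
      · exact ⟨s, hs, Or.inl ⟨hx.lo_of_lt hs' hxr, hy.lo_of_lt h hyr⟩⟩
      · exact ⟨r', hr', Or.inl ⟨hx.lo_of_lt h hxr, hyr⟩⟩
    · exact (hx.exists_gt h).imp fun _ h => ⟨h.1, Or.inr (Or.inl ⟨hP, h.2⟩)⟩
    · exact (hy.exists_gt h).imp fun _ h => ⟨h.1, Or.inr (Or.inr ⟨hQ, h.2⟩)⟩
  · exact fun h => Or.imp (And.imp (hx.hi_of_lt h) (hy.hi_of_lt h))
      (Or.imp (And.imp_right (hx.hi_of_lt h)) (And.imp_right (hy.hi_of_lt h)))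
  · rintro q (⟨h, h'⟩ | ⟨hP, h⟩ | ⟨hQ, h⟩)
    · obtain ⟨r, hr, hxr⟩ := hx.exists_lt h
      obtain ⟨r', hr', hyr⟩ := hy.exists_lt h'
      obtain ⟨s, hs, hs'⟩ := exists_ratLt_ratLt hr
      obtain h | h := ratLt_or_ratLt hs r'
      · exact ⟨r', hr', Or.inl ⟨hx.hi_of_lt h hxr, hyr⟩⟩
      · exact ⟨s, hs', Or.inl ⟨hx.hi_of_lt hs hxr, hy.hi_of_lt h hyr⟩⟩
    · exact (hx.exists_lt h).imp fun _ h => ⟨h.1, Or.inr (Or.inl ⟨hP, h.2⟩)⟩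
    · exact (hy.exists_lt h).imp fun _ h => ⟨h.1, Or.inr (Or.inr ⟨hQ, h.2⟩)⟩
  · rintro q (⟨h, h'⟩ | ⟨hP, h⟩ | ⟨hQ, h⟩) (⟨k, k'⟩ | ⟨hP', k⟩ | ⟨hQ', k⟩)
    · exact hx.disjoint h k
    · exact hx.disjoint h k
    · exact hy.disjoint h' k
    · exact hx.disjoint h k
    · exact hx.disjoint h k
    · exact hPQ hP hQ'
    · exact hy.disjoint h k'
    · exact hPQ hP' hQ
    · exact hy.disjoint h k
  · intro q r hqr
    obtain ⟨s, hs, hs'⟩ := exists_ratLt_ratLt hqr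
    have ne : (w ⊩ realNe x y) → ((w ⊩ lo x q) ∨ (w ⊩ hi x r)) → ((w ⊩ lo y q) ∨ (w ⊩ hi y r)) →
        ((w ⊩ lo x q) ∧ (w ⊩ lo y q) ∨ (w ⊩ P) ∧ (w ⊩ lo x q) ∨ (w ⊩ Q) ∧ (w ⊩ lo y q)) ∨
        ((w ⊩ hi x r) ∧ (w ⊩ hi y r) ∨ (w ⊩ P) ∧ (w ⊩ hi x r) ∨ (w ⊩ Q) ∧ (w ⊩ hi y r)) := by
      have := @h
      tauto
    have hx' := hx.located hqr
    have hy' := hy.located hqr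
    obtain h₁ | h₁ := hx'
    · obtain h₂ | h₂ := hy'
      · exact Or.inl (Or.inl ⟨h₁, h₂⟩)
      · obtain h₃ | h₃ := hx.located hs'
        · obtain h₄ | h₄ := hy.located hs
          · exact Or.inl (Or.inl ⟨h₁, h₄⟩)
          · exact ne (forces_realNe.2 (Or.inr (forces_realLt.2 ⟨s, h₄, h₃⟩))) (Or.inl h₁)
              (Or.inr h₂)
        · exact Or.inr (Or.inl ⟨h₃, h₂⟩)
    · obtain h₂ | h₂ := hy'
      · obtain h₃ | h₃ := hx.located hs
        · exact Or.inl (Or.inl ⟨h₃, h₂⟩)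
        · obtain h₄ | h₄ := hy.located hs'
          · exact ne (forces_realNe.2 (Or.inl (forces_realLt.2 ⟨s, h₃, h₄⟩))) (Or.inr h₁)
              (Or.inl h₂)
          · exact Or.inr (Or.inl ⟨h₁, h₄⟩)
      · exact Or.inr (Or.inl ⟨h₁, h₂⟩)

theorem glueReal_eq_left (hPQ : w ⊩ (P ⊓ Q)ᶜ) : w ⊩ P ⇨ El.eq (glueReal P Q x y) x := by
  rw [forces_himp]
  filter_upwards [near_near hPQ.near] with v hPQ hP
  refine eq_of_near_lo_hi_iff ?_
  filter_upwards [hP.near, hPQ] with u hP hPQ q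
  have hQ : ¬ (u ⊩ Q) := fun hQ => hPQ.false (forces_inf.2 ⟨hP, hQ⟩)
  rw [lo_glueReal, hi_glueReal]
  tauto

theorem glueReal_eq_right (hPQ : w ⊩ (P ⊓ Q)ᶜ) : w ⊩ Q ⇨ El.eq (glueReal P Q x y) y := by
  rw [forces_himp]
  filter_upwards [near_near hPQ.near] with v hPQ hQ
  refine eq_of_near_lo_hi_iff ?_
  filter_upwards [hQ.near, hPQ] with u hQ hPQ q
  have hP : ¬ (u ⊩ P) := fun hP => hPQ.false (forces_inf.2 ⟨hP, hQ⟩)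
  rw [lo_glueReal, hi_glueReal]
  tauto

end

end

end El

theorem forces_mem_realNeSet {w : World B} {Γ : Ctx} {ρ : Env B Γ} {x y : El B realTy} :
    (w ⊩ mem (pair x y) (ev realNeSet ρ)) ↔ (w ⊩ El.realNe x y) := by
  simp only [realNeSet, mem_ev_compr, ev_realNe, ev_fst, ev_snd, ev_var_zero, fst_pair, snd_pair]

theorem forces_seUnitInterval {w : World []} : (w ⊩ ev SEUnitInterval Env.nil) ↔
    ∀ᶠ v in near w, ∀ F, (v ⊩ isFun El.unitInterval El.reals F) → ∀ x y a b,
      (v ⊩ mem (pair x a) F) → (v ⊩ mem (pair y b) F) → (v ⊩ El.realNe a b) →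
        (v ⊩ El.realNe x y) := by
  simp only [SEUnitInterval, forces_allStronglyExtensional, ev_unitInterval, forces_mem_realNeSet]

theorem seUnitInterval_of_wmpAt {w : World []} (hw : WMPAt w) :
    w ⊩ ev SEUnitInterval Env.nil := by
  rw [forces_seUnitInterval]
  filter_upwards [near_near hw] with w hw F hF x y a b hxa hyb hab
  have hx := hF.isFunAt.dom hxa
  have hy := hF.isFunAt.dom hyb
  obtain ⟨A, hA⟩ := exists_isUniqAt_realNe_iff hx hy
  have hx' := forces_mem_unitInterval.1 hx
  have hy' := forces_mem_unitInterval.1 hy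
  refine (near_self hA).2.2 (forces_inhabited_of_wmpAt hw hF hxa hyb hab
    (hA.mono fun _ => And.left) ?_ ?_)
  · rw [forces_himp]
    filter_upwards [near_near hA, near_near hx', near_near hy'] with v hA hx hy h
    refine eq_of_realLe_of_realLe (forces_isReal.2 (hx.mono fun _ => And.left))
      (forces_isReal.2 (hy.mono fun _ => And.left)) ?_ ?_
    · filter_upwards [hA, h.near] with u hA h h'
      exact h.false (hA.2.1 (forces_realNe.2 (Or.inl h')))
    · filter_upwards [hA, h.near] with u hA h h'
      exact h.false (hA.2.1 (forces_realNe.2 (Or.inr h')))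
  · filter_upwards [near_near hA, near_near hx', near_near hy'] with v hA hx hy P Q hPQ hφ
    refine ⟨glueReal P Q x y, forces_mem_unitInterval.2 ?_, glueReal_eq_left hPQ,
      glueReal_eq_right hPQ⟩
    filter_upwards [hA, hx, hy, hφ.near, hPQ.near] with u hA hx hy hφ hPQ
    refine ⟨hx.1.glueReal hy.1 (fun hP hQ => hPQ.false (forces_inf.2 ⟨hP, hQ⟩)) fun h =>
      forces_sup.1 (hφ.mp (hA.2.1 h)), ?_, ?_⟩
    · rw [hi_glueReal]; tauto
    · rw [lo_glueReal]; tauto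

/-! ### From functions on the unit interval to weak Markov's principle -/

namespace El

section
variable {w : World B} {A : El B (.pow .nat)} {y : El B realTy} {q : El B ratTy}

/-- The real number `min 1 ((n + 1) * y)` for the element `n` of `A`. -/
noncomputable def scale (A : El B (.pow .nat)) (y : El B realTy) : El B realTy :=
  pair (compr fun q => exi fun r => ratLt q r ⊓ (ratLt r ratOne ⊓
      (exi fun n => mem n A ⊓ lo y (ratDiv r n))ᶜᶜ))
    (compr fun q => exi fun r => ratLt r q ⊓ (ratLt ratOne r ⊔
      (exi fun n => mem n A ⊓ hi y (ratDiv r n))ᶜᶜ))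

theorem lo_scale : (w ⊩ lo (scale A y) q) ↔ ∃ r, (w ⊩ ratLt q r) ∧ (w ⊩ ratLt r ratOne) ∧
    (w ⊩ (exi fun n => mem n A ⊓ lo y (ratDiv r n))ᶜᶜ) := by
  simp only [scale, lo_pair, mem_compr, forces_exi, forces_inf]

theorem hi_scale : (w ⊩ hi (scale A y) q) ↔ ∃ r, (w ⊩ ratLt r q) ∧ ((w ⊩ ratLt ratOne r) ∨
    (w ⊩ (exi fun n => mem n A ⊓ hi y (ratDiv r n))ᶜᶜ)) := by
  simp only [scale, hi_pair, mem_compr, forces_exi, forces_inf, forces_sup]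

/-- The cuts speak about the element of `A` under double negation, so it need not be known.
Locatedness compares y with s/(n+1) and t/(n+1) at that element by `split_or`. -/
theorem isReal_scale (hA : ∀ᶠ v in near w, IsUniqAt v A) (hs : w ⊩ split (inhabited A))
    (hy : w ⊩ mem y unitInterval) : w ⊩ isReal (scale A y) := by
  rw [forces_isReal]
  rw [forces_mem_unitInterval] at hy
  filter_upwards [near_near hA, hs.near, near_near hy] with w hA hs hy
  constructor <;> simp only [lo_scale, hi_scale]
  · obtain ⟨r, hr⟩ := exists_ratLt w ratZero
    obtain ⟨q, hq⟩ := exists_ratLt w r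
    refine ⟨q, r, hq, ratLt_trans hr (ratZero_lt_ratOne _),
      (compl_compl_of_split hs).compl_compl_mono ?_⟩
    filter_upwards [hy, hr.near] with v hy hr h
    obtain ⟨n, hn⟩ := forces_inhabited.1 h
    simp only [forces_exi, forces_inf]
    exact ⟨n, hn, (hy.1.located (ratDiv_lt_ratZero_iff.2 hr)).resolve_right hy.2.1⟩
  · obtain ⟨r, hr⟩ := exists_ratGt w ratOne
    obtain ⟨q, hq⟩ := exists_ratGt w r
    exact ⟨q, r, hq, Or.inl hr⟩
  · rintro q r h ⟨s, hs, h'⟩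
    exact ⟨s, ratLt_trans h hs, h'⟩
  · rintro q ⟨r, hr, h⟩
    exact (exists_ratLt_ratLt hr).imp fun _ h' => ⟨h'.1, r, h'.2, h⟩
  · rintro q r h ⟨s, hs, h'⟩
    exact ⟨s, ratLt_trans hs h, h'⟩
  · rintro q ⟨r, hr, h⟩
    exact (exists_ratLt_ratLt hr).imp fun _ h' => ⟨h'.2, r, h'.1, h⟩
  · rintro q ⟨r, hr, hr₁, h⟩ ⟨s, hs, h' | h'⟩
    · exact ratLt_asymm (ratLt_trans h' hs) (ratLt_trans hr hr₁)
    · refine false_of_compl_compl h h' ?_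
      filter_upwards [hA, hy, (ratLt_trans hs hr).near] with v hA hy hsr h h'
      simp only [forces_exi, forces_inf] at h h'
      obtain ⟨m, hm, hm'⟩ := h
      obtain ⟨n, hn, hn'⟩ := h'
      have := (hA.uniq hn hm).subst (fun n => hi y (ratDiv s n)) hn'
      exact hy.1.disjoint hm' (hy.1.hi_of_lt (ratDiv_lt_ratDiv hsr) this)
  · intro q r h
    obtain ⟨s, hqs, hsr⟩ := exists_ratLt_ratLt h
    obtain ⟨t, hst, htr⟩ := exists_ratLt_ratLt hsr
    -- The truncation at 1: either s < 1 and the comparison with y decides, or 1 < t and r is above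
    -- the minimum in any case.
    obtain h | h := ratLt_or_ratLt hst ratOne
    · refine (split_or (f := fun n => lo y (ratDiv s n)) (g := fun n => hi y (ratDiv t n))
        hA hs ?_).imp (fun h' => ⟨s, hqs, h, h'⟩) fun h' => ⟨t, htr, Or.inr h'⟩
      filter_upwards [hy, hst.near] with v hy hst n _
      exact hy.1.located (ratDiv_lt_ratDiv hst)
    · exact Or.inr ⟨t, htr, Or.inl h⟩

theorem elemReal_mem_unitInterval (hA : ∀ᶠ v in near w, IsUniqAt v A) :
    w ⊩ mem (elemReal A) unitInterval := by
  rw [forces_mem_unitInterval]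
  filter_upwards [near_near hA] with v hA
  refine ⟨(isReal_elemReal hA).isRealAt, ?_, ?_⟩
  · rw [hi_elemReal]
    rintro ⟨n, -, h⟩
    exact ratLt_asymm h (ratZero_lt_ratInv _ _)
  · rw [lo_elemReal]
    rintro (h | ⟨n, -, h⟩)
    · exact ratLt_asymm h (ratZero_lt_ratOne _)
    · refine ratInv_le_ratInv (m := 0) (n := n) ?_ h
      rw [map_zero]
      exact Num.zero_le _

theorem zero_mem_unitInterval (w : World B) : w ⊩ mem (ofRat ratZero) unitInterval := by
  rw [forces_mem_unitInterval]
  refine near_of_forall fun v => ⟨(isReal_ofRat _ _).isRealAt, ?_, ?_⟩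
  · rw [hi_ofRat]; exact ratLt_irrefl
  · rw [lo_ofRat]; exact ratLt_asymm (ratZero_lt_ratOne _)

/-- Up to double negation the values are 0 and 1, so rationals 0 < s < q < r < 1 place q strictly
between them. -/
theorem scale_zero_lt (hs : w ⊩ split (inhabited A)) :
    w ⊩ realLt (scale A (ofRat ratZero)) (scale A (elemReal A)) := by
  obtain ⟨q, hq, hq'⟩ := exists_ratLt_ratLt (ratZero_lt_ratOne w)
  obtain ⟨s, hs', hsq⟩ := exists_ratLt_ratLt hq
  obtain ⟨r, hr, hr'⟩ := exists_ratLt_ratLt hq'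
  refine forces_realLt.2 ⟨q, hi_scale.2 ⟨s, hsq, Or.inr ?_⟩, lo_scale.2 ⟨r, hr, hr', ?_⟩⟩
  · refine (compl_compl_of_split hs).compl_compl_mono ?_
    filter_upwards [hs'.near] with v hs' h
    obtain ⟨n, hn⟩ := forces_inhabited.1 h
    simp only [forces_exi, forces_inf, hi_ofRat]
    exact ⟨n, hn, ratZero_lt_ratDiv_iff.2 hs'⟩
  · refine (compl_compl_of_split hs).compl_compl_mono ?_
    filter_upwards [hr'.near] with v hr h
    obtain ⟨n, hn⟩ := forces_inhabited.1 h
    simp only [forces_exi, forces_inf, lo_elemReal]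
    refine ⟨n, hn, Or.inr ⟨n, hn, ?_⟩⟩
    rw [← ratDiv_ratOne]
    exact ratDiv_lt_ratDiv hr

end

end El

theorem wmpAt_of_seUnitInterval {w : World []} (h : w ⊩ ev SEUnitInterval Env.nil) : WMPAt w := by
  filter_upwards [forces_seUnitInterval.1 h] with w h A hA hs
  have hd : Dfn (scale A) := by unfold scale; infer_instance
  have hd' : Dfn fun p : El [] (.prod realTy realTy) => scale A p.fst := Dfn.comp _ _
  let F : El [] (.pow (.prod realTy realTy)) := compr fun p =>
    mem p.fst El.unitInterval ⊓ El.eq p.snd (scale A p.fst)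
  have hF : ∀ {v : World []} {x a}, (v ⊩ mem (pair x a) F) ↔
      (v ⊩ mem x El.unitInterval) ∧ (v ⊩ El.eq a (scale A x)) := by
    intro v x a; simp only [F, mem_compr, forces_inf, fst_pair, snd_pair]
  have hne := h F ?_ (elemReal A) (El.ofRat El.ratZero) (scale A (elemReal A))
    (scale A (El.ofRat El.ratZero)) (hF.2 ⟨elemReal_mem_unitInterval hA, forces_eq_refl _ _⟩)
    (hF.2 ⟨zero_mem_unitInterval w, forces_eq_refl _ _⟩)
    (forces_realNe.2 (Or.inr (scale_zero_lt hs)))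
  · obtain h | h := forces_realNe.1 hne
    · have hx := (near_self (forces_mem_unitInterval.1 (elemReal_mem_unitInterval hA)))
      exact (hx.2.1 ((realLt_ofRat_right hx.1).1 h)).elim
    · exact (elemReal_pos_iff hA).1 h
  · rw [forces_isFun]
    filter_upwards [near_near hA, hs.near] with v hA hs
    constructor
    · exact fun h => (hF.1 h).1
    · intro x a h
      rw [hF] at h
      exact forces_mem_reals.2 (h.2.symm.subst El.isReal (isReal_scale hA hs h.1))
    · exact fun h => ⟨_, hF.2 ⟨h, forces_eq_refl _ _⟩⟩
    · exact fun h h' => (hF.1 h).2.trans (hF.1 h').2.symm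

theorem equivalent_wmp_seUnitInterval : Equivalent {WMP} {SEUnitInterval} := by
  refine ⟨fun φ hφ => ?_, fun φ hφ => ?_⟩
  · rw [Set.mem_singleton_iff.1 hφ]
    exact derives_sentence_of_forces fun w h => seUnitInterval_of_wmpAt (wmpAt_of_forces h)
  · rw [Set.mem_singleton_iff.1 hφ]
    exact derives_sentence_of_forces fun w h => forces_wmp_of_wmpAt (wmpAt_of_seUnitInterval h)

end BISH

namespace BISH

open El

variable {B : Ctx}

/-! ### Metric spaces -/

namespace El

section
variable {w : World B} {p p' q q' : El B ratTy}

theorem ratAdd_lt_ratAdd (h : w ⊩ ratLt p p') (h' : w ⊩ ratLt q q') :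
    w ⊩ ratLt (ratAdd p q) (ratAdd p' q') := by
  rw [forces_ratLt] at *
  have hp := Num.add_one_pos (num w p.snd)
  have hp' := Num.add_one_pos (num w p'.snd)
  have hq := Num.add_one_pos (num w q.snd)
  have hq' := Num.add_one_pos (num w q'.snd)
  simp only [ratAdd, fst_pair, snd_pair, map_add, map_mul, map_one]
  have := add_lt_add (mul_lt_mul_of_pos_right h (mul_pos hq hq'))
    (mul_lt_mul_of_pos_right h' (mul_pos hp hp'))
  convert this using 1 <;> ring

theorem exists_ratAdd_self_lt (h : w ⊩ ratLt ratZero p) :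
    ∃ q, (w ⊩ ratLt ratZero q) ∧ (w ⊩ ratLt (ratAdd q q) p) := by
  -- One third of `p`.
  refine ⟨ratDiv p (1 + 1), ratZero_lt_ratDiv_iff.2 h, ?_⟩
  rw [ratZero_lt_iff, Num.lt_def] at h
  obtain ⟨z, hz⟩ := h
  rw [forces_ratLt, Num.lt_def]
  simp only [ratAdd, ratDiv, fst_pair, snd_pair, map_add, map_mul, map_one, ← hz]
  generalize num w p.snd = c
  exact ⟨3 * z * (c + 1) * (c + 1) + (3 * c * c + 6 * c + 2), by ring⟩

end

section
variable {σ : Ty}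

/-- The type of graphs of functions of two variables in `σ` with real values. -/
abbrev distTy (σ : Ty) : Ty := .pow (.prod (.prod σ σ) realTy)

/-- `d(x, y) < ε` in the world `w`. -/
def DistLt (w : World B) (D : El B (distTy σ)) (x y : El B σ) (ε : El B ratTy) : Prop :=
  ∃ r, (w ⊩ mem (pair (pair x y) r) D) ∧ (w ⊩ realLt r (ofRat ε))

/-- `D` is a metric on `X` in the world `w`. -/
structure IsMetricAt (w : World B) (X : El B (.pow σ)) (D : El B (distTy σ)) : Prop where
  left_mem : ∀ {x y r}, (w ⊩ mem (pair (pair x y) r) D) → (w ⊩ mem x X)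
  right_mem : ∀ {x y r}, (w ⊩ mem (pair (pair x y) r) D) → (w ⊩ mem y X)
  real : ∀ {x y r}, (w ⊩ mem (pair (pair x y) r) D) → (w ⊩ isReal r)
  total : ∀ {x y}, (w ⊩ mem x X) → (w ⊩ mem y X) → ∃ r, w ⊩ mem (pair (pair x y) r) D
  unique : ∀ {x y r s}, (w ⊩ mem (pair (pair x y) r) D) → (w ⊩ mem (pair (pair x y) s) D) →
    (w ⊩ El.eq r s)
  nonneg : ∀ {x y r}, (w ⊩ mem (pair (pair x y) r) D) → ¬ (w ⊩ realLt r (ofRat ratZero))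
  eq_of_zero : ∀ {x y r}, (w ⊩ mem (pair (pair x y) r) D) → (w ⊩ El.eq r (ofRat ratZero)) →
    (w ⊩ El.eq x y)
  zero_of_eq : ∀ {x y r}, (w ⊩ mem (pair (pair x y) r) D) → (w ⊩ El.eq x y) →
    (w ⊩ El.eq r (ofRat ratZero))
  symm : ∀ {x y r}, (w ⊩ mem (pair (pair x y) r) D) → (w ⊩ mem (pair (pair y x) r) D)
  triangle : ∀ {x y z r s t}, (w ⊩ mem (pair (pair x y) r) D) → (w ⊩ mem (pair (pair y z) s) D) →
    (w ⊩ mem (pair (pair x z) t) D) → ¬ (w ⊩ realLt (realAdd r s) t)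

/-- The sequence `S` is Cauchy. -/
def CauchyAt (w : World B) (D : El B (distTy σ)) (S : El B (.pow (.prod .nat σ))) : Prop :=
  ∀ᶠ v in near w, ∀ ε, (v ⊩ ratLt ratZero ε) → ∃ k, ∀ᶠ u in near v, ∀ m n,
    num u k ≤ num u m → num u k ≤ num u n → ∀ x y, (u ⊩ mem (pair m x) S) →
      (u ⊩ mem (pair n y) S) → DistLt u D x y ε

/-- The sequence `S` converges to `l`. -/
def ConvAt (w : World B) (D : El B (distTy σ)) (S : El B (.pow (.prod .nat σ))) (l : El B σ) :
    Prop :=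
  ∀ᶠ v in near w, ∀ ε, (v ⊩ ratLt ratZero ε) → ∃ k, ∀ᶠ u in near v, ∀ n,
    num u k ≤ num u n → ∀ x, (u ⊩ mem (pair n x) S) → DistLt u D x l ε

end

end El

section
variable {σ : Ty} {w : World B} {Γ : Ctx} {ρ : Env B Γ} {X : Tm Γ (.pow σ)} {D : Tm Γ (distTy σ)}
  {S : Tm Γ (.pow (.prod .nat σ))}

theorem forces_distLt {x y : Tm Γ σ} {ε : Tm Γ ratTy} :
    (w ⊩ ev (distLt D x y ε) ρ) ↔ DistLt w (ev D ρ) (ev x ρ) (ev y ρ) (ev ε ρ) := by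
  simp only [distLt, forces_ev_ex, ev_and, ev_mem, ev_pair, ev_w, ev_var_zero, ev_realLt, ev_ofRat,
    forces_inf, DistLt]

theorem forces_mem_metricNeSet {x y : El B σ} : (w ⊩ mem (pair x y) (ev (metricNeSet D) ρ)) ↔
    ∃ r, (w ⊩ mem (pair (pair x y) r) (ev D ρ)) ∧ (w ⊩ El.realLt (El.ofRat El.ratZero) r) := by
  simp only [metricNeSet, mem_ev_compr, forces_ev_ex, ev_and, ev_mem, ev_pair, ev_w, ev_var_zero,
    ev_realLt, ev_ofRat, ev_ratZero, forces_inf]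

variable [Inh B σ]

theorem forces_isMetric :
    (w ⊩ ev (IsMetric X D) ρ) ↔ ∀ᶠ v in near w, IsMetricAt v (ev X ρ) (ev D ρ) := by
  simp only [IsMetric, ev_and, forces_inf, ev_isFun, ev_times, ev_reals, forces_isFun,
    forces_ev_all, ev_imp, ev_mem, ev_pair, ev_w, ev_var_zero, ev_realLe, ev_ofRat, ev_ratZero,
    ev_eq, ev_realAdd, forces_himp, near_forall_near, near_imp_near, near_and_near,
    forces_realLe]
  generalize ev X ρ = Y
  generalize ev D ρ = E
  constructor
  · intro h
    filter_upwards [h] with v ⟨hf, h, ht⟩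
    have mem : ∀ {x y r}, (v ⊩ mem (pair (pair x y) r) E) → (v ⊩ mem x Y) ∧
        (v ⊩ mem y Y) := fun h => by
      simpa only [El.times, mem_compr, forces_inf, fst_pair, snd_pair] using hf.dom h
    refine ⟨fun h => (mem h).1, fun h => (mem h).2, fun h => forces_mem_reals.1 (hf.cod h), ?_,
      hf.unique, fun h' => near_self (h _ _ _ h').1, fun h' => (near_self (h _ _ _ h').2.1).1,
      fun h' => (near_self (h _ _ _ h').2.1).2, fun h' => (h _ _ _ h').2.2, ht _ _ _ _ _ _⟩
    refine fun hx hy => hf.total ?_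
    rw [El.times, mem_compr, forces_inf, fst_pair, snd_pair]
    exact ⟨hx, hy⟩
  · intro h
    filter_upwards [near_near h] with v h
    have h' := near_self h
    refine ⟨⟨?_, ?_, ?_, ?_⟩, ?_, fun x y z r s t => h'.triangle⟩
    · intro p r hp
      rw [← pair_fst_snd p] at hp ⊢
      rw [El.times, mem_compr, forces_inf, fst_pair, snd_pair]
      exact ⟨h'.left_mem hp, h'.right_mem hp⟩
    · intro p r hp
      rw [← pair_fst_snd p] at hp
      exact forces_mem_reals.2 (h'.real hp)
    · intro p hp
      rw [El.times, mem_compr, forces_inf] at hp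
      rw [← pair_fst_snd p]
      exact h'.total hp.1 hp.2
    · intro p r s hr hs
      rw [← pair_fst_snd p] at hr hs
      exact h'.unique hr hs
    · intro x y r hr
      refine ⟨?_, ?_, h'.symm hr⟩
      · filter_upwards [h, hr.near] with u h hr using h.nonneg hr
      · filter_upwards [h, hr.near] with u h hr using ⟨h.eq_of_zero hr, h.zero_of_eq hr⟩

theorem forces_isCauchy : (w ⊩ ev (IsCauchy D S) ρ) ↔ CauchyAt w (ev D ρ) (ev S ρ) := by
  simp only [IsCauchy, CauchyAt, forces_ev_all, forces_ev_ex, ev_imp, ev_mem, ev_pair, ev_w,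
    ev_var_zero, ev_ratLt, ev_ratZero, ev_natLe, forces_himp, near_forall_near, near_imp_near,
    forces_distLt]
  simp only [forces_natLe]

theorem forces_convergesTo {l : Tm Γ σ} :
    (w ⊩ ev (ConvergesTo D S l) ρ) ↔ ConvAt w (ev D ρ) (ev S ρ) (ev l ρ) := by
  simp only [ConvergesTo, ConvAt, forces_ev_all, forces_ev_ex, ev_imp, ev_mem, ev_pair, ev_w,
    ev_var_zero, ev_ratLt, ev_ratZero, ev_natLe, forces_himp, near_forall_near, near_imp_near,
    forces_distLt]
  simp only [forces_natLe]

theorem forces_isCompleteMetric : (w ⊩ ev (IsCompleteMetric X D) ρ) ↔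
    ∀ᶠ v in near w, IsMetricAt v (ev X ρ) (ev D ρ) ∧
      ∀ S, (v ⊩ isFun (El.univ .nat) (ev X ρ) S) → CauchyAt v (ev D ρ) S →
        ∃ l, (v ⊩ mem l (ev X ρ)) ∧ ConvAt v (ev D ρ) S l := by
  simp only [IsCompleteMetric, ev_and, forces_inf, forces_isMetric, forces_ev_all, ev_imp, ev_isFun,
    ev_univ, ev_var_zero, ev_w, forces_himp, forces_ev_ex, ev_mem, near_forall_near,
    near_imp_near, near_and_near, forces_convergesTo, forces_isCauchy]

theorem forces_mem_closurePair {a b : Tm Γ σ} {x : El B σ} :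
    (w ⊩ mem x (ev (closurePair X D a b) ρ)) ↔ (w ⊩ mem x (ev X ρ)) ∧ ∀ᶠ v in near w, ∀ ε,
      (v ⊩ El.ratLt El.ratZero ε) →
        ∃ y, ((v ⊩ El.eq y (ev a ρ)) ∨ (v ⊩ El.eq y (ev b ρ))) ∧ DistLt v (ev D ρ) x y ε := by
  simp only [closurePair, mem_ev_compr, ev_and, ev_mem, ev_var_zero, ev_w, forces_inf,
    forces_ev_all, forces_ev_ex, ev_imp, ev_ratLt, ev_ratZero, ev_or, ev_eq, forces_himp,
    near_forall_near, forces_sup, forces_distLt]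

end

end BISH

/-! ### Limits in complete metric spaces and strong extensionality on closed subsets -/

namespace BISH

open El

variable {B : Ctx}

namespace El

section
variable {σ : Ty} {w : World B} {X : El B (.pow σ)} {D : El B (distTy σ)} {x y z : El B σ}
  {ε δ : El B ratTy}

theorem DistLt.congr (h : DistLt w D x y ε) {x' y' : El B σ} (hx : w ⊩ El.eq x x')
    (hy : w ⊩ El.eq y y') : DistLt w D x' y' ε :=
  h.imp fun r h => ⟨hy.subst (fun y => mem (pair (pair x' y) r) D)
    (hx.subst (fun x => mem (pair (pair x y) r) D) h.1), h.2⟩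

namespace IsMetricAt
variable (hD : IsMetricAt w X D)
include hD

theorem distLt_of_hi {r : El B realTy} (h : w ⊩ mem (pair (pair x y) r) D) (h' : w ⊩ hi r ε) :
    DistLt w D x y ε :=
  ⟨r, h, (realLt_ofRat_right (hD.real h).isRealAt).2 h'⟩

theorem hi_of_distLt {r : El B realTy} (h : w ⊩ mem (pair (pair x y) r) D)
    (h' : DistLt w D x y ε) : w ⊩ hi r ε := by
  obtain ⟨s, hs, h'⟩ := h'
  exact (hD.unique hs h).subst (fun r => hi r ε)
    ((realLt_ofRat_right (hD.real hs).isRealAt).1 h')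

theorem distLt_mono (h : DistLt w D x y ε) (hε : w ⊩ ratLt ε δ) : DistLt w D x y δ := by
  obtain ⟨r, hr, h⟩ := h
  have hr' := (hD.real hr).isRealAt
  exact hD.distLt_of_hi hr (hr'.hi_of_lt hε ((realLt_ofRat_right hr').1 h))

theorem distLt_self (hx : w ⊩ mem x X) (hε : w ⊩ ratLt ratZero ε) : DistLt w D x x ε := by
  obtain ⟨r, hr⟩ := hD.total hx hx
  refine hD.distLt_of_hi hr ((hD.zero_of_eq hr (forces_eq_refl _ _)).symm.subst
    (fun r => hi r ε) ?_)
  rwa [hi_ofRat]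

theorem distLt_symm (h : DistLt w D x y ε) : DistLt w D y x ε :=
  h.imp fun _ h => ⟨hD.symm h.1, h.2⟩

theorem distLt_triangle (h : DistLt w D x y ε) (h' : DistLt w D y z δ) :
    DistLt w D x z (ratAdd ε δ) := by
  obtain ⟨r, hr, h⟩ := h
  obtain ⟨s, hs, h'⟩ := h'
  obtain ⟨t, ht⟩ := hD.total (hD.left_mem hr) (hD.right_mem hs)
  rw [realLt_ofRat_right (hD.real hr).isRealAt] at h
  rw [realLt_ofRat_right (hD.real hs).isRealAt] at h'
  obtain ⟨ε', hε, hr'⟩ := (hD.real hr).isRealAt.exists_lt h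
  obtain ⟨δ', hδ, hs'⟩ := (hD.real hs).isRealAt.exists_lt h'
  obtain ⟨q, hq, hq'⟩ := exists_ratLt_ratLt (ratAdd_lt_ratAdd hε hδ)
  refine hD.distLt_of_hi ht (((hD.real ht).isRealAt.located hq').resolve_left fun h₀ => ?_)
  refine hD.triangle hr hs ht (forces_realLt.2 ⟨q, ?_, h₀⟩)
  simp only [realAdd, hi_pair, mem_compr, forces_exi, forces_inf]
  exact ⟨ε', hr', δ', hs', hq⟩

end IsMetricAt

theorem eq_of_distLt (hD : ∀ᶠ v in near w, IsMetricAt v X D) (hx : w ⊩ mem x X) (hy : w ⊩ mem y X)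
    (h : ∀ᶠ v in near w, ∀ ε, (v ⊩ ratLt ratZero ε) → DistLt v D x y ε) : w ⊩ El.eq x y := by
  have hD' := near_self hD
  obtain ⟨r, hr⟩ := hD'.total hx hy
  refine hD'.eq_of_zero hr (eq_of_realLe_of_realLe (hD'.real hr) (isReal_ofRat _ _) ?_ ?_)
  · filter_upwards [hD, hr.near] with v hD hr using hD.nonneg hr
  · filter_upwards [hD, hr.near, h] with v hD hr h h'
    have hr' := (hD.real hr).isRealAt
    obtain ⟨q, hq, hq'⟩ := hr'.exists_gt ((realLt_ofRat_left hr').1 h')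
    exact hr'.disjoint hq' (hD.hi_of_distLt hr (h q hq))

/-- A term with index `k + j` is late enough both for the convergence to z and for the explicit
bound on the distance from x. -/
theorem ConvAt.eq {S : El B (.pow (.prod .nat σ))} [Inh B σ] (hD : ∀ᶠ v in near w, IsMetricAt v X D)
    (hS : w ⊩ isFun (univ .nat) X S) (hz : w ⊩ mem z X) (hx : w ⊩ mem x X) (h : ConvAt w D S z)
    (h' : ∀ᶠ v in near w, ∀ n s, (v ⊩ mem (pair n s) S) → DistLt v D s x (ratInv n)) :
    w ⊩ El.eq z x := by
  refine eq_of_distLt hD hz hx ?_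
  filter_upwards [hD, forces_isFun.1 hS, h, h'] with v hD hS h h' ε hε
  obtain ⟨δ, hδ, hδε⟩ := exists_ratAdd_self_lt hε
  obtain ⟨k, hk⟩ := h δ hδ
  obtain ⟨j, hj⟩ := exists_ratInv_lt hδ
  obtain ⟨s, hs⟩ := hS.total (forces_mem_univ (k + j))
  have h₁ := near_self hk (k + j) (by rw [map_add, Num.le_def]; exact ⟨_, rfl⟩) s hs
  have h₂ := hD.distLt_mono (h' _ s hs) ((ratLt_or_ratLt hj (ratInv (k + j))).resolve_left
    (ratInv_le_ratInv (by rw [map_add, Num.le_def]; exact ⟨_, add_comm _ _⟩)))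
  exact hD.distLt_mono (hD.distLt_triangle (hD.distLt_symm h₁) h₂) hδε

/-- `X` with the metric `D` is a complete metric space in the world `w`. -/
structure IsCompleteAt (w : World B) (X : El B (.pow σ)) (D : El B (distTy σ)) : Prop
    extends IsMetricAt w X D where
  complete : ∀ {S}, (w ⊩ isFun (univ .nat) X S) → CauchyAt w D S →
    ∃ l, (w ⊩ mem l X) ∧ ConvAt w D S l

/-- `Y` contains the limits of the sequences in `Y` that converge in `X`. -/
def IsClosedAt (w : World B) (X : El B (.pow σ)) (D : El B (distTy σ)) (Y : El B (.pow σ)) : Prop :=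
  ∀ {S l}, (w ⊩ isFun (univ .nat) Y S) → (w ⊩ mem l X) → ConvAt w D S l → (w ⊩ mem l Y)

/-- The subset `Y` allows one proof for the whole space and for the closure of two points. The glued
point is a limit, and it belongs to `Y` because `Y` is closed. -/
theorem exists_dist_pos [Inh B σ] (hw : WMPAt w) (hD : ∀ᶠ v in near w, IsCompleteAt v X D)
    {Y : El B (.pow σ)} (hYX : ∀ᶠ v in near w, ∀ x, (v ⊩ mem x Y) → (v ⊩ mem x X))
    (hY : ∀ᶠ v in near w, IsClosedAt v X D Y) {F : El B (.pow (.prod σ realTy))}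
    (hF : w ⊩ isFun Y reals F) {a b : El B realTy} (hxa : w ⊩ mem (pair x a) F)
    (hyb : w ⊩ mem (pair y b) F) (hab : w ⊩ realNe a b) :
    ∃ r, (w ⊩ mem (pair (pair x y) r) D) ∧ (w ⊩ realLt (ofRat ratZero) r) := by
  have hxY := hF.isFunAt.dom hxa
  have hyY := hF.isFunAt.dom hyb
  have hx := near_self hYX x hxY
  have hy := near_self hYX y hyY
  obtain ⟨r, hr⟩ := (near_self hD).total hx hy
  have hr' := (near_self hD).real hr
  obtain ⟨A, hA⟩ := exists_isUniqAt_iff hr'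
  refine ⟨r, hr, (near_self hA).2.2 (forces_inhabited_of_wmpAt hw hF hxa hyb hab
    (hA.mono fun _ => And.left) ?_ ?_)⟩
  · rw [forces_himp]
    filter_upwards [near_near hA, near_near hD, hr.near, hr'.near] with v hA hD hr hr' h
    refine (near_self hD).eq_of_zero hr (eq_of_realLe_of_realLe hr' (isReal_ofRat _ _) ?_ ?_)
    · filter_upwards [hD, hr.near] with u hD hr using hD.nonneg hr
    · filter_upwards [hA, h.near] with u hA h h'
      exact h.false (hA.2.1 h')
  · filter_upwards [near_near hA, near_near hD, hr.near, near_near (forces_isReal.1 hr'),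
      hxY.near, hyY.near, hx.near, hy.near, near_near hYX, near_near hY]
      with w hA hD hr hr' hxY hyY hx hy hYX hY P Q hPQ hφ
    -- The n-th term is x if d(x, y) < 1/(n+1) or P, and y if Q. Two terms can differ only when the
    -- distance of x and y is already small, so the sequence is Cauchy. Under P it is constantly x;
    -- under Q its terms are within 1/(n+1) of y.
    obtain ⟨S, hS, hSf⟩ := forces_choice (w := w) (f := fun n s =>
      ((hi r (ratInv n) ⊔ P) ⊓ El.eq s x) ⊔ (Q ⊓ El.eq s y)) (by
        filter_upwards [hA, hr', hφ.near] with v hA hr' hφ n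
        simp only [forces_sup, forces_inf]
        obtain h | h := hr'.located (ratZero_lt_ratInv v n)
        · obtain h | h := forces_sup.1 (hφ.mp (hA.2.1 ((realLt_ofRat_left hr').2 h)))
          · exact ⟨x, Or.inl ⟨Or.inr h, forces_eq_refl _ _⟩⟩
          · exact ⟨y, Or.inr ⟨h, forces_eq_refl _ _⟩⟩
        · exact ⟨x, Or.inl ⟨Or.inl h, forces_eq_refl _ _⟩⟩)
    simp only [forces_sup, forces_inf] at hSf
    have hSY : w ⊩ isFun (univ .nat) Y S := by
      rw [forces_isFun] at hS ⊢
      filter_upwards [hS, hSf, hxY.near, hyY.near] with v hS hSf hxY hyY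
      refine ⟨hS.dom, fun {n s} h => ?_, hS.total, hS.unique⟩
      obtain h | h := hSf n s h
      · exact forces_mem_of_eq h.2.symm hxY
      · exact forces_mem_of_eq h.2.symm hyY
    have hSX : w ⊩ isFun (univ .nat) X S := by
      rw [forces_isFun] at hSY ⊢
      filter_upwards [hSY, hYX] with v hS hYX using hS.mono_cod hYX
    have hC : CauchyAt w D S := by
      filter_upwards [near_near hSf, near_near hD, hr.near, near_near hr', hx.near, hy.near,
        hPQ.near] with v hSf hD hr hr' hx hy hPQ ε hε
      obtain ⟨k, hk⟩ := exists_ratInv_lt hε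
      refine ⟨k, ?_⟩
      filter_upwards [hSf, hD, hr.near, hr', hx.near, hy.near, hPQ.near, hε.near, hk.near]
        with u hSf hD hr hr' hx hy hPQ hε hk m n hm hn s t hs ht
      have hi' : ∀ {m}, num u k ≤ num u m → (u ⊩ hi r (ratInv m)) → DistLt u D x y ε :=
        fun hm h => hD.distLt_of_hi hr (hr'.hi_of_lt ((ratLt_or_ratLt hk _).resolve_left
          (ratInv_le_ratInv hm)) h)
      obtain ⟨hs, hs'⟩ | ⟨hs, hs'⟩ := hSf m s hs <;> obtain ⟨ht, ht'⟩ | ⟨ht, ht'⟩ := hSf n t ht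
      · exact (hD.distLt_self hx hε).congr hs'.symm ht'.symm
      · obtain hs | hs := hs
        · exact (hi' hm hs).congr hs'.symm ht'.symm
        · exact (hPQ.false (forces_inf.2 ⟨hs, ht⟩)).elim
      · obtain ht | ht := ht
        · exact (hD.distLt_symm (hi' hn ht)).congr hs'.symm ht'.symm
        · exact (hPQ.false (forces_inf.2 ⟨ht, hs⟩)).elim
      · exact (hD.distLt_self hy hε).congr hs'.symm ht'.symm
    obtain ⟨z, hz, hSz⟩ := (near_self hD).complete hSX hC
    have hD' : ∀ᶠ v in near w, IsMetricAt v X D := hD.mono fun _ h => h.toIsMetricAt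
    refine ⟨z, near_self hY hSY hz hSz, ?_, ?_⟩
    · rw [forces_himp]
      filter_upwards [near_near hSf, near_near hD', hx.near, hz.near, hPQ.near, hSX.near,
        near_near hSz] with v hSf hD hx hz hPQ hSX hSz hP
      refine ConvAt.eq hD hSX hz hx hSz ?_
      filter_upwards [hSf, hD, hx.near, hPQ.near, hP.near] with u hSf hD hx hPQ hP n s hs
      obtain ⟨-, hs⟩ | ⟨hQ, hs⟩ := hSf n s hs
      · exact (hD.distLt_self hx (ratZero_lt_ratInv _ _)).congr hs.symm (forces_eq_refl _ _)
      · exact (hPQ.false (forces_inf.2 ⟨hP, hQ⟩)).elim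
    · rw [forces_himp]
      filter_upwards [near_near hSf, near_near hD', hy.near, hz.near, hPQ.near, hSX.near,
        near_near hSz, hr.near] with v hSf hD hy hz hPQ hSX hSz hr hQ
      refine ConvAt.eq hD hSX hz hy hSz ?_
      filter_upwards [hSf, hD, hy.near, hPQ.near, hQ.near, hr.near]
        with u hSf hD hy hPQ hQ hr n s hs
      obtain ⟨h | hP, hs⟩ | ⟨hQ, hs⟩ := hSf n s hs
      · exact (hD.distLt_of_hi hr h).congr hs.symm (forces_eq_refl _ _)
      · exact (hPQ.false (forces_inf.2 ⟨hP, hQ⟩)).elim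
      · exact (hD.distLt_self hy (ratZero_lt_ratInv _ _)).congr hs.symm (forces_eq_refl _ _)

end

end El

section
variable {σ : Ty} [Inh B σ] {w : World B} {Γ : Ctx} {ρ : Env B Γ} {X : Tm Γ (.pow σ)}
  {D : Tm Γ (distTy σ)}

theorem isClosedAt_closurePair {a b : Tm Γ σ} {Y : El B (.pow σ)} {E : El B (distTy σ)}
    (hX : ev X ρ = Y) (hE : ev D ρ = E) (hD : ∀ᶠ v in near w, IsMetricAt v Y E) :
    IsClosedAt w Y E (ev (closurePair X D a b) ρ) := by
  subst hX hE
  intro S l hS hl h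
  refine forces_mem_closurePair.2 ⟨hl, ?_⟩
  filter_upwards [hD, forces_isFun.1 hS, h] with v hD hS h ε hε
  obtain ⟨δ, hδ, hδε⟩ := exists_ratAdd_self_lt hε
  obtain ⟨k, hk⟩ := h δ hδ
  obtain ⟨s, hs⟩ := hS.total (forces_mem_univ k)
  obtain ⟨y, hy, hsy⟩ := near_self (forces_mem_closurePair.1 (hS.cod hs)).2 δ hδ
  have := near_self hk k le_rfl s hs
  exact ⟨y, hy, hD.distLt_mono (hD.distLt_triangle (hD.distLt_symm this) hsy) hδε⟩

theorem forces_isCompleteMetric_iff : (w ⊩ ev (IsCompleteMetric X D) ρ) ↔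
    ∀ᶠ v in near w, IsCompleteAt v (ev X ρ) (ev D ρ) := by
  rw [forces_isCompleteMetric]
  exact Filter.eventually_congr (near_of_forall fun v =>
    ⟨fun h => ⟨h.1, h.2 _⟩, fun h => ⟨h.1, fun _ => h.2⟩⟩)

end

/-! ### From weak Markov's principle to complete metric spaces -/

section
variable {σ : Ty} [Inh B σ] {w : World B}

theorem forces_seComplete_of_wmpAt (hw : WMPAt w) : w ⊩ ev (SEComplete σ) Env.nil := by
  simp only [SEComplete, forces_ev_all, ev_imp, forces_himp, near_forall_near]
  filter_upwards [near_near hw] with v hw X D hD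
  rw [forces_isCompleteMetric_iff] at hD
  rw [forces_allStronglyExtensional]
  filter_upwards [near_near hw, near_near hD] with v hw hD F hF x y a b hxa hyb hab
  rw [forces_mem_metricNeSet]
  exact exists_dist_pos hw hD (near_of_forall fun _ _ h => h) (near_of_forall fun _ _ _ _ h _ => h)
    hF hxa hyb hab

theorem forces_seClosurePair_of_wmpAt (hw : WMPAt w) : w ⊩ ev (SEClosurePair σ) Env.nil := by
  simp only [SEClosurePair, forces_ev_all, ev_imp, forces_himp, near_forall_near]
  filter_upwards [near_near hw] with v hw X D hD
  rw [forces_isCompleteMetric_iff] at hD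
  filter_upwards [near_near hw, near_near hD] with v hw hD c _
  filter_upwards [near_near hw, near_near hD] with v hw hD d _
  rw [forces_allStronglyExtensional]
  filter_upwards [near_near hw, near_near hD] with v hw hD F hF x y a b hxa hyb hab
  rw [forces_mem_metricNeSet]
  simp only [ev_w, ev_var_zero] at hD ⊢
  refine exists_dist_pos hw hD ?_ ?_ hF hxa hyb hab
  · exact near_of_forall fun _ _ h => by
      simpa only [ev_w, ev_var_zero] using (forces_mem_closurePair.1 h).1
  · filter_upwards [near_near hD] with u hD
    exact isClosedAt_closurePair (by simp only [ev_w, ev_var_zero]) (by simp only [ev_w, ev_var_zero])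
      (hD.mono fun _ h => h.toIsMetricAt)

end

/-- `φ` is built from a formula that begins with a quantifier over `σ` by universal quantifications
and implications. -/
inductive BindsAll (σ : Ty) : {Γ : Ctx} → Fm Γ → Prop
  | here {Γ : Ctx} (φ : Fm (σ :: Γ)) : BindsAll σ (.all σ φ)
  | all {Γ : Ctx} (τ : Ty) {φ : Fm (τ :: Γ)} : BindsAll σ φ → BindsAll σ (.all τ φ)
  | imp {Γ : Ctx} (ψ : Fm Γ) {φ : Fm Γ} : BindsAll σ φ → BindsAll σ (ψ ⇛ φ)

/-- A point of `σ` may be assumed when proving such a formula, since its own quantifier over `σ`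
eventually provides one. This covers the types for which no closed term is available. -/
theorem BindsAll.derives {σ : Ty} {Γ : Ctx} {φ : Fm Γ} (hφ : BindsAll σ φ) {H : Set (Fm Γ)}
    (h : Derives (Tm.w (τ := σ) '' H) φ.w) : Derives H φ := by
  induction hφ with
  | here φ =>
    refine .allI ?_
    have := Derives.allE (.var .zero) h
    have e : (φ.rename (liftRen (fun _ x => .succ x) σ)).inst (.var .zero) = φ := by
      rw [Tm.inst, Tm.subst_rename]
      refine Eq.trans ?_ φ.subst_var
      congr 1; funext τ x; cases x <;> rfl
    rwa [e] at this
  | @all Γ τ φ _ ih =>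
    refine .allI (ih ?_)
    have := h.rename (liftRen (fun _ x => .succ x) σ)
      (H' := Tm.w (τ := σ) '' (Tm.w (τ := τ) '' H)) (by
        rintro _ ⟨ψ, hψ, rfl⟩
        rw [Tm.w_rename]
        exact ⟨_, ⟨ψ, hψ, rfl⟩, rfl⟩)
    have := Derives.allE (.var (.succ .zero)) this
    have e : ((φ.rename (liftRen (fun _ x => .succ x) τ)).rename
        (liftRen (liftRen (fun _ x => .succ x) σ) τ)).inst (.var (.succ .zero)) =
        φ.w (τ := σ) := by
      rw [Tm.w, Tm.inst, Tm.rename_rename, Tm.subst_rename, Tm.rename_eq_subst]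
      congr 1; funext τ x; cases x <;> rfl
    exact e ▸ this
  | imp ψ _ ih =>
    refine .impI (ih ?_)
    exact .impE (h.mono (Set.image_mono (Set.subset_insert _ _)))
      (.hyp ⟨ψ, Set.mem_insert _ _, rfl⟩)

theorem bindsAll_seComplete (σ : Ty) : BindsAll σ (SEComplete σ) :=
  .all _ (.all _ (.imp _ (.all _ (.imp _ (.here _)))))

theorem bindsAll_seClosurePair (σ : Ty) : BindsAll σ (SEClosurePair σ) :=
  .all _ (.all _ (.imp _ (.here _)))

instance {σ : Ty} : Inh [σ] σ := ⟨⟨.var .zero⟩⟩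

theorem derives_seComplete (σ : Ty) : Derives {WMP} (SEComplete σ) := by
  refine (bindsAll_seComplete σ).derives ?_
  rw [Set.image_singleton]
  exact derives_w_of_forces fun w h => forces_seComplete_of_wmpAt (wmpAt_of_forces h)

theorem derives_seClosurePair (σ : Ty) : Derives {WMP} (SEClosurePair σ) := by
  refine (bindsAll_seClosurePair σ).derives ?_
  rw [Set.image_singleton]
  exact derives_w_of_forces fun w h => forces_seClosurePair_of_wmpAt (wmpAt_of_forces h)

end BISH

namespace BISH

open El

variable {B : Ctx}

/-! ### Two points at a given distance -/

namespace El

section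
variable {w : World B} {x : El B realTy}

theorem hi_right_of_hi_realAdd {r s : El B realTy} {q : El B ratTy} (hr : IsRealAt w r)
    (hs : IsRealAt w s) (h₀ : ¬ (w ⊩ hi r ratZero)) (h : w ⊩ hi (realAdd r s) q) : w ⊩ hi s q := by
  simp only [realAdd, hi_pair, mem_compr, forces_exi, forces_inf] at h
  obtain ⟨p, hp, t, ht, h⟩ := h
  obtain ⟨p', hp', hpr⟩ := hr.exists_lt hp
  have := (ratLt_or_ratLt hp' ratZero).resolve_left fun h => h₀ (hr.hi_of_lt h hpr)
  exact hs.hi_of_lt (ratLt_trans (lt_ratAdd_right this) h) ht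

theorem hi_left_of_hi_realAdd {r s : El B realTy} {q : El B ratTy} (hr : IsRealAt w r)
    (hs : IsRealAt w s) (h₀ : ¬ (w ⊩ hi s ratZero)) (h : w ⊩ hi (realAdd r s) q) : w ⊩ hi r q := by
  simp only [realAdd, hi_pair, mem_compr, forces_exi, forces_inf] at h
  obtain ⟨p, hp, t, ht, h⟩ := h
  obtain ⟨t', ht', hts⟩ := hs.exists_lt ht
  have := (ratLt_or_ratLt ht' ratZero).resolve_left fun h => h₀ (hs.hi_of_lt h hts)
  exact hr.hi_of_lt (ratLt_trans (lt_ratAdd_left this) h) hp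

/-- The distance on `{0, 1}` for which `0` and `1` have distance `x`. -/
noncomputable def twoDist (x : El B realTy) : El B (distTy .nat) :=
  compr fun p => (mem p.fst.fst two ⊓ mem p.fst.snd two) ⊓
    ((El.eq p.fst.fst p.fst.snd ⊓ El.eq p.snd (ofRat ratZero)) ⊔
      ((El.eq p.fst.fst p.fst.snd)ᶜ ⊓ El.eq p.snd x))

theorem mem_twoDist {i j : El B .nat} {r : El B realTy} :
    (w ⊩ mem (pair (pair i j) r) (twoDist x)) ↔ ((w ⊩ mem i two) ∧ (w ⊩ mem j two)) ∧
      ((w ⊩ El.eq i j) ∧ (w ⊩ El.eq r (ofRat ratZero)) ∨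
        (w ⊩ (El.eq i j)ᶜ) ∧ (w ⊩ El.eq r x)) := by
  simp only [twoDist, mem_compr, forces_inf, forces_sup, fst_pair, snd_pair]

theorem eq_or_eq_of_mem_two {i j k : El B .nat} (hi : w ⊩ mem i two) (hj : w ⊩ mem j two)
    (hk : w ⊩ mem k two) (hik : w ⊩ (El.eq i k)ᶜ) :
    (w ⊩ El.eq i j) ∧ (w ⊩ (El.eq j k)ᶜ) ∨ (w ⊩ (El.eq i j)ᶜ) ∧ (w ⊩ El.eq j k) := by
  obtain h | h := eq_or_compl w i j
  · exact Or.inl ⟨h, h.subst (fun i => (El.eq i k)ᶜ) hik⟩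
  · refine Or.inr ⟨h, ?_⟩
    rw [forces_mem_two] at hi hj hk
    have h₁ : num w i ≠ num w j := fun h' => h.false (num_eq_num.1 h')
    have h₂ : num w i ≠ num w k := fun h' => hik.false (num_eq_num.1 h')
    rw [← num_eq_num]
    grind

theorem eq_compl_symm {i j : El B .nat} (h : w ⊩ (El.eq i j)ᶜ) : w ⊩ (El.eq j i)ᶜ := by
  rw [forces_compl] at *
  filter_upwards [h] with v h h' using h h'.symm

/-- The condition `hne` is needed because distance 0 must imply equality. In the triangle inequality
for i ≠ k the middle point equals one end, so one of the two summands is already x and the other is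
not negative. -/
theorem isMetricAt_twoDist (hx : w ⊩ isReal x) (h₀ : ¬ (w ⊩ hi x ratZero))
    (hne : ¬ (w ⊩ El.eq x (ofRat ratZero))) : IsMetricAt w two (twoDist x) := by
  have real₀ := isReal_ofRat w ratZero
  have key : ∀ {i j r}, (w ⊩ mem (pair (pair i j) r) (twoDist x)) → IsRealAt w r ∧
      (w ⊩ isReal r) ∧ ¬ (w ⊩ hi r ratZero) := by
    intro i j r h
    obtain ⟨-, h⟩ | ⟨-, h⟩ := (mem_twoDist.1 h).2
    · have := h.symm.subst isReal real₀
      refine ⟨this.isRealAt, this, fun h' => ratLt_irrefl (w := w) (p := ratZero) ?_⟩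
      rw [← hi_ofRat]
      exact h.subst (fun r => hi r ratZero) h'
    · have := h.symm.subst isReal hx
      exact ⟨this.isRealAt, this, fun h' => h₀ (h.subst (fun r => hi r ratZero) h')⟩
  constructor
  · exact fun h => (mem_twoDist.1 h).1.1
  · exact fun h => (mem_twoDist.1 h).1.2
  · exact fun h => (key h).2.1
  · intro i j hi hj
    simp only [mem_twoDist]
    exact (eq_or_compl w i j).elim (fun h => ⟨_, ⟨hi, hj⟩, Or.inl ⟨h, forces_eq_refl _ _⟩⟩)
      fun h => ⟨_, ⟨hi, hj⟩, Or.inr ⟨h, forces_eq_refl _ _⟩⟩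
  · intro i j r s hr hs
    obtain hr | hr := (mem_twoDist.1 hr).2 <;> obtain hs | hs := (mem_twoDist.1 hs).2
    · exact hr.2.trans hs.2.symm
    · exact (hs.1.false hr.1).elim
    · exact (hr.1.false hs.1).elim
    · exact hr.2.trans hs.2.symm
  · exact fun h h' => (key h).2.2 ((realLt_ofRat_right (key h).1).1 h')
  · intro i j r h h'
    exact (mem_twoDist.1 h).2.elim And.left fun h => (hne (h.2.symm.trans h')).elim
  · intro i j r h h'
    exact (mem_twoDist.1 h).2.elim And.right fun h => (h.1.false h').elim
  · intro i j r h
    rw [mem_twoDist] at h ⊢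
    exact ⟨h.1.symm, h.2.imp (And.imp_left Forces.symm) (And.imp_left eq_compl_symm)⟩
  · intro i j k r s t hr hs ht h
    obtain ⟨q, hq, hq'⟩ := forces_realLt.1 h
    have hr' := key hr
    have hs' := key hs
    have hq₁ := hi_left_of_hi_realAdd hr'.1 hs'.1 hs'.2.2 hq
    have hq₂ := hi_right_of_hi_realAdd hr'.1 hs'.1 hr'.2.2 hq
    have ht' := (key ht).1
    rw [mem_twoDist] at hr hs ht
    obtain ⟨hik, ht⟩ | ⟨hik, ht⟩ := ht.2
    · have := ht.subst (fun r => lo r q) hq'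
      rw [lo_ofRat] at this
      exact hr'.2.2 (hr'.1.hi_of_lt this hq₁)
    · obtain h | h := eq_or_eq_of_mem_two hr.1.1 hr.1.2 hs.1.2 hik
      · have h' := hs.2.resolve_left fun h' => h.2.false h'.1
        exact ht'.disjoint hq' ((h'.2.trans ht.symm).subst (fun r => hi r q) hq₂)
      · have h' := hr.2.resolve_left fun h' => h.1.false h'.1
        exact ht'.disjoint hq' ((h'.2.trans ht.symm).subst (fun r => hi r q) hq₁)

/-- The sequence `S` is eventually equal to `i`. -/
noncomputable def tail (S : El B seqTy) (i : El B .nat) : Om B :=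
  exi fun k => fal fun n => natLe k n ⇨ mem (pair n i) S

theorem forces_tail {S : El B seqTy} {i : El B .nat} : (w ⊩ tail S i) ↔
    ∃ k, ∀ᶠ v in near w, ∀ n, num v k ≤ num v n → (v ⊩ mem (pair n i) S) := by
  simp only [tail, forces_exi, forces_fal, forces_himp, near_forall_near]
  simp only [forces_natLe]

theorem not_tail_and_tail {S : El B seqTy} {C : El B (.pow .nat)} (hS : IsFunAt w (univ .nat) C S)
    {i j : El B .nat} (hij : ¬ (w ⊩ El.eq i j)) (hi : w ⊩ tail S i) : ¬ (w ⊩ tail S j) := by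
  intro hj
  obtain ⟨k, hk⟩ := forces_tail.1 hi
  obtain ⟨l, hl⟩ := forces_tail.1 hj
  refine hij (hS.unique (x := k + l) (near_self hk _ ?_) (near_self hl _ ?_))
  · rw [map_add, Num.le_def]; exact ⟨_, rfl⟩
  · rw [map_add, Num.le_def]; exact ⟨_, add_comm _ _⟩

theorem mem_two_iff_eq {i : El B .nat} :
    (w ⊩ mem i two) ↔ (w ⊩ El.eq i 0) ∨ (w ⊩ El.eq i 1) := by
  rw [forces_mem_two, ← num_eq_num, ← num_eq_num, map_zero, map_one]

theorem zero_mem_two : w ⊩ mem (0 : El B .nat) two :=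
  forces_mem_two.2 (Or.inl (map_zero _))

theorem one_mem_two : w ⊩ mem (1 : El B .nat) two :=
  forces_mem_two.2 (Or.inr (map_one _))

/-- If x > 0, a Cauchy sequence is eventually constant, with value 1 or 0, and these cases exclude
each other. Splitting therefore selects a value that is, up to double negation, the eventual one;
this value is the limit. -/
theorem isCompleteAt_twoDist (hx : w ⊩ isReal x) (h₀ : ∀ᶠ v in near w, ¬ (v ⊩ hi x ratZero))
    (hs : w ⊩ split (realLt (ofRat ratZero) x)) :
    IsCompleteAt w two (twoDist x) := by
  have hne : ∀ᶠ v in near w, ¬ (v ⊩ El.eq x (ofRat ratZero)) := by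
    rw [← forces_compl]
    refine forces_compl_of_compl_compl (compl_compl_of_split hs) (near_of_forall fun v h h' => ?_)
    exact not_realLt_self (isReal_ofRat v ratZero).isRealAt
      (h'.subst (fun x => realLt (ofRat ratZero) x) h)
  have hm : ∀ᶠ v in near w, IsMetricAt v two (twoDist x) := by
    filter_upwards [hx.near, h₀, hne] with v hx h₀ hne using isMetricAt_twoDist hx h₀ hne
  refine ⟨near_self hm, fun {S} hS hC => ?_⟩
  have hS' := forces_isFun.1 hS
  have hx' := forces_isReal.1 hx
  have htail : Dfn fun i => tail S i := by unfold tail; infer_instance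
  have hor : ∀ᶠ v in near w, (v ⊩ realLt (ofRat ratZero) x) → (v ⊩ tail S 1) ∨ (v ⊩ tail S 0) := by
    filter_upwards [near_near hx', near_near hm, near_near hS', hC] with v hx' hm hS' hC h
    have hx₁ := near_self hx'
    obtain ⟨q, hq, hq'⟩ := hx₁.exists_gt ((realLt_ofRat_left hx₁).1 h)
    obtain ⟨k, hk⟩ := hC q hq
    obtain ⟨i, hi⟩ := (near_self hS').total (forces_mem_univ k)
    have : v ⊩ tail S i := by
      refine forces_tail.2 ⟨k, ?_⟩
      filter_upwards [hk, hx', hm, hS', hi.near, hq'.near] with u hk hx' hm hS' hi hq' n hn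
      obtain ⟨j, hj⟩ := hS'.total (forces_mem_univ n)
      obtain ⟨r, hr, hrq⟩ := hk k n le_rfl hn i j hi hj
      obtain h | h := (mem_twoDist.1 hr).2
      · exact h.1.symm.subst (fun i => mem (pair n i) S) hj
      · rw [realLt_ofRat_right (hm.real hr).isRealAt] at hrq
        exact (hx'.disjoint hq' (h.2.subst (fun r => El.hi r q) hrq)).elim
    obtain h | h := forces_mem_two.1 ((near_self hS').cod hi)
    · rw [← map_zero (num v), num_eq_num] at h
      exact Or.inr (h.subst (fun i => tail S i) this)
    · rw [← map_one (num v), num_eq_num] at h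
      exact Or.inl (h.subst (fun i => tail S i) this)
  have hconv : ∀ {i j : El B .nat}, (w ⊩ mem i two) → (∀ᶠ v in near w, ¬ (v ⊩ El.eq i j)) →
      (∀ᶠ v in near w, (v ⊩ realLt (ofRat ratZero) x) → (v ⊩ tail S i) ∨ (v ⊩ tail S j)) →
      (w ⊩ (tail S i)ᶜᶜ) → ConvAt w (twoDist x) S i := by
    intro i j hi hij hor h
    have hj : w ⊩ (tail S j)ᶜ := forces_compl_of_compl_compl h (by
      filter_upwards [hij, hS'] with v hij hS' h using not_tail_and_tail hS' hij h)
    filter_upwards [near_near hx', near_near hm, near_near hS', hor, hj.near, hi.near]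
      with v hx' hm hS' hor hj hi ε hε
    have hx₁ := near_self hx'
    -- If 0 < x, the sequence is eventually constant, and the other value has been excluded. If x <
    -- ε, all points are within ε of each other, and any index will do.
    obtain h | h := hx₁.located hε
    · have := (hor ((realLt_ofRat_left hx₁).2 h)).resolve_right hj.false
      obtain ⟨k, hk⟩ := forces_tail.1 this
      refine ⟨k, ?_⟩
      filter_upwards [hk, hm, hS', hε.near, hi.near] with u hk hm hS' hε hi n hn s hs
      exact (hm.distLt_self hi hε).congr (hS'.unique (hk n hn) hs) (forces_eq_refl _ _)
    · refine ⟨0, ?_⟩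
      filter_upwards [hm, hS', hε.near, hi.near, h.near] with u hm hS' hε hi h n _ s hs
      obtain ⟨r, hr⟩ := hm.total (hS'.cod hs) hi
      refine hm.distLt_of_hi hr ?_
      obtain h' | h' := (mem_twoDist.1 hr).2
      · refine h'.2.symm.subst (fun r => El.hi r ε) ?_
        rwa [hi_ofRat]
      · exact h'.2.symm.subst (fun r => El.hi r ε) h
  have hdisj : w ⊩ (tail S 1 ⊓ tail S 0)ᶜ := by
    rw [forces_compl]
    filter_upwards [hS'] with v hS' h
    exact not_tail_and_tail hS' not_one_eq_zero (forces_inf.1 h).1 (forces_inf.1 h).2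
  obtain h | h := near_self (forces_split.1 hs) _ _ hdisj (forces_himp.2 (hor.mono fun v h h' =>
    forces_sup.2 (h h')))
  · exact ⟨1, one_mem_two, hconv one_mem_two (near_of_forall fun v => not_one_eq_zero) hor h⟩
  · exact ⟨0, zero_mem_two, hconv zero_mem_two
      (near_of_forall fun v h => not_one_eq_zero h.symm)
      (hor.mono fun _ h h' => (h h').symm) h⟩

/-- The inclusion of `{0, 1}` in the real numbers. -/
noncomputable def twoReal : El B (.pow (.prod .nat realTy)) :=
  compr fun p => (El.eq p.fst 0 ⊓ El.eq p.snd (ofRat ratZero)) ⊔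
    (El.eq p.fst 1 ⊓ El.eq p.snd (ofRat ratOne))

theorem mem_twoReal {i : El B .nat} {r : El B realTy} : (w ⊩ mem (pair i r) twoReal) ↔
    (w ⊩ El.eq i 0) ∧ (w ⊩ El.eq r (ofRat ratZero)) ∨
      (w ⊩ El.eq i 1) ∧ (w ⊩ El.eq r (ofRat ratOne)) := by
  simp only [twoReal, mem_compr, forces_sup, forces_inf, fst_pair, snd_pair]

theorem isFunAt_twoReal {C : El B (.pow .nat)} (hC : ∀ i, (w ⊩ mem i C) ↔ (w ⊩ mem i two)) :
    IsFunAt w C reals twoReal := by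
  constructor
  · intro i r h
    rw [hC, mem_two_iff_eq]
    exact (mem_twoReal.1 h).imp And.left And.left
  · intro i r h
    rw [forces_mem_reals]
    exact (mem_twoReal.1 h).elim (fun h => h.2.symm.subst isReal (isReal_ofRat _ _))
      fun h => h.2.symm.subst isReal (isReal_ofRat _ _)
  · intro i h
    rw [hC, mem_two_iff_eq] at h
    simp only [mem_twoReal]
    exact h.elim (fun h => ⟨_, Or.inl ⟨h, forces_eq_refl _ _⟩⟩)
      fun h => ⟨_, Or.inr ⟨h, forces_eq_refl _ _⟩⟩
  · intro i r s hr hs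
    obtain hr | hr := mem_twoReal.1 hr <;> obtain hs | hs := mem_twoReal.1 hs
    · exact hr.2.trans hs.2.symm
    · exact (not_one_eq_zero (hs.1.symm.trans hr.1)).elim
    · exact (not_one_eq_zero (hr.1.symm.trans hs.1)).elim
    · exact hr.2.trans hs.2.symm

theorem wmpAt_of_twoDist (h : ∀ᶠ v in near w, ∀ x : El B realTy, (v ⊩ isReal x) →
    (∀ᶠ u in near v, IsCompleteAt u two (twoDist x)) →
      ∃ r, (v ⊩ mem (pair (pair 0 1) r) (twoDist x)) ∧ (v ⊩ realLt (ofRat ratZero) r)) :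
    WMPAt w := by
  filter_upwards [h] with v h A hA hs
  have hx := isReal_elemReal hA
  obtain ⟨r, hr, hr'⟩ := h _ hx (by
    filter_upwards [hx.near, near_near hA, hs.near] with u hx hA hs
    refine isCompleteAt_twoDist hx ?_ (split_congr ?_ hs)
    · filter_upwards [near_near hA] with t hA
      exact (near_self (forces_mem_unitInterval.1 (elemReal_mem_unitInterval hA))).2.1
    · filter_upwards [near_near hA] with t hA using (elemReal_pos_iff hA).symm)
  obtain h' | h' := (mem_twoDist.1 hr).2
  · exact (not_one_eq_zero h'.1.symm).elim
  · exact (elemReal_pos_iff hA).1 (h'.2.subst (fun r => realLt (ofRat ratZero) r) hr')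

end

end El

/-! ### From two-point spaces to weak Markov's principle -/

section
variable {w : World B}

theorem realNe_zero_one (w : World B) :
    w ⊩ El.realNe (El.ofRat El.ratZero) (El.ofRat El.ratOne) :=
  forces_realNe.2 (Or.inl ((realLt_ofRat_left (isReal_ofRat _ _).isRealAt).2
    (by rw [lo_ofRat]; exact ratZero_lt_ratOne _)))

theorem wmpAt_of_seComplete (h : w ⊩ ev (SEComplete .nat) Env.nil) : WMPAt w := by
  simp only [SEComplete, forces_ev_all, ev_imp, forces_himp, near_forall_near,
    forces_isCompleteMetric_iff] at h
  refine wmpAt_of_twoDist ?_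
  filter_upwards [h] with v h x hx hc
  have := h El.two (twoDist x) (by simpa only [ev_w, ev_var_zero] using hc)
  rw [forces_allStronglyExtensional] at this
  have := near_self this twoReal (forces_isFun.2 (near_of_forall fun u => isFunAt_twoReal
    fun i => by simp only [ev_w, ev_var_zero])) 0 1 _ _
    (mem_twoReal.2 (Or.inl ⟨forces_eq_refl _ _, forces_eq_refl _ _⟩))
    (mem_twoReal.2 (Or.inr ⟨forces_eq_refl _ _, forces_eq_refl _ _⟩)) (realNe_zero_one v)
  rw [forces_mem_metricNeSet] at this
  simpa only [ev_var_zero] using this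

theorem wmpAt_of_seClosurePair (h : w ⊩ ev (SEClosurePair .nat) Env.nil) : WMPAt w := by
  simp only [SEClosurePair, forces_ev_all, ev_imp, forces_himp, near_forall_near,
    forces_isCompleteMetric_iff, ev_mem, ev_w, ev_var_zero] at h
  refine wmpAt_of_twoDist ?_
  filter_upwards [h] with v h x hx hc
  have := near_self (near_self (h El.two (twoDist x) hc) 0 zero_mem_two) 1 one_mem_two
  rw [forces_allStronglyExtensional] at this
  have := near_self this twoReal (forces_isFun.2 ((near_near hc).mono fun u hc => isFunAt_twoReal
    fun i => ?_)) 0 1 _ _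
    (mem_twoReal.2 (Or.inl ⟨forces_eq_refl _ _, forces_eq_refl _ _⟩))
    (mem_twoReal.2 (Or.inr ⟨forces_eq_refl _ _, forces_eq_refl _ _⟩)) (realNe_zero_one v)
  · rw [forces_mem_metricNeSet] at this
    simpa only [ev_w, ev_var_zero] using this
  -- The closure of {0, 1} is the whole two-point space, so the same function can be used.
  · rw [forces_mem_closurePair]
    simp only [ev_w, ev_var_zero]
    refine ⟨And.left, fun hi => ⟨hi, ?_⟩⟩
    filter_upwards [hc, hi.near] with t hc hi ε hε
    exact ⟨i, mem_two_iff_eq.1 hi, hc.distLt_self hi hε⟩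

end

theorem equivalent_wmp_seComplete : Equivalent {WMP} (Set.range SEComplete) := by
  refine ⟨?_, fun φ hφ => ?_⟩
  · rintro _ ⟨σ, rfl⟩
    exact derives_seComplete σ
  · rw [Set.mem_singleton_iff.1 hφ]
    refine Derives.mono (derives_sentence_of_forces fun w h =>
      forces_wmp_of_wmpAt (wmpAt_of_seComplete h)) (Set.singleton_subset_iff.2 ⟨.nat, rfl⟩)

theorem equivalent_wmp_seClosurePair : Equivalent {WMP} (Set.range SEClosurePair) := by
  refine ⟨?_, fun φ hφ => ?_⟩
  · rintro _ ⟨σ, rfl⟩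
    exact derives_seClosurePair σ
  · rw [Set.mem_singleton_iff.1 hφ]
    refine Derives.mono (derives_sentence_of_forces fun w h =>
      forces_wmp_of_wmpAt (wmpAt_of_seClosurePair h)) (Set.singleton_subset_iff.2 ⟨.nat, rfl⟩)

end BISH

/-- Over intuitionistic higher-order arithmetic with countable choice, weak Markov's principle is
equivalent to each of the six statements on strong extensionality.  The statements about all complete
metric spaces are families of sentences, one for each type of points. -/
theorem proposition2p2p7 :
    BISH.Equivalent {BISH.WMP} (Set.range BISH.SEComplete) ∧
    BISH.Equivalent {BISH.WMP} {BISH.SEBaire} ∧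
    BISH.Equivalent {BISH.WMP} {BISH.SECantor} ∧
    BISH.Equivalent {BISH.WMP} {BISH.SENatInfty} ∧
    BISH.Equivalent {BISH.WMP} {BISH.SEUnitInterval} ∧
    BISH.Equivalent {BISH.WMP} (Set.range BISH.SEClosurePair) := by
  exact ⟨BISH.equivalent_wmp_seComplete, BISH.equivalent_wmp_seBaire, BISH.equivalent_wmp_seCantor,
    BISH.equivalent_wmp_seNatInfty, BISH.equivalent_wmp_seUnitInterval,
    BISH.equivalent_wmp_seClosurePair⟩
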